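/- **Setting.** Let $\mathbf Q=\{0,\dots,N-1\}$ be a finite set of qubits. For a one-qubit operator $U$ write $U_{(i)}$ for $U$ acting on qubit $i$, and $CX_{(i,j)}$ for the controlled-$X$ gate with control $i$ and target $j$. Programs are $$C ::= \mathtt{skip}\mid C;C'\mid U(i)\mid T(i)\mid CX(i,j)\ (i\ne j)\mid \mathtt{if}\ i\ \mathtt{then}\ C\ \mathtt{else}\ C'\mid \mathtt{while}\ i\ \mathtt{do}\ C,\qquad U\in\{X,Y,Z,H,S\}.$$ With $P^b_i=(|b\rangle\langle b|)_{(i)}$, their concrete semantics on partial density matrices (positive semidefinite $2^N\times 2^N$ matrices of trace at most $1$) is $[\![\mathtt{skip}]\!](\rho)=\rho$, $[\![C;C']\!](\rho)=[\![C']\!]([\![C]\!](\rho))$, $[\![V]\!](\rho)=V\rho V^\dagger$ for a gate $V$, $$[\![\mathtt{if}\ i\ \mathtt{then}\ C\ \mathtt{else}\ C']\!](\rho)=[\![C]\!](P^0_i\rho P^0_i)+[\![C']\!](P^1_i\rho P^1_i),$$ $$[\![\mathtt{while}\ i\ \mathtt{do}\ C]\!](\rho)=\sum_{n\ge 0}P^1_i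 f^n(\rho)P^1_i,\qquad f(\rho)=[\![C]\!](P^0_i\rho P^0_i).$$ **Assignments.** Signs of Pauli operators are disregarded. A stabilizer on a set $A$ of qubits is a group $S$ of pairwise commuting tensor products of $I,X,Y,Z$ on $A$ (multiplied up to phase) with $|A|$ independent generators. A label on $A$ is the symbol $\blacksquare$, or a stabilizer on $A$ that, if $|A|\ge 2$, contains none of $X_{(i)},Y_{(i)},Z_{(i)}$, or, if $|A|=1$, the symbol $\mathrm I$. An assignment $\alpha$ is a partition of $\mathbf Q$ with a label on each of its blocks; $\alpha(i)=(\alpha_0(i),\alpha_1(i))$ denotes the block containing $i$ and its label. We write $\alpha\vDash\rho$ if $$\rho=\sum_k p_k\bigotimes_{(A,S)\in\alpha}\rho^{k,(A,S)}$$ is a finite sum with $p_k\ge 0$, $\sum_k p_k\le 1$, where $\rho^{k,(A,S)}$ is $\tfrac12 I$ if $S=\mathrm I$, an arbitrary density matrix on $A$ if $S=\blacksquare$, and $|\psi\rangle\langle\psi|$ with $\psi$ a unit vector such that $M\psi=\pm\psi$ for every $M\in S$ if $S$ is a stabilizer. **Order.** Put $S\le_s S'$ if $S=\mathrm I$ or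 $S'=\blacksquare$ or $S=S'$. For a union $B$ of blocks of $\alpha$ let $\bigodot_{B}\alpha$ be the label of $B$ if $B$ is a single block, $\mathrm I$ if $B$ is not a single block and all blocks in $B$ have label $\mathrm I$, and $\blacksquare$ otherwise. Put $\alpha\le_c\beta$ if every block $B$ of $\beta$ is a union of blocks of $\alpha$ and $\bigodot_B\alpha\le_s S$ for the label $S$ of $B$. Joins $\bigvee$ are least upper bounds for $\le_c$ (they exist). **Abstract semantics.** Write $\alpha[\mathcal B/i]$ for $\alpha$ with the block of $i$ replaced by the labelled blocks $\mathcal B$ (blocks on the empty set are dropped), $\alpha[S/i]$ for $\alpha$ with the label of the block of $i$ replaced by $S$, and $\alpha[S/i,j]$ for $\alpha$ with the blocks of $i$ and $j$ merged into one with label $S$. Unitaries act on stabilizers by conjugation, and $U\mathrm IU^\dagger=\mathrm I$, $U\blacksquare U^\dagger=\blacksquare$, $\blacksquare\otimes S=S\otimes\blacksquare=\blacksquare$. For a list $J$ of qubits let $update(J,A,\blacksquare)=\{(A,\blacksquare)\}$, $update(\emptyset,A,S)=\{(A,S)\}$, and let $update(\{i\}\cup J,A,S)$ be $\{(\{i\},S')\}\cup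 update(J,A\setminus\{i\},S'')$ if $S=S'\otimes S''$ with $S'$ a stabilizer on $\{i\}$ and $S''$ one on $A\setminus\{i\}$, and $update(J,A,S)$ otherwise. Let $meas_i(\alpha)$ be * $\alpha[\langle Z\rangle/i]$ if $|\alpha_0(i)|=1$; * otherwise $\alpha[\{(\{i\},\langle Z\rangle),(\alpha_0(i)\setminus\{i\},\blacksquare)\}/i]$ if $\alpha_1(i)=\blacksquare$; * otherwise $\alpha[update(\alpha_0(i),\alpha_0(i),S')/i]$, where $S'$ is generated by $Z_{(i)}$ and the elements of $\alpha_1(i)$ that commute with $Z_{(i)}$. Then $[\![\mathtt{skip}]\!]_C(\alpha)=\alpha$; $[\![C;C']\!]_C(\alpha)=[\![C']\!]_C([\![C]\!]_C(\alpha))$; $[\![U(i)]\!]_C(\alpha)=\alpha[U_{(i)}\alpha_1(i)U_{(i)}^\dagger/i]$; $[\![T(i)]\!]_C(\alpha)$ is $\alpha$ if $\alpha_1(i)$ is $\mathrm I$ or a stabilizer commuting with $Z_{(i)}$, and $\alpha[\blacksquare/i]$ otherwise; $[\![CX(i,j)]\!]_C(\alpha)$ is given by the first case that applies of 1. $\alpha[update(\{i,j\},\alpha_0(i),CX_{(i,j)}\alpha_1(i)CX_{(i,j)}^\dagger)/i]$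 if $\alpha_0(i)=\alpha_0(j)$; 2. $\alpha$ if $\alpha_1(i)=\langle Z\rangle$, or $\alpha_1(j)=\langle X\rangle$, or $\alpha_1(i)=\alpha_1(j)=\mathrm I$; 3. $\alpha[\langle Z\rangle/i]$ if $\alpha_1(i)=\mathrm I$; 4. $\alpha[\langle X\rangle/j]$ if $\alpha_1(j)=\mathrm I$; 5. $\alpha[CX_{(i,j)}(\alpha_1(i)\otimes\alpha_1(j))CX_{(i,j)}^\dagger/i,j]$; and $$[\![\mathtt{if}\ i\ \mathtt{then}\ C\ \mathtt{else}\ C']\!]_C(\alpha)=[\![C]\!]_C(meas_i(\alpha))\vee[\![C']\!]_C(meas_i(\alpha)),$$ $$[\![\mathtt{while}\ i\ \mathtt{do}\ C]\!]_C(\alpha)=\bigvee_{n\ge0}meas_i\big(([\![C]\!]_C\circ meas_i)^n(\alpha)\big).$$ **Theorem (soundness).** For every partial density matrix $\rho$, every assignment $\alpha$ and every program $C$: $[\![C]\!]_C(\alpha)$ is an assignment, and if $\alpha\vDash\rho$ then $[\![C]\!]_C(\alpha)\vDash[\![C]\!](\rho)$. -/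

import Mathlib

open scoped ComplexOrder

namespace QStab

/-! ## Qubit operators -/

/-- Square complex matrices on the qubits indexed by `ι`; a basis vector is a bit string. -/
abbrev Op (ι : Type) : Type := Matrix (ι → Fin 2) (ι → Fin 2) ℂ

/-- The tensor product `⨂ i, M i` of one-qubit matrices. -/
def kron {ι : Type} [Fintype ι] (M : ι → Matrix (Fin 2) (Fin 2) ℂ) : Op ι :=
  Matrix.of fun x y => ∏ i, M i (x i) (y i)

/-- The one-qubit operator `U` applied to qubit `i`, identity elsewhere. -/
def onQubit {N : ℕ} (i : Fin N) (U : Matrix (Fin 2) (Fin 2) ℂ) : Op (Fin N) :=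
  kron (Function.update (fun _ => 1) i U)

def matX : Matrix (Fin 2) (Fin 2) ℂ := !![0, 1; 1, 0]
def matY : Matrix (Fin 2) (Fin 2) ℂ := !![0, -Complex.I; Complex.I, 0]
def matZ : Matrix (Fin 2) (Fin 2) ℂ := !![1, 0; 0, -1]
noncomputable def matH : Matrix (Fin 2) (Fin 2) ℂ :=
  ((1 / Real.sqrt 2 : ℝ) : ℂ) • !![1, 1; 1, -1]
def matS : Matrix (Fin 2) (Fin 2) ℂ := !![1, 0; 0, Complex.I]
noncomputable def matT : Matrix (Fin 2) (Fin 2) ℂ :=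
  !![1, 0; 0, Complex.exp (Complex.I * (Real.pi / 4))]

/-- The projector `|b⟩⟨b|` on qubit `i`. -/
def proj {N : ℕ} (b : Fin 2) (i : Fin N) : Op (Fin N) :=
  onQubit i (Matrix.single b b 1)

/-- The controlled-X gate with control `i` and target `j`:
it sends `|y⟩` to `|y'⟩`, where `y'` is `y` with `y j` replaced by `y j + y i` mod 2. -/
def matCX {N : ℕ} (i j : Fin N) : Op (Fin N) :=
  Matrix.of fun x y => if x = Function.update y j (y j + y i) then 1 else 0

/-- A partial density matrix: positive semidefinite of trace at most one. -/
def IsPartialDensity {N : ℕ} (ρ : Op (Fin N)) : Prop :=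
  ρ.PosSemidef ∧ ρ.trace.re ≤ 1

/-! ## The language and its concrete semantics -/

/-- The one-qubit Clifford gates of the language. -/
inductive Gate : Type
  | X | Y | Z | H | S

noncomputable def Gate.mat : Gate → Matrix (Fin 2) (Fin 2) ℂ
  | .X => matX
  | .Y => matY
  | .Z => matZ
  | .H => matH
  | .S => matS

/-- Programs on the quantum variables `0, …, N - 1`: `skip`, sequential composition,
one-qubit gates, controlled-X, `if i then C else C' fi`, and `while i do C od`. -/
inductive QIL (N : ℕ) : Type
  | skip : QIL N
  | seq (C C' : QIL N) : QIL N
  | gate (U : Gate) (i : Fin N) : QIL N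
  | gateT (i : Fin N) : QIL N
  | cx (i j : Fin N) (hij : i ≠ j) : QIL N
  | ifte (i : Fin N) (C C' : QIL N) : QIL N
  | loop (i : Fin N) (C : QIL N) : QIL N

/-- The concrete superoperator semantics. The `then` branch and the loop body are run on
outcome `0`, the `else` branch is run, and the loop is left, on outcome `1`. -/
noncomputable def QIL.sem {N : ℕ} : QIL N → Op (Fin N) → Op (Fin N)
  | .skip, ρ => ρ
  | .seq C C', ρ => C'.sem (C.sem ρ)
  | .gate U i, ρ => onQubit i U.mat * ρ * (onQubit i U.mat).conjTranspose
  | .gateT i, ρ => onQubit i matT * ρ * (onQubit i matT).conjTranspose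
  | .cx i j _, ρ => matCX i j * ρ * (matCX i j).conjTranspose
  | .ifte i C C', ρ => C.sem (proj 0 i * ρ * proj 0 i) + C'.sem (proj 1 i * ρ * proj 1 i)
  | .loop i C, ρ =>
      ∑' n : ℕ, proj 1 i * ((fun σ => C.sem (proj 0 i * σ * proj 0 i))^[n] ρ) * proj 1 i

/-! The concrete semantics is well defined on partial density matrices. -/

theorem kron_mul {ι : Type} [Fintype ι] [DecidableEq ι] (M M' : ι → Matrix (Fin 2) (Fin 2) ℂ) :
    kron M * kron M' = kron fun i => M i * M' i := by
  ext x y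
  simp only [kron, Matrix.mul_apply, Matrix.of_apply, Finset.prod_univ_sum, Fintype.piFinset_univ,
    Finset.prod_mul_distrib]

theorem kron_one {ι : Type} [Fintype ι] [DecidableEq ι] :
    kron (fun _ : ι => (1 : Matrix (Fin 2) (Fin 2) ℂ)) = 1 := by
  ext x y
  simp only [kron, Matrix.of_apply, Matrix.one_apply, Finset.prod_ite_zero, Finset.prod_const_one,
    Finset.mem_univ, true_imp_iff, funext_iff]

theorem onQubit_mul {N : ℕ} (i : Fin N) (U V : Matrix (Fin 2) (Fin 2) ℂ) :
    onQubit i U * onQubit i V = onQubit i (U * V) := by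
  unfold onQubit
  rw [kron_mul]
  congr 1
  funext j
  by_cases h : j = i
  · subst h; simp
  · simp [h]

theorem onQubit_one {N : ℕ} (i : Fin N) : onQubit i 1 = 1 := by
  unfold onQubit
  rw [Function.update_eq_self_iff.2 rfl, kron_one]

theorem onQubit_conjTranspose {N : ℕ} (i : Fin N) (U : Matrix (Fin 2) (Fin 2) ℂ) :
    (onQubit i U).conjTranspose = onQubit i U.conjTranspose := by
  ext x y
  simp only [onQubit, kron, Matrix.conjTranspose_apply, Matrix.of_apply, star_prod]
  refine Finset.prod_congr rfl fun j _ => ?_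
  by_cases h : j = i
  · subst h; simp
  · simp [h, Matrix.one_apply, eq_comm]

theorem onQubit_add {N : ℕ} (i : Fin N) (U V : Matrix (Fin 2) (Fin 2) ℂ) :
    onQubit i U + onQubit i V = onQubit i (U + V) := by
  ext x y
  simp only [onQubit, kron, Matrix.add_apply, Matrix.of_apply]
  simp only [← Finset.mul_prod_erase _ _ (Finset.mem_univ i), Function.update_self,
    Matrix.add_apply, add_mul]
  have : ∀ W : Matrix (Fin 2) (Fin 2) ℂ, ∏ j ∈ Finset.univ.erase i,
      Function.update (fun _ => (1 : Matrix (Fin 2) (Fin 2) ℂ)) i W j (x j) (y j) =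
      ∏ j ∈ Finset.univ.erase i, (1 : Matrix (Fin 2) (Fin 2) ℂ) (x j) (y j) := fun W =>
    Finset.prod_congr rfl fun j hj => by simp [(Finset.mem_erase.1 hj).1]
  simp only [this]

theorem matT_unitary : matT.conjTranspose * matT = 1 := by
  ext a b
  have h4 : (starRingEnd ℂ) 4 = 4 := map_ofNat _ 4
  fin_cases a <;> fin_cases b <;>
    simp [matT, Matrix.mul_apply, Fin.sum_univ_two, ← Complex.exp_conj, ← Complex.exp_add, h4]

theorem Gate.mat_unitary (U : Gate) : U.mat.conjTranspose * U.mat = 1 := by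
  have h2 : ((Real.sqrt 2 : ℝ) : ℂ) * (Real.sqrt 2 : ℝ) = 2 := by
    rw [← Complex.ofReal_mul, Real.mul_self_sqrt (by norm_num)]; norm_num
  have h3 : ((Real.sqrt 2 : ℝ) : ℂ)⁻¹ * ((Real.sqrt 2 : ℝ) : ℂ)⁻¹ = 2⁻¹ := by
    rw [← mul_inv, h2]
  cases U <;> ext a b <;> fin_cases a <;> fin_cases b <;>
    simp [Gate.mat, matX, matY, matZ, matH, matS, Matrix.mul_apply, Fin.sum_univ_two, h3] <;>
    norm_num

theorem matCX_unitary {N : ℕ} (i j : Fin N) (hij : i ≠ j) :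
    (matCX i j).conjTranspose * matCX i j = 1 := by
  have hinv : ∀ y : Fin N → Fin 2, Function.update (Function.update y j (y j + y i)) j
      (Function.update y j (y j + y i) j + Function.update y j (y j + y i) i) = y := by
    intro y
    simp only [Function.update_self, Function.update_of_ne hij, Function.update_idem]
    rw [Function.update_eq_self_iff]
    generalize y j = a; generalize y i = b
    revert a b; decide
  ext x y
  simp only [Matrix.mul_apply, Matrix.conjTranspose_apply, matCX, Matrix.of_apply, Matrix.one_apply]
  simp only [apply_ite star, star_one, star_zero, mul_ite, mul_one, mul_zero]
  rw [Finset.sum_ite_eq' Finset.univ]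
  simp only [Finset.mem_univ, if_true]
  refine if_congr ⟨fun h => ?_, fun h => by rw [h]⟩ rfl rfl
  rw [← hinv x, ← h, hinv y]

theorem proj_mul_self {N : ℕ} (b : Fin 2) (i : Fin N) : proj b i * proj b i = proj b i := by
  simp [proj, onQubit_mul]

theorem proj_conjTranspose {N : ℕ} (b : Fin 2) (i : Fin N) :
    (proj b i).conjTranspose = proj b i := by
  simp [proj, onQubit_conjTranspose, Matrix.conjTranspose_single]

theorem proj_add {N : ℕ} (i : Fin N) : proj 0 i + proj 1 i = (1 : Op (Fin N)) := by
  rw [proj, proj, onQubit_add, ← onQubit_one i]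
  congr 1
  ext a b
  fin_cases a <;> fin_cases b <;> simp

theorem proj_posSemidef {N : ℕ} (b : Fin 2) (i : Fin N) {ρ : Op (Fin N)} (h : ρ.PosSemidef) :
    (proj b i * ρ * proj b i).PosSemidef := by
  have := h.mul_mul_conjTranspose_same (proj b i)
  rwa [proj_conjTranspose] at this

theorem trace_proj {N : ℕ} (i : Fin N) (ρ : Op (Fin N)) :
    (proj 0 i * ρ * proj 0 i).trace + (proj 1 i * ρ * proj 1 i).trace = ρ.trace := by
  have : ∀ b : Fin 2, (proj b i * ρ * proj b i).trace = (proj b i * ρ).trace := fun b => by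
    rw [Matrix.trace_mul_comm, ← mul_assoc, proj_mul_self]
  rw [this, this, ← Matrix.trace_add, ← add_mul, proj_add, one_mul]

theorem trace_unitary {N : ℕ} {U : Op (Fin N)} (hU : U.conjTranspose * U = 1) (ρ : Op (Fin N)) :
    (U * ρ * U.conjTranspose).trace = ρ.trace := by
  rw [Matrix.trace_mul_comm, ← mul_assoc, hU, one_mul]

theorem norm_entry_le_trace {n : Type} [Fintype n] [DecidableEq n] {A : Matrix n n ℂ}
    (hA : A.PosSemidef) (x y : n) : ‖A x y‖ ≤ A.trace.re := by
  have hd : ∀ z, 0 ≤ (A z z).re := fun z => (Complex.le_def.1 (hA.diag_nonneg (i := z))).1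
  have htr : A.trace.re = ∑ z, (A z z).re := by simp [Matrix.trace]
  by_cases hxy : x = y
  · subst hxy
    have him : A x x = ((A x x).re : ℂ) := by
      have := (Complex.le_def.1 (hA.diag_nonneg (i := x))).2
      apply Complex.ext <;> simp_all
    rw [him, Complex.norm_real, Real.norm_of_nonneg (hd x), htr]
    exact Finset.single_le_sum (f := fun z => (A z z).re) (fun z _ => hd z) (Finset.mem_univ x)
  · have h2 : (A x x).re + (A y y).re ≤ A.trace.re := by
      rw [htr, ← Finset.sum_pair (f := fun z => (A z z).re) hxy]
      exact Finset.sum_le_sum_of_subset_of_nonneg (Finset.subset_univ _) fun z _ _ => hd z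
    obtain ⟨c, hc, hcA⟩ : ∃ c : ℂ, ‖c‖ = 1 ∧ c * A x y = -(‖A x y‖ : ℂ) := by
      by_cases h0 : A x y = 0
      · exact ⟨1, by simp, by simp [h0]⟩
      · refine ⟨-(‖A x y‖ : ℂ) / A x y, ?_, by field_simp⟩
        simp [h0]
    have hyx : A y x = star (A x y) := (hA.isHermitian.apply x y).symm ▸ by simp
    have hq := hA.dotProduct_mulVec_nonneg (Pi.single x 1 + Pi.single y c)
    have he : dotProduct (star (Pi.single x 1 + Pi.single y c : n → ℂ))
        (A.mulVec (Pi.single x 1 + Pi.single y c)) =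
        A x x + star c * c * A y y + (c * A x y + star (c * A x y)) := by
      simp [Matrix.mulVec_add, hyx]
      ring
    have hcc : star c * c = 1 := by
      have := Complex.conj_mul' c
      rw [hc] at this
      simpa using this
    rw [he, hcc, hcA] at hq
    have := (Complex.le_def.1 hq).1
    simp at this
    have h3 : 0 ≤ (A x x).re + (A y y).re := add_nonneg (hd x) (hd y)
    linarith

theorem isClosed_posSemidef {n : Type} [Fintype n] [DecidableEq n] :
    IsClosed {A : Matrix n n ℂ | A.PosSemidef} := by
  simp only [Matrix.posSemidef_iff_dotProduct_mulVec, Matrix.IsHermitian, Set.ofPred_and, Set.ofPred_forall]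
  refine IsClosed.inter (isClosed_eq (by fun_prop) (by fun_prop)) (isClosed_iInter fun x => ?_)
  exact isClosed_le continuous_const (by fun_prop)

theorem sum_posSemidef {n : Type} [Fintype n] [DecidableEq n] {a : ℕ → Matrix n n ℂ} {c : ℝ}
    (ha : ∀ k, (a k).PosSemidef) (hc : ∀ M, ∑ k ∈ Finset.range M, (a k).trace.re ≤ c) :
    Summable a ∧ (∑' k, a k).PosSemidef ∧ (∑' k, a k).trace.re ≤ c := by
  have h0 : ∀ k, 0 ≤ (a k).trace.re := fun k => (Complex.le_def.1 (ha k).trace_nonneg).1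
  have hs : Summable fun k => (a k).trace.re := summable_of_sum_range_le h0 hc
  have hsum : Summable a := by
    refine Pi.summable.2 fun x => Pi.summable.2 fun y => ?_
    exact Summable.of_norm_bounded hs fun k => norm_entry_le_trace (ha k) x y
  have ht := hsum.hasSum.tendsto_sum_nat
  refine ⟨hsum, ?_, ?_⟩
  · refine isClosed_posSemidef.mem_of_tendsto ht (Filter.Eventually.of_forall fun M => ?_)
    exact Matrix.posSemidef_sum _ fun k _ => ha k
  · have hcont : Continuous fun A : Matrix n n ℂ => A.trace.re := by fun_prop
    refine le_of_tendsto ((hcont.tendsto _).comp ht) (Filter.Eventually.of_forall fun M => ?_)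
    simpa [Matrix.trace_sum] using hc M

theorem loop_aux {N : ℕ} (i : Fin N) (f : Op (Fin N) → Op (Fin N))
    (hf : ∀ σ : Op (Fin N), σ.PosSemidef → (f σ).PosSemidef ∧ (f σ).trace.re ≤ σ.trace.re)
    (ρ : Op (Fin N)) (hρ : ρ.PosSemidef) :
    (∀ n, (proj 1 i * ((fun σ => f (proj 0 i * σ * proj 0 i))^[n] ρ) * proj 1 i).PosSemidef) ∧
    ∀ M, ∑ n ∈ Finset.range M,
      (proj 1 i * ((fun σ => f (proj 0 i * σ * proj 0 i))^[n] ρ) * proj 1 i).trace.re ≤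
      ρ.trace.re := by
  set g := fun σ => f (proj 0 i * σ * proj 0 i) with hg
  have hp : ∀ n, (g^[n] ρ).PosSemidef := by
    intro n
    induction n with
    | zero => exact hρ
    | succ n ih =>
      rw [Function.iterate_succ_apply']
      exact (hf _ (proj_posSemidef 0 i ih)).1
  refine ⟨fun n => proj_posSemidef 1 i (hp n), fun M => ?_⟩
  have key : ∑ n ∈ Finset.range M, (proj 1 i * (g^[n] ρ) * proj 1 i).trace.re +
      (g^[M] ρ).trace.re ≤ ρ.trace.re := by
    induction M with
    | zero => simp
    | succ M ih =>
      rw [Finset.sum_range_succ, Function.iterate_succ_apply']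
      have h1 := (hf _ (proj_posSemidef 0 i (hp M))).2
      have h2 := congrArg Complex.re (trace_proj i (g^[M] ρ))
      rw [Complex.add_re] at h2
      change _ + (f _).trace.re ≤ _
      linarith
  have := (Complex.le_def.1 (hp M).trace_nonneg).1
  simp only [Complex.zero_re] at this
  linarith

/-- The concrete semantics preserves positivity and does not increase the trace. -/
theorem QIL.sem_posSemidef {N : ℕ} (C : QIL N) (ρ : Op (Fin N)) (hρ : ρ.PosSemidef) :
    (C.sem ρ).PosSemidef ∧ (C.sem ρ).trace.re ≤ ρ.trace.re := by
  induction C generalizing ρ with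
  | skip => exact ⟨hρ, le_rfl⟩
  | seq C C' ih ih' =>
    exact ⟨(ih' _ (ih _ hρ).1).1, (ih' _ (ih _ hρ).1).2.trans (ih _ hρ).2⟩
  | gate U i =>
    refine ⟨hρ.mul_mul_conjTranspose_same _, ?_⟩
    rw [QIL.sem, trace_unitary]
    rw [onQubit_conjTranspose, onQubit_mul, U.mat_unitary, onQubit_one]
  | gateT i =>
    refine ⟨hρ.mul_mul_conjTranspose_same _, ?_⟩
    rw [QIL.sem, trace_unitary]
    rw [onQubit_conjTranspose, onQubit_mul, matT_unitary, onQubit_one]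
  | cx i j hij =>
    refine ⟨hρ.mul_mul_conjTranspose_same _, ?_⟩
    rw [QIL.sem, trace_unitary (matCX_unitary i j hij)]
  | ifte i C C' ih ih' =>
    have h0 := ih _ (proj_posSemidef 0 i hρ)
    have h1 := ih' _ (proj_posSemidef 1 i hρ)
    refine ⟨h0.1.add h1.1, ?_⟩
    have h2 := congrArg Complex.re (trace_proj i ρ)
    rw [Complex.add_re] at h2
    rw [QIL.sem, Matrix.trace_add, Complex.add_re]
    linarith [h0.2, h1.2]
  | loop i C ih =>
    have h := loop_aux i C.sem ih ρ hρ
    exact (sum_posSemidef h.1 h.2).2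

/-- The series in the semantics of a loop converges. -/
theorem QIL.summable_loop {N : ℕ} (i : Fin N) (C : QIL N) (ρ : Op (Fin N)) (hρ : ρ.PosSemidef) :
    Summable fun n : ℕ =>
      proj 1 i * ((fun σ => C.sem (proj 0 i * σ * proj 0 i))^[n] ρ) * proj 1 i := by
  have h := loop_aux i C.sem (fun σ hσ => C.sem_posSemidef σ hσ) ρ hρ
  exact (sum_posSemidef h.1 h.2).1

/-- The concrete semantics maps partial density matrices to partial density matrices. -/
theorem QIL.sem_isPartialDensity {N : ℕ} (C : QIL N) (ρ : Op (Fin N)) (hρ : IsPartialDensity ρ) :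
    IsPartialDensity (C.sem ρ) :=
  ⟨(C.sem_posSemidef ρ hρ.1).1, (C.sem_posSemidef ρ hρ.1).2.trans hρ.2⟩

/-! ## Pauli strings and stabilizers, up to sign -/

/-- A Pauli matrix up to phase, as a pair (X-bit, Z-bit); `+` is multiplication up to phase. -/
abbrev Pauli : Type := ZMod 2 × ZMod 2

def pX : Pauli := (1, 0)
def pY : Pauli := (1, 1)
def pZ : Pauli := (0, 1)

def Pauli.mat (p : Pauli) : Matrix (Fin 2) (Fin 2) ℂ :=
  if p = pX then matX else if p = pY then matY else if p = pZ then matZ else 1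

/-- Tensor products of Pauli matrices on `N` qubits, with the sign dropped. They form a vector
space over `ℤ/2`, in which linear independence is independence of generators. A Pauli operator on
a set `A` of qubits is a string that is `0` (the identity) off `A`. -/
abbrev PString (N : ℕ) : Type := Fin N → Pauli

/-- The operator of a Pauli string on all qubits. -/
def pauliOp {N : ℕ} (σ : PString N) : Op (Fin N) := kron fun i => (σ i).mat

/-- The operator of a Pauli string on the qubits in `A`. -/
def pauliOn {N : ℕ} (A : Finset (Fin N)) (σ : PString N) : Op A := kron fun i : A => (σ i).mat

/-- Sign-free groups of Pauli strings. -/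
abbrev PGroup (N : ℕ) : Type := Submodule (ZMod 2) (PString N)

/-- The Pauli strings on the qubits in `A`. -/
def supported {N : ℕ} (A : Finset (Fin N)) : PGroup N where
  carrier := {σ | ∀ i, i ∉ A → σ i = 0}
  zero_mem' := fun _ _ => rfl
  add_mem' := fun {a b} ha hb i hi => by simp [ha i hi, hb i hi]
  smul_mem' := fun c a ha i hi => by simp [ha i hi]

/-- `S` is, up to signs, a stabilizer on the qubits in `A` generated by `|A|` independent
generators: a group of pairwise commuting Pauli operators of rank `|A|`. -/
def IsStab {N : ℕ} (A : Finset (Fin N)) (S : PGroup N) : Prop :=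
  S ≤ supported A ∧ (∀ σ ∈ S, ∀ τ ∈ S, Commute (pauliOp σ) (pauliOp τ)) ∧
    Module.finrank (ZMod 2) S = A.card

/-- The group generated by the one-qubit Pauli operator `p` on qubit `i`. -/
def oneGen {N : ℕ} (i : Fin N) (p : Pauli) : PGroup N := Submodule.span (ZMod 2) {Pi.single i p}

/-- `U S U†`, up to signs. -/
def conjGroup {N : ℕ} (U : Op (Fin N)) (S : PGroup N) : PGroup N :=
  Submodule.span (ZMod 2)
    {τ | ∃ σ ∈ S, pauliOp τ = U * pauliOp σ * U.conjTranspose ∨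
      pauliOp τ = -(U * pauliOp σ * U.conjTranspose)}

/-- Measurement of qubit `i` in the stabilizer formalism, up to signs: the generators that commute
with `Z` on qubit `i` are kept, and that operator is added. -/
def measStab {N : ℕ} (i : Fin N) (S : PGroup N) : PGroup N :=
  Submodule.span (ZMod 2)
    ({σ | σ ∈ S ∧ Commute (pauliOp σ) (pauliOp (Pi.single i pZ))} ∪ {Pi.single i pZ})

/-- What may be assigned to a set of qubits: the symbol `I` (maximally mixed qubit),
the non-stabilizer `■`, or a stabilizer up to signs. -/
inductive Label (N : ℕ) : Type
  | mixed : Label N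
  | box : Label N
  | stab (S : PGroup N) : Label N

/-- The order `≤ₛ`. -/
def Label.le {N : ℕ} (L L' : Label N) : Prop := L = .mixed ∨ L' = .box ∨ L = L'

/-- The label belongs to `𝒮_{|A|}`, read on the qubits in `A`. -/
def Label.Valid {N : ℕ} (A : Finset (Fin N)) : Label N → Prop
  | .mixed => A.card = 1
  | .box => True
  | .stab S => IsStab A S ∧
      (2 ≤ A.card → ∀ i, ∀ p : Pauli, p ≠ 0 → Pi.single i p ∉ S)

def Label.conj {N : ℕ} (U : Op (Fin N)) : Label N → Label N
  | .mixed => .mixed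
  | .box => .box
  | .stab S => .stab (conjGroup U S)

/-- Tensor product of two labels of disjoint sets of qubits. (It is only taken when neither
label is `I`.) -/
def Label.tensor {N : ℕ} : Label N → Label N → Label N
  | .stab S, .stab T => .stab (S ⊔ T)
  | _, _ => .box

/-- `⟨Z⟩` on qubit `i`. -/
def labelZ {N : ℕ} (i : Fin N) : Label N := .stab (oneGen i pZ)

/-- `⟨X⟩` on qubit `i`. -/
def labelX {N : ℕ} (i : Fin N) : Label N := .stab (oneGen i pX)

/-! ## Assignments -/

abbrev Block (N : ℕ) : Type := Finset (Fin N) × Label N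

/-- The data of an assignment, as the function that sends a qubit `i` to the pair `(A, S)`
with `i ∈ A`. -/
abbrev PreAssignment (N : ℕ) : Type := Fin N → Block N

/-- The sets of qubits form a partition, each with one label, which is a legitimate one. -/
structure IsAssignment {N : ℕ} (α : PreAssignment N) : Prop where
  mem : ∀ i, i ∈ (α i).1
  eq_of_mem : ∀ i, ∀ j ∈ (α i).1, α j = α i
  valid : ∀ i, (α i).2.Valid (α i).1

/-- `α` with the blocks in `bs` put in place of the blocks of the qubits that they contain. -/
def replace {N : ℕ} (α : PreAssignment N) (bs : List (Block N)) : PreAssignment N :=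
  fun j => (bs.find? fun b => decide (j ∈ b.1)).getD (α j)

/-- The matrix `r` is a state of the qubits in `A` of the form that the label prescribes:
`I/2`, any density matrix, or a pure joint eigenstate of the stabilizer. -/
def Label.IsState {N : ℕ} (A : Finset (Fin N)) (r : Op A) : Label N → Prop
  | .mixed => r = (1 / 2 : ℂ) • (1 : Op A)
  | .box => r.PosSemidef ∧ r.trace = 1
  | .stab S => ∃ ψ : (A → Fin 2) → ℂ, ∑ x, ‖ψ x‖ ^ 2 = 1 ∧
      (∀ σ ∈ S, (pauliOn A σ).mulVec ψ = ψ ∨ (pauliOn A σ).mulVec ψ = -ψ) ∧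
      r = Matrix.vecMulVec ψ (star ψ)

/-- The tensor product of the matrices `r A` over the blocks `A` of `α`. -/
def blockTensor {N : ℕ} (α : PreAssignment N) (r : (A : Finset (Fin N)) → Op A) : Op (Fin N) :=
  Matrix.of fun x y =>
    ∏ A ∈ Finset.univ.image (fun i => (α i).1), r A (fun i => x i) (fun i => y i)

/-- `α ⊨ ρ`. For partial density matrices the weights add up to `tr ρ ≤ 1`. -/
def Sat {N : ℕ} (α : PreAssignment N) (ρ : Op (Fin N)) : Prop :=
  ∃ (m : ℕ) (p : Fin m → ℝ) (r : Fin m → (A : Finset (Fin N)) → Op A),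
    (∀ k, 0 ≤ p k) ∧ ∑ k, p k ≤ 1 ∧
    (∀ k i, (α i).2.IsState (α i).1 (r k (α i).1)) ∧
    ρ = ∑ k, (p k : ℂ) • blockTensor α (r k)

/-! ## The order on assignments and joins -/

open Classical in
/-- `⨀ j ∈ B, α j`, where `i` is any element of `B`. -/
noncomputable def merge {N : ℕ} (α : PreAssignment N) (i : Fin N) (B : Finset (Fin N)) : Label N :=
  if ∀ j ∈ B, (α j).1 = (α i).1 then (α i).2
  else if ∀ j ∈ B, (α j).2 = .mixed then .mixed
  else .box

/-- The order `≤_c`: the blocks of `β` are unions of blocks of `α`, and the labels increase. -/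
def AssignLE {N : ℕ} (α β : PreAssignment N) : Prop :=
  (∀ i, ∀ j ∈ (β i).1, (α j).1 ⊆ (β i).1) ∧ ∀ i, (merge α i (β i).1).le (β i).2

open Classical in
/-- The least upper bound of a nonempty family of labels: its greatest member if there is one,
and `■` otherwise. -/
noncomputable def labelJoin {N : ℕ} {κ : Type} (f : κ → Label N) : Label N :=
  if h : ∃ n, ∀ m, (f m).le (f n) then f h.choose else .box

open Classical in
/-- The block of `i` in the join of the partitions of the assignments `F n`. -/
noncomputable def joinBlock {N : ℕ} {κ : Type} (F : κ → PreAssignment N) (i : Fin N) :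
    Finset (Fin N) :=
  Finset.univ.filter fun j => Relation.EqvGen (fun a b => ∃ n, b ∈ (F n a).1) i j

/-- The join of a nonempty family of assignments with respect to `≤_c`
(see `assignJoin_isLUB`). -/
noncomputable def assignJoin {N : ℕ} {κ : Type} (F : κ → PreAssignment N) : PreAssignment N :=
  fun i => (joinBlock F i, labelJoin fun n => merge (F n) i (joinBlock F i))

/-! The join defined above is the least upper bound. -/

theorem joinBlock_self {N : ℕ} {κ : Type} (F : κ → PreAssignment N) (i : Fin N) :
    i ∈ joinBlock F i := by
  simp [joinBlock, Relation.EqvGen.refl]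

theorem joinBlock_eq {N : ℕ} {κ : Type} (F : κ → PreAssignment N) {i j : Fin N}
    (h : j ∈ joinBlock F i) : joinBlock F j = joinBlock F i := by
  simp only [joinBlock, Finset.mem_filter, Finset.mem_univ, true_and] at h
  ext k
  simp only [joinBlock, Finset.mem_filter, Finset.mem_univ, true_and]
  exact ⟨fun hk => h.trans _ _ _ hk, fun hk => (h.symm _ _).trans _ _ _ hk⟩

theorem block_subset_joinBlock {N : ℕ} {κ : Type} (F : κ → PreAssignment N) (n : κ)
    {i j : Fin N} (h : j ∈ joinBlock F i) : (F n j).1 ⊆ joinBlock F i := by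
  intro k hk
  rw [← joinBlock_eq F h]
  simp only [joinBlock, Finset.mem_filter, Finset.mem_univ, true_and]
  exact Relation.EqvGen.rel _ _ ⟨n, hk⟩

theorem joinBlock_subset {N : ℕ} {κ : Type} (F : κ → PreAssignment N) {i : Fin N}
    {B : Finset (Fin N)} (hF : ∀ n j, j ∈ (F n j).1) (hE : ∀ n i, ∀ j ∈ (F n i).1, F n j = F n i)
    (hi : i ∈ B) (hB : ∀ n, ∀ j ∈ B, (F n j).1 ⊆ B) : joinBlock F i ⊆ B := by
  intro k hk
  simp only [joinBlock, Finset.mem_filter, Finset.mem_univ, true_and] at hk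
  have key : ∀ a b, Relation.EqvGen (fun a b => ∃ n, b ∈ (F n a).1) a b → (a ∈ B ↔ b ∈ B) := by
    intro a b h
    induction h with
    | rel a b h =>
      obtain ⟨n, h⟩ := h
      refine ⟨fun ha => hB n a ha h, fun hb => hB n b hb ?_⟩
      rw [hE n a b h]; exact hF n a
    | refl a => exact Iff.rfl
    | symm a b _ ih => exact ih.symm
    | trans a b c _ _ ih ih' => exact ih.trans ih'
  exact (key i k hk).1 hi

theorem Label.le_refl {N : ℕ} (L : Label N) : L.le L := Or.inr (Or.inr rfl)

theorem Label.le_trans {N : ℕ} {L L' L'' : Label N} (h : L.le L') (h' : L'.le L'') : L.le L'' := by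
  unfold Label.le at *
  rcases h with h | h | h <;> rcases h' with h' | h' | h' <;> subst_vars <;> simp_all

theorem le_labelJoin {N : ℕ} {κ : Type} (f : κ → Label N) (n : κ) : (f n).le (labelJoin f) := by
  unfold labelJoin
  split_ifs with h
  · exact h.choose_spec n
  · exact Or.inr (Or.inl rfl)

theorem labelJoin_le {N : ℕ} {κ : Type} [hκ : Nonempty κ] (f : κ → Label N) (L : Label N)
    (hL : ∀ n, (f n).le L) : (labelJoin f).le L := by
  unfold labelJoin
  split_ifs with h
  · exact hL _
  · by_cases hb : L = .box
    · exact Or.inr (Or.inl hb)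
    · exfalso
      by_cases hm : ∀ n, f n = .mixed
      · exact h ⟨hκ.some, fun m => Or.inl (hm m)⟩
      · push Not at hm
        obtain ⟨n, hn⟩ := hm
        have hn' : f n = L := by
          rcases hL n with h1 | h1 | h1
          · exact absurd h1 hn
          · exact absurd h1 hb
          · exact h1
        exact h ⟨n, fun m => hn' ▸ hL m⟩

/-- The label of a block of the assignment itself. -/
theorem merge_self {N : ℕ} {α : PreAssignment N} (hα : IsAssignment α) (i : Fin N) :
    merge α i (α i).1 = (α i).2 := by
  unfold merge
  rw [if_pos fun j hj => by rw [hα.eq_of_mem i j hj]]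

theorem merge_congr {N : ℕ} {α : PreAssignment N} (hα : IsAssignment α) {i j : Fin N}
    {B : Finset (Fin N)} (hi : i ∈ B) (hj : j ∈ B) : merge α i B = merge α j B := by
  unfold merge
  by_cases h : ∀ k ∈ B, (α k).1 = (α i).1
  · have hij : α j = α i := hα.eq_of_mem i j (h j hj ▸ hα.mem j)
    rw [if_pos h, hij, if_pos h]
  · have h' : ¬ ∀ k ∈ B, (α k).1 = (α j).1 := fun h' => h fun k hk => by rw [h' k hk, h' i hi]
    rw [if_neg h, if_neg h']

theorem merge_eq_stab {N : ℕ} {α : PreAssignment N} (hα : IsAssignment α) {i : Fin N}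
    {B : Finset (Fin N)} (hB : (α i).1 ⊆ B) {S : PGroup N} (h : merge α i B = .stab S) :
    α i = (B, .stab S) := by
  unfold merge at h
  split_ifs at h with h1
  · refine Prod.ext (Finset.Subset.antisymm hB fun k hk => ?_) h
    exact h1 k hk ▸ hα.mem k

theorem merge_eq_mixed {N : ℕ} {α : PreAssignment N} (hα : IsAssignment α) {i : Fin N}
    {B : Finset (Fin N)} (h : merge α i B = .mixed) :
    ∀ j ∈ B, (α j).2 = .mixed := by
  unfold merge at h
  split_ifs at h with h1 h2
  · intro j hj
    rw [hα.eq_of_mem i j (h1 j hj ▸ hα.mem j), h]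
  · exact h2

theorem block_of_mixed {N : ℕ} {α : PreAssignment N} (hα : IsAssignment α) {i : Fin N}
    (h : (α i).2 = .mixed) : (α i).1 = {i} := by
  have := hα.valid i
  rw [h] at this
  obtain ⟨a, ha⟩ := Finset.card_eq_one.1 this
  have := hα.mem i
  rw [ha, Finset.mem_singleton] at this
  rw [ha, this]

/-- The join of assignments is an assignment, and it is their least upper bound. -/
theorem assignJoin_isLUB {N : ℕ} {κ : Type} [Nonempty κ] (F : κ → PreAssignment N)
    (hF : ∀ n, IsAssignment (F n)) :
    IsAssignment (assignJoin F) ∧ (∀ n, AssignLE (F n) (assignJoin F)) ∧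
      ∀ β, IsAssignment β → (∀ n, AssignLE (F n) β) → AssignLE (assignJoin F) β := by
  have hsub : ∀ n i, (F n i).1 ⊆ joinBlock F i := fun n i =>
    block_subset_joinBlock F n (joinBlock_self F i)
  have hmixed : ∀ i, labelJoin (fun n => merge (F n) i (joinBlock F i)) = .mixed →
      joinBlock F i = {i} := by
    intro i h
    refine Finset.Subset.antisymm ?_ (by simpa using joinBlock_self F i)
    refine joinBlock_subset F (fun n => (hF n).mem) (fun n => (hF n).eq_of_mem) (by simp) ?_
    intro n j hj
    rw [Finset.mem_singleton] at hj
    subst hj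
    have h1 := le_labelJoin (fun n => merge (F n) j (joinBlock F j)) n
    rw [h] at h1
    have h2 : merge (F n) j (joinBlock F j) = .mixed := by
      rcases h1 with h1 | h1 | h1
      · exact h1
      · cases h1
      · exact h1
    rw [block_of_mixed (hF n) (merge_eq_mixed (hF n) h2 j (joinBlock_self F j))]
  refine ⟨⟨joinBlock_self F, ?_, ?_⟩, ?_, ?_⟩
  · intro i j hj
    have e : joinBlock F j = joinBlock F i := joinBlock_eq F hj
    refine Prod.ext e ?_
    change labelJoin _ = labelJoin _
    rw [e]
    congr 1
    funext n
    exact merge_congr (hF n) hj (joinBlock_self F i)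
  · intro i
    change (labelJoin _).Valid (joinBlock F i)
    rcases hL : labelJoin (fun n => merge (F n) i (joinBlock F i)) with _ | _ | S
    · rw [hmixed i hL]; simp [Label.Valid]
    · trivial
    · unfold labelJoin at hL
      split_ifs at hL with h
      have := merge_eq_stab (hF _) (hsub _ i) hL
      have hv := (hF h.choose).valid i
      rw [this] at hv
      exact hv
  · intro n
    refine ⟨fun i j hj => block_subset_joinBlock F n hj, fun i => ?_⟩
    exact le_labelJoin (fun n => merge (F n) i (joinBlock F i)) n
  · intro β hβ hle
    have hjs : ∀ i, ∀ j ∈ (β i).1, joinBlock F j ⊆ (β i).1 := fun i j hj =>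
      joinBlock_subset F (fun n => (hF n).mem) (fun n => (hF n).eq_of_mem) hj
        fun n k hk => (hle n).1 i k hk
    refine ⟨hjs, fun i => ?_⟩
    by_cases h1 : ∀ j ∈ (β i).1, (assignJoin F j).1 = (assignJoin F i).1
    · have hB : (β i).1 = joinBlock F i := by
        refine Finset.Subset.antisymm (fun k hk => ?_) (hjs i i (hβ.mem i))
        have := h1 k hk
        change joinBlock F k = joinBlock F i at this
        exact this ▸ joinBlock_self F k
      unfold merge
      rw [if_pos h1]
      refine labelJoin_le _ _ fun n => ?_
      have := (hle n).2 i
      rwa [hB] at this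
    · by_cases h2 : ∀ j ∈ (β i).1, (assignJoin F j).2 = .mixed
      · unfold merge
        rw [if_neg h1, if_pos h2]
        exact Or.inl rfl
      · push Not at h1 h2
        obtain ⟨k, hk, hk'⟩ := h1
        obtain ⟨j, hj, hj'⟩ := h2
        have hbox : (β i).2 = .box := by
          by_contra hb
          apply hj'
          have hall : ∀ n, merge (F n) j (joinBlock F j) = .mixed := by
            intro n
            have hl := (hle n).2 i
            unfold merge at hl
            rw [if_neg] at hl
            · split_ifs at hl with h3
              · unfold merge
                by_cases h4 : ∀ l ∈ joinBlock F j, (F n l).1 = (F n j).1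
                · rw [if_pos h4]; exact h3 j hj
                · rw [if_neg h4, if_pos fun l hl => h3 l (hjs i j hj hl)]
              · exfalso
                rcases hl with hl | hl | hl
                · cases hl
                · exact hb hl
                · exact hb hl.symm
            · intro h5
              apply hk'
              apply joinBlock_eq
              exact hsub n i (h5 k hk ▸ (hF n).mem k)
          change labelJoin _ = _
          have := labelJoin_le (fun n => merge (F n) j (joinBlock F j)) .mixed
            fun n => Or.inl (hall n)
          rcases this with h | h | h
          · exact h
          · cases h
          · exact h
        exact Or.inr (Or.inl hbox)

/-! ## The abstract semantics -/

open Classical in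
/-- Split off, one after the other, those of the listed qubits that carry a one-qubit tensor
factor of the stabilizer. -/
noncomputable def splitStab {N : ℕ} :
    List (Fin N) → Finset (Fin N) → PGroup N → List (Block N)
  | [], A, S => [(A, .stab S)]
  | i :: J, A, S =>
      if (∃ p : Pauli, p ≠ 0 ∧ S ⊓ supported {i} = oneGen i p) ∧
          S = (S ⊓ supported {i}) ⊔ (S ⊓ supported (A.erase i)) then
        ({i}, .stab (S ⊓ supported {i})) :: splitStab J (A.erase i) (S ⊓ supported (A.erase i))
      else splitStab J A S

/-- `update(J, A, S)`. A block on the empty set of qubits may occur in the list;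
`replace` ignores it. -/
noncomputable def updateBlocks {N : ℕ} (J : List (Fin N)) (A : Finset (Fin N)) :
    Label N → List (Block N)
  | .mixed => [(A, .mixed)]
  | .box => [(A, .box)]
  | .stab S => splitStab J A S

/-- `meas(i, α)`. -/
noncomputable def meas {N : ℕ} (i : Fin N) (α : PreAssignment N) : PreAssignment N :=
  if (α i).1.card = 1 then replace α [((α i).1, labelZ i)]
  else match (α i).2 with
    | .stab S =>
        replace α (updateBlocks ((α i).1.sort (· ≤ ·)) (α i).1 (.stab (measStab i S)))
    | _ => replace α [({i}, labelZ i), ((α i).1.erase i, .box)]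

/-- The label commutes with `Z` on qubit `i`. -/
def Label.CommutesZ {N : ℕ} (i : Fin N) : Label N → Prop
  | .mixed => True
  | .box => False
  | .stab S => ∀ σ ∈ S, Commute (pauliOp σ) (pauliOp (Pi.single i pZ))

open Classical in
/-- The abstract semantics. -/
noncomputable def QIL.asem {N : ℕ} : QIL N → PreAssignment N → PreAssignment N
  | .skip, α => α
  | .seq C C', α => C'.asem (C.asem α)
  | .gate U i, α => replace α [((α i).1, (α i).2.conj (onQubit i U.mat))]
  | .gateT i, α => if (α i).2.CommutesZ i then α else replace α [((α i).1, .box)]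
  | .cx i j _, α =>
      if (α i).1 = (α j).1 then
        replace α (updateBlocks [i, j] (α i).1 ((α i).2.conj (matCX i j)))
      else if (α i).2 = labelZ i ∨ (α j).2 = labelX j ∨
          ((α i).2 = .mixed ∧ (α j).2 = .mixed) then α
      else if (α i).2 = .mixed then replace α [((α i).1, labelZ i)]
      else if (α j).2 = .mixed then replace α [((α j).1, labelX j)]
      else replace α
        [((α i).1 ∪ (α j).1, ((α i).2.tensor (α j).2).conj (matCX i j))]
  | .ifte i C C', α =>
      assignJoin fun b : Bool => if b then C.asem (meas i α) else C'.asem (meas i α)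
  | .loop i C, α =>
      assignJoin fun n : ℕ => meas i ((fun β => C.asem (meas i β))^[n] α)

end QStab

namespace QStab

open scoped NNReal

/-! ## Convergent series in convex cones -/

section Convergence

open Filter Topology

/-! The proof replaces satisfaction by membership in a convex cone. A state on a set of qubits is
read as a kernel on all of `Fin N` that depends only on the coordinates in that set; a tensor
product over disjoint sets is then an entrywise product `⊙`. A label prescribes unnormalised rays,
and `cone α X` is spanned over `ℝ≥0` by products of one ray for each block in `X`. Since every block
tensor has trace one, `α ⊨ ρ` amounts to `ρ ∈ cone α univ` together with `tr ρ ≤ 1` (`Sat.mem_cone`,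
`sat_of_mem_cone`). The trace bound is supplied by the concrete semantics, so no weights have to be
followed through a program, and a measurement branch of probability zero is just the zero vector.

Gates and projections are conjugations by an operator local to a union of blocks. Such an operator
passes through the factors outside that union, so by linearity each abstract step need only be
checked on a product of rays of the blocks it touches (`conj_mem_cone`). There it becomes stabilizer
theory. Commutation of Pauli strings is the vanishing of a symplectic form over `ℤ/2`; an isotropic
group on `A` has rank at most `|A|`, so a stabilizer is maximal and contains every string on `A`
that commutes with it. Maximality yields the rank of a measured stabilizer, and the fact that a
stabilizer commuting with `Z` contains `Z`, which makes `T` act as a phase. A nonidentity one-qubit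
Pauli matrix has one-dimensional eigenspaces, so a vector stabilised by one factors off that qubit;
this is what justifies `update` (`splitStab_mem_cone`). Signs being disregarded, a Pauli correction
preserves every label, which explains why `CX` may leave an assignment unchanged when its control is
a `Z`-eigenstate or its target an `X`-eigenstate.

The order and the joins rest on two facts: the identity on `A` is a mixture of joint eigenstates of
any commuting group on `A`, so `I` lies below every label (`ind_mem_stabCone`), and any product of
rays is a mixture of pure states, so merging under `■` is harmless. Hence `cone_mono`. For a loop,
the `n`-th summand lies in the cone of the `n`-th assignment of the join, and the infinite sum stays
in the cone of the join because in finite dimension a convex cone, closed or not, contains the sums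
of its convergent series. -/

/-- In finite dimension a convex cone contains the sums of its convergent series. -/
theorem mem_of_hasSum_of_forall_mem {E : Type*} [AddCommGroup E] [Module ℝ E] [TopologicalSpace E]
    [IsTopologicalAddGroup E] [ContinuousSMul ℝ E] [T2Space E] [FiniteDimensional ℝ E]
    (K : Submodule ℝ≥0 E) {v : ℕ → E} {s : E} (hs : HasSum v s) (hv : ∀ n, v n ∈ K) : s ∈ K := by
  let V : ℕ →o Submodule ℝ E :=
    ⟨fun m => Submodule.span ℝ (v '' Set.Iio m), fun a b h =>
      Submodule.span_mono (Set.image_mono (Set.Iio_subset_Iio h))⟩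
  -- The spans of the first terms stop growing, so the first `m` terms span all the others.
  obtain ⟨m, hm⟩ := monotone_stabilizes_iff_noetherian.2 (inferInstance : IsNoetherian ℝ E) V
  have hvm : ∀ n, v n ∈ V m := by
    intro n
    rw [hm (max m (n + 1)) (le_max_left _ _)]
    exact Submodule.subset_span ⟨n, by simp, rfl⟩
  have hV : V m = Submodule.span ℝ (Set.range fun k : Fin m => v k) := by
    change Submodule.span ℝ (v '' Set.Iio m) = _
    congr 1
    ext x
    constructor
    · rintro ⟨k, hk, rfl⟩; exact ⟨⟨k, hk⟩, rfl⟩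
    · rintro ⟨k, rfl⟩; exact ⟨k, k.2, rfl⟩
  have hVc : IsClosed (V m : Set E) := Submodule.closed_of_finiteDimensional _
  let φ : (Fin m → ℝ) →ₗ[ℝ] E := Fintype.linearCombination ℝ fun k : Fin m => v k
  have hφ : LinearMap.range φ = V m := by
    rw [hV, Fintype.range_linearCombination]
  -- A linear, hence continuous, choice of coefficients expresses every vector of `V m` in the first
  -- `m` terms; small remainders get small coefficients.
  obtain ⟨g, hg⟩ := φ.rangeRestrict.exists_rightInverse_of_surjective
    (LinearMap.range_eq_top.2 φ.surjective_rangeRestrict)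
  have hgc : Continuous g := LinearMap.continuous_of_finiteDimensional g
  have hpart : ∀ M, ∑ n ∈ Finset.range M, v n ∈ V m := fun M =>
    Submodule.sum_mem _ fun n _ => hvm n
  have hsV : s ∈ V m := hVc.mem_of_tendsto hs.tendsto_sum_nat (Eventually.of_forall hpart)
  let t : ℕ → LinearMap.range φ := fun M =>
    ⟨s - ∑ n ∈ Finset.range M, v n, hφ ▸ Submodule.sub_mem _ hsV (hpart M)⟩
  have ht : Tendsto t atTop (𝓝 0) := by
    rw [tendsto_subtype_rng]
    simpa using (tendsto_const_nhds (x := s)).sub hs.tendsto_sum_nat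
  have hgt : Tendsto (fun M => g (t M)) atTop (𝓝 0) := by
    simpa [Function.comp_def] using (hgc.tendsto 0).comp ht
  -- Each of the first `m` terms occurs in the partial sum with coefficient `1`. Once the
  -- coefficients of the remainder exceed `-1`, the remainder can be absorbed there without leaving
  -- the cone.
  have hev : ∀ᶠ M in atTop, ∀ k : Fin m, -1 < g (t M) k := by
    rw [eventually_all]
    intro k
    have := (tendsto_pi_nhds.1 hgt) k
    exact this.eventually (lt_mem_nhds (by simp))
  obtain ⟨M, hM, hmM⟩ := (hev.and (eventually_ge_atTop m)).exists
  have hsum : φ (g (t M)) = s - ∑ n ∈ Finset.range M, v n := by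
    have := LinearMap.congr_fun hg (t M)
    exact congrArg Subtype.val this
  have hs' : s = ∑ k : Fin m, (1 + g (t M) k) • v k + ∑ n ∈ Finset.Ico m M, v n := by
    have h1 : φ (g (t M)) = ∑ k : Fin m, g (t M) k • v k := by
      simp [φ, Fintype.linearCombination_apply]
    have h2 : ∑ k : Fin m, v k = ∑ n ∈ Finset.range m, v n := Fin.sum_univ_eq_sum_range v m
    simp only [add_smul, one_smul, Finset.sum_add_distrib]
    rw [← h1, hsum, h2, ← Finset.sum_range_add_sum_Ico v hmM]
    abel
  rw [hs']
  refine K.add_mem (K.sum_mem fun k _ => ?_) (K.sum_mem fun n _ => hv n)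
  have : (1 + g (t M) k) • v k = (⟨1 + g (t M) k, by linarith [hM k]⟩ : ℝ≥0) • v k := rfl
  rw [this]
  exact K.smul_mem _ (hv k)

end Convergence

variable {N : ℕ}

/-! ## Pauli strings -/

theorem Pauli.cases (p : Pauli) : p = 0 ∨ p = pX ∨ p = pY ∨ p = pZ := by
  revert p; decide

@[simp] theorem Pauli.mat_zero : Pauli.mat 0 = 1 := by
  have h1 : (0 : Pauli) ≠ pX := by decide
  have h2 : (0 : Pauli) ≠ pY := by decide
  have h3 : (0 : Pauli) ≠ pZ := by decide
  simp [Pauli.mat, h1, h2, h3]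

@[simp] theorem Pauli.mat_pX : Pauli.mat pX = matX := by simp [Pauli.mat]

@[simp] theorem Pauli.mat_pY : Pauli.mat pY = matY := by
  have h1 : pY ≠ pX := by decide
  simp [Pauli.mat, h1]

@[simp] theorem Pauli.mat_pZ : Pauli.mat pZ = matZ := by
  have h1 : pZ ≠ pX := by decide
  have h2 : pZ ≠ pY := by decide
  simp [Pauli.mat, h1, h2]

theorem Pauli.mat_mul_self (p : Pauli) : p.mat * p.mat = 1 := by
  rcases p.cases with h | h | h | h <;> subst h <;> ext a b <;> fin_cases a <;> fin_cases b <;>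
    simp [matX, matY, matZ, Matrix.mul_apply, Fin.sum_univ_two]

theorem Pauli.mat_mul (p q : Pauli) : ∃ c : ℂ, p.mat * q.mat = c • (p + q).mat := by
  have hXY : pX + pY = pZ := by decide
  have hYX : pY + pX = pZ := by decide
  have hXZ : pX + pZ = pY := by decide
  have hZX : pZ + pX = pY := by decide
  have hYZ : pY + pZ = pX := by decide
  have hZY : pZ + pY = pX := by decide
  have hself : ∀ r : Pauli, r + r = 0 := by decide
  rcases p.cases with h | h | h | h <;> rcases q.cases with h' | h' | h' | h' <;>
    subst h <;> subst h' <;> simp only [hXY, hYX, hXZ, hZX, hYZ, hZY, hself, zero_add, add_zero]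
  case inl.inl | inl.inr.inl | inl.inr.inr.inl | inl.inr.inr.inr => exact ⟨1, by simp⟩
  case inr.inl.inl | inr.inr.inl.inl | inr.inr.inr.inl => exact ⟨1, by simp⟩
  case inr.inl.inr.inl | inr.inr.inl.inr.inr.inl | inr.inr.inr.inr.inr.inr =>
    exact ⟨1, by simp [Pauli.mat_mul_self, -mat_pX, -mat_pY, -mat_pZ]⟩
  case inr.inl.inr.inr.inl | inr.inr.inl.inr.inr.inr | inr.inr.inr.inr.inl =>
    refine ⟨Complex.I, ?_⟩
    ext a b; fin_cases a <;> fin_cases b <;> simp [matX, matY, matZ, Matrix.mul_apply]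
  all_goals
    refine ⟨-Complex.I, ?_⟩
    ext a b; fin_cases a <;> fin_cases b <;> simp [matX, matY, matZ, Matrix.mul_apply]

theorem Pauli.mat_conjTranspose (p : Pauli) : p.mat.conjTranspose = p.mat := by
  rcases p.cases with h | h | h | h <;> subst h <;> ext a b <;> fin_cases a <;> fin_cases b <;>
    simp [matX, matY, matZ]

/-- The sign character of `ℤ/2`. -/
def signChar (a : ZMod 2) : ℂ := if a = 0 then 1 else -1

theorem signChar_add (a b : ZMod 2) : signChar (a + b) = signChar a * signChar b := by
  have h : ∀ a : ZMod 2, a = 0 ∨ a = 1 := by decide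
  have h10 : (1 : ZMod 2) ≠ 0 := by decide
  have h11 : (1 + 1 : ZMod 2) = 0 := by decide
  rcases h a with ha | ha <;> rcases h b with hb | hb <;> subst ha <;> subst hb <;>
    simp [signChar, h11]

theorem signChar_sum {ι : Type*} (s : Finset ι) (f : ι → ZMod 2) :
    signChar (∑ i ∈ s, f i) = ∏ i ∈ s, signChar (f i) := by
  classical
  induction s using Finset.induction_on with
  | empty => simp [signChar]
  | insert i s hi ih => rw [Finset.sum_insert hi, Finset.prod_insert hi, signChar_add, ih]

theorem signChar_eq_one {a : ZMod 2} : signChar a = 1 ↔ a = 0 := by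
  unfold signChar
  split_ifs with h
  · simp [h]
  · simp only [h, iff_false]; norm_num

/-- The symplectic form on Pauli strings. -/
def symp (ι : Type) [Fintype ι] : LinearMap.BilinForm (ZMod 2) (ι → Pauli) :=
  LinearMap.mk₂ (ZMod 2) (fun σ τ => ∑ i, ((σ i).1 * (τ i).2 + (σ i).2 * (τ i).1))
    (fun a b c => by
      rw [← Finset.sum_add_distrib]; exact Finset.sum_congr rfl fun i _ => by simp; ring)
    (fun a b c => by
      rw [Finset.smul_sum]; exact Finset.sum_congr rfl fun i _ => by simp; ring)
    (fun a b c => by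
      rw [← Finset.sum_add_distrib]; exact Finset.sum_congr rfl fun i _ => by simp; ring)
    (fun a b c => by
      rw [Finset.smul_sum]; exact Finset.sum_congr rfl fun i _ => by simp; ring)

theorem symp_apply {ι : Type} [Fintype ι] (σ τ : ι → Pauli) :
    symp ι σ τ = ∑ i, ((σ i).1 * (τ i).2 + (σ i).2 * (τ i).1) := rfl

theorem symp_comm {ι : Type} [Fintype ι] (σ τ : ι → Pauli) : symp ι σ τ = symp ι τ σ := by
  rw [symp_apply, symp_apply]
  exact Finset.sum_congr rfl fun i _ => by ring

theorem symp_self {ι : Type} [Fintype ι] (σ : ι → Pauli) : symp ι σ σ = 0 := by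
  rw [symp_apply]
  refine Finset.sum_eq_zero fun i _ => ?_
  generalize σ i = p
  revert p; decide

theorem symp_single {ι : Type} [Fintype ι] [DecidableEq ι] (σ : ι → Pauli) (i : ι) (p : Pauli) :
    symp ι σ (Pi.single i p) = (σ i).1 * p.2 + (σ i).2 * p.1 := by
  rw [symp_apply, Finset.sum_eq_single i]
  · simp
  · intro j _ hj; simp [hj]
  · simp

/-- Nondegeneracy: pairing with `X` and with `Z` at a site reads off both bits of the string there.
-/
theorem symp_ker {ι : Type} [Fintype ι] [DecidableEq ι] : LinearMap.ker (symp ι) = ⊥ := by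
  rw [LinearMap.ker_eq_bot']
  intro σ h
  funext i
  have h1 := symp_single σ i pX
  have h2 := symp_single σ i pZ
  rw [h] at h1 h2
  simp [pX, pZ] at h1 h2
  exact Prod.ext h2.symm h1.symm

/-- An isotropic subspace lies in its own orthogonal, and by nondegeneracy the two dimensions add up
to `2 * card ι`. -/
theorem finrank_le_of_symp_eq_zero {ι : Type} [Fintype ι] [DecidableEq ι]
    (T : Submodule (ZMod 2) (ι → Pauli)) (hT : ∀ σ ∈ T, ∀ τ ∈ T, symp ι σ τ = 0) :
    Module.finrank (ZMod 2) T ≤ Fintype.card ι := by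
  have h := LinearMap.BilinForm.finrank_add_finrank_orthogonal' (B := symp ι) T
  have hle : T ≤ (symp ι).orthogonal T := by
    intro σ hσ τ hτ
    exact hT τ hτ σ hσ
  have h1 := Submodule.finrank_mono hle
  have h2 : Module.finrank (ZMod 2) (ι → Pauli) = 2 * Fintype.card ι := by
    simp [Module.finrank_pi_fintype, mul_comm]
  have h3 : Module.finrank (ZMod 2) (T ⊓ LinearMap.ker (symp ι) : Submodule _ _) = 0 := by
    rw [symp_ker, inf_bot_eq, finrank_bot]
  have h4 := h.trans (congrArg₂ (· + ·) h2 h3)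
  omega

theorem symp_restrict {A : Finset (Fin N)} {σ : PString N} (hσ : σ ∈ supported A)
    (τ : PString N) : symp A (fun i => σ i) (fun i => τ i) = symp (Fin N) σ τ := by
  rw [symp_apply, symp_apply, Finset.sum_coe_sort A fun i => (σ i).1 * (τ i).2 + (σ i).2 * (τ i).1]
  refine Finset.sum_subset (Finset.subset_univ _) fun i _ hi => ?_
  rw [hσ i hi]; simp

/-- A commuting group of Pauli strings on the qubits in `A` has rank at most `|A|`. -/
theorem finrank_le_card {A : Finset (Fin N)} {T : PGroup N} (hA : T ≤ supported A)
    (hT : ∀ σ ∈ T, ∀ τ ∈ T, symp (Fin N) σ τ = 0) : Module.finrank (ZMod 2) T ≤ A.card := by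
  let R : PString N →ₗ[ZMod 2] (A → Pauli) :=
    LinearMap.funLeft (ZMod 2) Pauli ((↑) : A → Fin N)
  have hinj : Set.InjOn R T := by
    intro σ hσ τ hτ h
    funext i
    by_cases hi : i ∈ A
    · exact congrFun h ⟨i, hi⟩
    · rw [hA hσ i hi, hA hτ i hi]
  have h1 : Module.finrank (ZMod 2) (T.map R) = Module.finrank (ZMod 2) T := by
    have hd : Function.Injective (R.domRestrict T) := fun x y h => Subtype.ext (hinj x.2 y.2 h)
    rw [← LinearMap.range_domRestrict, LinearMap.finrank_range_of_inj hd]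
  rw [← h1, ← Fintype.card_coe]
  refine finrank_le_of_symp_eq_zero _ ?_
  rintro _ ⟨σ, hσ, rfl⟩ _ ⟨τ, hτ, rfl⟩
  exact (symp_restrict (hA hσ) τ).trans (hT σ hσ τ hτ)

/-! ## Pauli operators -/

theorem kron_smul {ι : Type} [Fintype ι] (c : ι → ℂ) (M : ι → Matrix (Fin 2) (Fin 2) ℂ) :
    kron (fun i => c i • M i) = (∏ i, c i) • kron M := by
  ext x y
  simp [kron, Finset.prod_mul_distrib]

theorem pauliOp_zero : pauliOp (0 : PString N) = 1 := by
  simp [pauliOp, kron_one]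

theorem pauliOp_mul_self (σ : PString N) : pauliOp σ * pauliOp σ = 1 := by
  rw [pauliOp, kron_mul]
  simp [Pauli.mat_mul_self, kron_one]

theorem pauliOp_add (σ τ : PString N) :
    ∃ c : ℂ, pauliOp σ * pauliOp τ = c • pauliOp (σ + τ) := by
  choose c hc using fun i => Pauli.mat_mul (σ i) (τ i)
  refine ⟨∏ i, c i, ?_⟩
  rw [pauliOp, pauliOp, kron_mul, pauliOp, ← kron_smul]
  simp [hc]

theorem Pauli.mat_comm (p q : Pauli) :
    p.mat * q.mat = signChar (p.1 * q.2 + p.2 * q.1) • (q.mat * p.mat) := by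
  have h11 : (1 + 1 : ZMod 2) = 0 := by decide
  rcases p.cases with h | h | h | h <;> rcases q.cases with h' | h' | h' | h' <;>
    subst h <;> subst h' <;> ext a b <;> fin_cases a <;> fin_cases b <;>
    simp [matX, matY, matZ, Matrix.mul_apply, signChar] <;> simp [pX, pY, pZ, h11]

theorem pauliOp_comm (σ τ : PString N) :
    pauliOp σ * pauliOp τ = signChar (symp (Fin N) σ τ) • (pauliOp τ * pauliOp σ) := by
  rw [pauliOp, pauliOp, kron_mul, kron_mul, symp_apply, signChar_sum, ← kron_smul]
  congr 1
  funext i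
  exact Pauli.mat_comm _ _

theorem pauliOp_ne_zero (σ : PString N) : pauliOp σ ≠ 0 := by
  intro h
  have := pauliOp_mul_self σ
  rw [h, zero_mul] at this
  exact zero_ne_one this

/-- Two Pauli operators agree with their swapped product up to the sign `signChar (symp σ τ)`, and
the product is invertible, so the sign is determined. This turns every commutation condition into
linear algebra over `ℤ/2`. -/
theorem commute_pauliOp {σ τ : PString N} :
    Commute (pauliOp σ) (pauliOp τ) ↔ symp (Fin N) σ τ = 0 := by
  rw [Commute, SemiconjBy]
  have h0 : pauliOp τ * pauliOp σ ≠ 0 := by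
    intro h
    have : pauliOp τ * (pauliOp τ * pauliOp σ) * pauliOp σ = 1 := by
      rw [← mul_assoc, pauliOp_mul_self, one_mul, pauliOp_mul_self]
    rw [h, mul_zero, zero_mul] at this
    exact zero_ne_one this
  constructor
  · intro h
    rw [pauliOp_comm] at h
    rw [← signChar_eq_one]
    by_contra hc
    have : (signChar (symp (Fin N) σ τ) - 1) • (pauliOp τ * pauliOp σ) = 0 := by
      rw [sub_smul, h, one_smul, sub_self]
    rcases smul_eq_zero.1 this with h' | h'
    · exact hc (sub_eq_zero.1 h')
    · exact h0 h'
  · intro h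
    rw [pauliOp_comm, h]
    simp [signChar]

open Matrix

/-! ## Local operators -/

/-- State vectors, not necessarily normalised. -/
abbrev Vec (N : ℕ) : Type := (Fin N → Fin 2) → ℂ

/-- `|ψ⟩⟨ψ|`. -/
def outer (ψ : Vec N) : Op (Fin N) := vecMulVec ψ (star ψ)

theorem outer_apply (ψ : Vec N) (x y : Fin N → Fin 2) : outer ψ x y = ψ x * star (ψ y) := rfl

theorem mul_outer_mul (U : Op (Fin N)) (ψ : Vec N) :
    U * outer ψ * U.conjTranspose = outer (U *ᵥ ψ) := by
  rw [outer, outer, mul_vecMulVec, vecMulVec_mul, star_mulVec]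

theorem outer_mul (ψ φ : Vec N) : outer (ψ * φ) = outer ψ ⊙ outer φ := by
  ext x y
  simp only [outer_apply, hadamard_apply, Pi.mul_apply, star_mul']
  ring

theorem outer_smul (c : ℂ) (ψ : Vec N) : outer (c • ψ) = (c * star c) • outer ψ := by
  ext x y
  simp only [outer_apply, Pi.smul_apply, Matrix.smul_apply, smul_eq_mul, star_mul']
  ring

/-- `U` acts on the qubits in `A` only. -/
structure IsLocal (A : Finset (Fin N)) (U : Op (Fin N)) : Prop where
  mulVec_mul : ∀ f h : Vec N, DependsOn h {i | i ∉ A} → U *ᵥ (f * h) = (U *ᵥ f) * h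
  dependsOn : ∀ B : Finset (Fin N), A ⊆ B → ∀ f : Vec N, DependsOn f (B : Set (Fin N)) →
    DependsOn (U *ᵥ f) (B : Set (Fin N))

theorem IsLocal.mono {A B : Finset (Fin N)} (h : A ⊆ B) {U : Op (Fin N)} (hU : IsLocal A U) :
    IsLocal B U :=
  ⟨fun f g hg => hU.mulVec_mul f g (hg.mono (Set.ofPred_subset_ofPred.2 fun _ hi hA => hi (h hA))),
    fun C hC f hf => hU.dependsOn C (h.trans hC) f hf⟩

theorem IsLocal.mul_hadamard {A : Finset (Fin N)} {U : Op (Fin N)} (hU : IsLocal A U)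
    (K G : Op (Fin N)) (hG : ∀ y, DependsOn (fun x => G x y) {i | i ∉ A}) :
    U * (K ⊙ G) = (U * K) ⊙ G := by
  ext x y
  have h := congrFun (hU.mulVec_mul (fun x => K x y) (fun x => G x y) (hG y)) x
  simpa [mulVec, dotProduct, mul_apply] using h

/-- This is `(U ⊗ 1)(K ⊗ G)(U ⊗ 1)† = UKU† ⊗ G` in the language of kernels. Multiplication on the
right is the adjoint of multiplication on the left, hence the two dependence hypotheses on `G`. -/
theorem IsLocal.conj_hadamard {A : Finset (Fin N)} {U : Op (Fin N)} (hU : IsLocal A U)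
    (K G : Op (Fin N)) (hG : ∀ y, DependsOn (fun x => G x y) {i | i ∉ A})
    (hG' : ∀ x, DependsOn (fun y => G x y) {i | i ∉ A}) :
    U * (K ⊙ G) * U.conjTranspose = (U * K * U.conjTranspose) ⊙ G := by
  rw [hU.mul_hadamard K G hG]
  have h := hU.mul_hadamard (U * K).conjTranspose G.conjTranspose
    (fun y a b hab => congrArg star (hG' y hab))
  have hh : ∀ P Q : Op (Fin N), (P ⊙ Q).conjTranspose = P.conjTranspose ⊙ Q.conjTranspose :=
    fun P Q => by ext x y; simp [hadamard_apply]
  have h' := congrArg conjTranspose h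
  simp only [conjTranspose_mul, hh, conjTranspose_conjTranspose] at h'
  rw [h', mul_assoc]

theorem kron_isLocal (M : Fin N → Matrix (Fin 2) (Fin 2) ℂ) (A : Finset (Fin N))
    (hM : ∀ i, i ∉ A → M i = 1) : IsLocal A (kron M) := by
  constructor
  · intro f h hh
    funext x
    simp only [mulVec, dotProduct, Pi.mul_apply, Finset.sum_mul]
    refine Finset.sum_congr rfl fun y _ => ?_
    by_cases hxy : ∀ i, i ∉ A → x i = y i
    · rw [hh (x := x) (y := y) (fun i hi => hxy i hi)]; ring
    · push Not at hxy
      obtain ⟨i, hi, hne⟩ := hxy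
      have : kron M x y = 0 := by
        simp only [kron, of_apply]
        refine Finset.prod_eq_zero (Finset.mem_univ i) ?_
        rw [hM i hi, Matrix.one_apply_ne hne]
      rw [this]; ring
  · intro B hB f hf x x' hx
    simp only [mulVec, dotProduct]
    -- Swapping `x i` with `x' i` in each coordinate of the summation variable fixes the coordinates
    -- in `B`, where `x` and `x'` agree, and turns the identity factors off `B` for `x` into those
    -- for `x'`.
    refine Fintype.sum_equiv (Equiv.piCongrRight fun i => Equiv.swap (x i) (x' i)) _ _ fun y => ?_
    congr 1
    · simp only [kron, of_apply]
      refine Finset.prod_congr rfl fun i _ => ?_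
      by_cases hi : i ∈ B
      · simp [hx i hi]
      · rw [hM i fun h => hi (hB h)]
        have : ((x i : Fin 2) = y i) ↔ (x' i = Equiv.swap (x i) (x' i) (y i)) := by
          conv_rhs => lhs; rw [← Equiv.swap_apply_left (x i) (x' i)]
          rw [EmbeddingLike.apply_eq_iff_eq]
        simp only [one_apply, Equiv.piCongrRight_apply, Pi.map_apply]
        exact if_congr this rfl rfl
    · refine hf fun i hi => ?_
      simp [hx i hi]

theorem onQubit_isLocal (i : Fin N) (U : Matrix (Fin 2) (Fin 2) ℂ) : IsLocal {i} (onQubit i U) :=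
  kron_isLocal _ _ fun j hj => by
    rw [Finset.mem_singleton] at hj
    simp [Function.update_of_ne hj]

theorem pauliOp_isLocal {A : Finset (Fin N)} {σ : PString N} (hσ : σ ∈ supported A) :
    IsLocal A (pauliOp σ) :=
  kron_isLocal _ _ fun j hj => by simp [hσ j hj]

theorem onQubit_apply (i : Fin N) (U : Matrix (Fin 2) (Fin 2) ℂ) (x y : Fin N → Fin 2) :
    onQubit i U x y = if ∀ k, k ≠ i → y k = x k then U (x i) (y i) else 0 := by
  simp only [onQubit, kron, of_apply]
  rw [← Finset.mul_prod_erase _ _ (Finset.mem_univ i), Function.update_self]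
  split_ifs with h
  · rw [Finset.prod_eq_one, mul_one]
    intro k hk
    rw [Function.update_of_ne (Finset.ne_of_mem_erase hk), h k (Finset.ne_of_mem_erase hk),
      one_apply_eq]
  · push Not at h
    obtain ⟨k, hk, hne⟩ := h
    rw [Finset.prod_eq_zero (i := k) (by simp [hk]), mul_zero]
    rw [Function.update_of_ne hk, one_apply_ne hne.symm]

theorem onQubit_mulVec (i : Fin N) (U : Matrix (Fin 2) (Fin 2) ℂ) (f : Vec N)
    (x : Fin N → Fin 2) :
    (onQubit i U *ᵥ f) x = ∑ b, U (x i) b * f (Function.update x i b) := by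
  simp only [mulVec, dotProduct]
  symm
  refine Fintype.sum_of_injective (fun b => Function.update x i b)
    (Function.update_injective x i) _ _ ?_ ?_
  · intro y hy
    rw [onQubit_apply, if_neg, zero_mul]
    intro h
    refine hy ⟨y i, ?_⟩
    funext k
    by_cases hk : k = i
    · subst hk; simp
    · simp [hk, h k hk]
  · intro b
    rw [onQubit_apply, if_pos fun k hk => Function.update_of_ne hk _ _]
    simp

theorem proj_mulVec (b : Fin 2) (i : Fin N) (f : Vec N) (x : Fin N → Fin 2) :
    (proj b i *ᵥ f) x = if x i = b then f x else 0 := by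
  rw [proj, onQubit_mulVec]
  split_ifs with h
  · subst h
    rw [Finset.sum_eq_single (x i)]
    · simp
    · intro c _ hc; simp [hc.symm]
    · simp
  · refine Finset.sum_eq_zero fun c _ => ?_
    rw [single_apply, if_neg, zero_mul]
    rintro ⟨h', -⟩; exact h h'.symm

theorem pauliOp_single (i : Fin N) (p : Pauli) : pauliOp (Pi.single i p) = onQubit i p.mat := by
  unfold pauliOp onQubit
  congr 1
  funext j
  by_cases h : j = i
  · subst h; simp
  · simp [h]

theorem matCX_mulVec (i j : Fin N) (hij : i ≠ j) (f : Vec N) (x : Fin N → Fin 2) :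
    (matCX i j *ᵥ f) x = f (Function.update x j (x j + x i)) := by
  have h2 : ∀ a b : Fin 2, a + b + b = a := by decide
  have key : ∀ y : Fin N → Fin 2, x = Function.update y j (y j + y i) ↔
      y = Function.update x j (x j + x i) := by
    intro y
    constructor
    · rintro rfl; funext k
      by_cases hk : k = j
      · subst hk; simp [hij, h2]
      · simp [hk]
    · rintro rfl; funext k
      by_cases hk : k = j
      · subst hk; simp [hij, h2]
      · simp [hk]
  simp only [mulVec, dotProduct, matCX, of_apply, key]
  simp

theorem matCX_isLocal (i j : Fin N) (hij : i ≠ j) : IsLocal {i, j} (matCX i j) := by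
  constructor
  · intro f h hh
    funext x
    simp only [matCX_mulVec i j hij, Pi.mul_apply]
    congr 1
    refine hh fun k hk => ?_
    simp only [Set.mem_ofPred_eq, Finset.mem_insert, Finset.mem_singleton, not_or] at hk
    simp [hk.2]
  · intro B hB f hf x y hxy
    rw [matCX_mulVec i j hij, matCX_mulVec i j hij]
    refine hf fun k hk => ?_
    by_cases hkj : k = j
    · subst hkj
      simp [hxy k hk, hxy i (hB (by simp))]
    · simp [hkj, hxy k hk]

/-! ## Vectors stabilised up to sign -/

/-- `ψ` is, up to sign, fixed by the operators in `S`. -/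
def Stabilizes (S : PGroup N) (ψ : Vec N) : Prop :=
  ∀ σ ∈ S, pauliOp σ *ᵥ ψ = ψ ∨ pauliOp σ *ᵥ ψ = -ψ

/-- A Pauli operator squares to one, so an eigenvalue on a nonzero vector is `±1`; the zero vector
satisfies the conclusion trivially. Phases can therefore be left unspecified until the end of an
argument. -/
theorem eq_or_eq_neg_of_eq_smul {σ : PString N} {ψ : Vec N} {c : ℂ}
    (h : pauliOp σ *ᵥ ψ = c • ψ) : pauliOp σ *ᵥ ψ = ψ ∨ pauliOp σ *ᵥ ψ = -ψ := by
  have h1 : pauliOp σ *ᵥ (pauliOp σ *ᵥ ψ) = ψ := by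
    rw [mulVec_mulVec, pauliOp_mul_self, one_mulVec]
  rw [h, mulVec_smul, h, smul_smul] at h1
  have h2 : (c * c - 1) • ψ = 0 := by rw [sub_smul, h1, one_smul, sub_self]
  rcases smul_eq_zero.1 h2 with h3 | h3
  · have h4 : (c - 1) * (c + 1) = 0 := by linear_combination h3
    rcases mul_eq_zero.1 h4 with h5 | h5
    · left; rw [h, sub_eq_zero.1 h5, one_smul]
    · right; rw [h, eq_neg_of_add_eq_zero_left h5, neg_smul, one_smul]
  · left; rw [h3, mulVec_zero]

/-- It suffices to test generators: `pauliOp` is multiplicative up to a phase, so being an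
eigenvector, with whatever eigenvalue, passes to sums of strings. -/
theorem stabilizes_span {X : Set (PString N)} {ψ : Vec N}
    (h : ∀ σ ∈ X, pauliOp σ *ᵥ ψ = ψ ∨ pauliOp σ *ᵥ ψ = -ψ) :
    Stabilizes (Submodule.span (ZMod 2) X) ψ := by
  intro σ hσ
  suffices ∃ c : ℂ, pauliOp σ *ᵥ ψ = c • ψ from eq_or_eq_neg_of_eq_smul this.choose_spec
  induction hσ using Submodule.span_induction with
  | mem σ hσ =>
    rcases h σ hσ with h | h
    · exact ⟨1, by rw [h, one_smul]⟩
    · exact ⟨-1, by rw [h, neg_smul, one_smul]⟩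
  | zero => exact ⟨1, by rw [pauliOp_zero, one_mulVec, one_smul]⟩
  | add σ τ _ _ hσ hτ =>
    obtain ⟨a, ha⟩ := hσ
    obtain ⟨b, hb⟩ := hτ
    obtain ⟨c, hc⟩ := pauliOp_add σ τ
    -- The phase relating the product of the two operators to the operator of the sum is nonzero
    -- because the product is invertible; it can be divided out.
    have hc0 : c ≠ 0 := by
      rintro rfl
      rw [zero_smul] at hc
      have h1 : pauliOp σ * (pauliOp σ * pauliOp τ) * pauliOp τ = 1 := by
        rw [← mul_assoc, pauliOp_mul_self, one_mul, pauliOp_mul_self]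
      rw [hc, mul_zero, zero_mul] at h1
      exact zero_ne_one h1
    have h2 : c • (pauliOp (σ + τ) *ᵥ ψ) = (b * a) • ψ := by
      rw [← smul_mulVec, ← hc, ← mulVec_mulVec, hb, mulVec_smul, ha, smul_smul]
    refine ⟨c⁻¹ * (b * a), ?_⟩
    rw [mul_smul, ← h2, smul_smul, inv_mul_cancel₀ hc0, one_smul]
  | smul a σ _ hσ =>
    have : ∀ a : ZMod 2, a = 0 ∨ a = 1 := by decide
    rcases this a with rfl | rfl
    · exact ⟨1, by rw [zero_smul, pauliOp_zero, one_mulVec, one_smul]⟩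
    · rwa [one_smul]

theorem Stabilizes.sup {S T : PGroup N} {ψ : Vec N} (hS : Stabilizes S ψ) (hT : Stabilizes T ψ) :
    Stabilizes (S ⊔ T) ψ := by
  have h : S ⊔ T = Submodule.span (ZMod 2) ((S : Set (PString N)) ∪ T) := by
    rw [Submodule.span_union, Submodule.span_eq, Submodule.span_eq]
  rw [h]
  exact stabilizes_span fun σ hσ => hσ.elim (hS σ) (hT σ)

theorem Stabilizes.mono {S T : PGroup N} (h : S ≤ T) {ψ : Vec N} (hT : Stabilizes T ψ) :
    Stabilizes S ψ := fun σ hσ => hT σ (h hσ)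

theorem Stabilizes.mul {A : Finset (Fin N)} {S : PGroup N} (hS : S ≤ supported A) {ψ φ : Vec N}
    (hψ : Stabilizes S ψ) (hφ : DependsOn φ {i | i ∉ A}) : Stabilizes S (ψ * φ) := by
  intro σ hσ
  rw [(pauliOp_isLocal (hS hσ)).mulVec_mul ψ φ hφ]
  rcases hψ σ hσ with h | h <;> rw [h]
  · exact Or.inl rfl
  · exact Or.inr (neg_mul _ _)

theorem Stabilizes.smul {S : PGroup N} {ψ : Vec N} (hψ : Stabilizes S ψ) (c : ℂ) :
    Stabilizes S (c • ψ) := by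
  intro σ hσ
  rw [mulVec_smul]
  rcases hψ σ hσ with h | h <;> rw [h]
  · exact Or.inl rfl
  · exact Or.inr (smul_neg _ _)

theorem Stabilizes.conjGroup {S : PGroup N} {ψ : Vec N} (hψ : Stabilizes S ψ) {U : Op (Fin N)}
    (hU : U.conjTranspose * U = 1) : Stabilizes (conjGroup U S) (U *ᵥ ψ) := by
  refine stabilizes_span ?_
  rintro τ ⟨σ, hσ, h⟩
  have h1 : (U * pauliOp σ * U.conjTranspose) *ᵥ (U *ᵥ ψ) = U *ᵥ (pauliOp σ *ᵥ ψ) := by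
    rw [mulVec_mulVec, mul_assoc, hU, mul_one, mulVec_mulVec]
  rcases h with h | h <;> rcases hψ σ hσ with h' | h' <;> rw [h]
  · left; rw [h1, h']
  · right; rw [h1, h', mulVec_neg]
  · right; rw [neg_mulVec, h1, h']
  · left; rw [neg_mulVec, h1, h', mulVec_neg, neg_neg]

/-! ## Cones of product states -/

/-- The kernel of the maximally mixed state on the qubits in `A`. -/
def ind (A : Finset (Fin N)) : Op (Fin N) := of fun x y => if ∀ i ∈ A, x i = y i then 1 else 0

theorem ind_apply (A : Finset (Fin N)) (x y : Fin N → Fin 2) :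
    ind A x y = if ∀ i ∈ A, x i = y i then 1 else 0 := rfl

/-- The kernels, as functions of all qubits, of the unnormalised states that a label prescribes. -/
def Label.IsRay (A : Finset (Fin N)) (g : Op (Fin N)) : Label N → Prop
  | .mixed => g = ind A
  | .box => ∃ ψ : Vec N, DependsOn ψ (A : Set (Fin N)) ∧ g = outer ψ
  | .stab S => ∃ ψ : Vec N, DependsOn ψ (A : Set (Fin N)) ∧ Stabilizes S ψ ∧ g = outer ψ

/-- `M` is the product of rays of the blocks of `α` that meet `X`. -/
def IsProd (α : PreAssignment N) (X : Finset (Fin N)) (M : Op (Fin N)) : Prop :=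
  ∃ g : Finset (Fin N) → Op (Fin N), (∀ i ∈ X, (α i).2.IsRay (α i).1 (g (α i).1)) ∧
    M = of fun x y => ∏ A ∈ X.image (fun i => (α i).1), g A x y

/-- The convex cone generated by the product states on `X`. -/
noncomputable def cone (α : PreAssignment N) (X : Finset (Fin N)) : Submodule ℝ≥0 (Op (Fin N)) :=
  Submodule.span ℝ≥0 {M | IsProd α X M}

/-- The sets of an assignment form a partition. -/
structure IsPartition (α : PreAssignment N) : Prop where
  mem : ∀ i, i ∈ (α i).1
  eq_of_mem : ∀ i, ∀ j ∈ (α i).1, α j = α i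

theorem IsAssignment.isPartition {α : PreAssignment N} (h : IsAssignment α) : IsPartition α :=
  ⟨h.mem, h.eq_of_mem⟩

/-- `X` is a union of blocks. -/
def IsUnion (α : PreAssignment N) (X : Finset (Fin N)) : Prop := ∀ i ∈ X, (α i).1 ⊆ X

theorem IsPartition.isUnion_block {α : PreAssignment N} (h : IsPartition α) (i : Fin N) :
    IsUnion α (α i).1 := fun j hj => by rw [h.eq_of_mem i j hj]

theorem isUnion_univ (α : PreAssignment N) : IsUnion α Finset.univ := fun _ _ =>
  Finset.subset_univ _

theorem IsUnion.union {α : PreAssignment N} {X Y : Finset (Fin N)} (hX : IsUnion α X)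
    (hY : IsUnion α Y) : IsUnion α (X ∪ Y) := by
  intro i hi
  rcases Finset.mem_union.1 hi with h | h
  · exact (hX i h).trans Finset.subset_union_left
  · exact (hY i h).trans Finset.subset_union_right

theorem IsUnion.sdiff {α : PreAssignment N} (h : IsPartition α) {X Y : Finset (Fin N)}
    (hX : IsUnion α X) (hY : IsUnion α Y) : IsUnion α (X \ Y) := by
  intro i hi j hj
  rw [Finset.mem_sdiff] at hi ⊢
  refine ⟨hX i hi.1 hj, fun hjY => hi.2 (hY j hjY ?_)⟩
  rw [h.eq_of_mem i j hj]
  exact h.mem i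

/-- A union of blocks is built up by adjoining one whole block at a time; products over blocks are
treated by this induction. -/
theorem IsPartition.union_induction {α : PreAssignment N} (h : IsPartition α)
    {P : Finset (Fin N) → Prop} (h0 : P ∅)
    (hs : ∀ i X, IsUnion α X → Disjoint (α i).1 X → P X → P ((α i).1 ∪ X))
    (X : Finset (Fin N)) (hX : IsUnion α X) : P X := by
  induction X using Finset.strongInduction with
  | H X ih =>
    rcases X.eq_empty_or_nonempty with rfl | ⟨i, hi⟩
    · exact h0
    · have hsub := hX i hi
      have hU := hX.sdiff h (h.isUnion_block i)
      have hlt : X \ (α i).1 ⊂ X :=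
        Finset.sdiff_ssubset hsub ⟨i, h.mem i⟩
      have := hs i _ hU Finset.disjoint_sdiff (ih _ hlt hU)
      rwa [Finset.union_sdiff_of_subset hsub] at this

/-- The kernel depends only on the qubits in `A`. -/
def KernelOn (A : Finset (Fin N)) (g : Op (Fin N)) : Prop :=
  ∀ x x' y y', (∀ i ∈ A, x i = x' i) → (∀ i ∈ A, y i = y' i) → g x y = g x' y'

theorem kernelOn_outer {A : Finset (Fin N)} {ψ : Vec N} (h : DependsOn ψ (A : Set (Fin N))) :
    KernelOn A (outer ψ) := by
  intro x x' y y' hx hy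
  rw [outer_apply, outer_apply, h hx, h hy]

theorem Label.IsRay.kernelOn {A : Finset (Fin N)} {g : Op (Fin N)} {L : Label N}
    (h : L.IsRay A g) : KernelOn A g := by
  rcases L with _ | _ | S
  · rw [show g = ind A from h]
    intro x x' y y' hx hy
    rw [ind_apply, ind_apply]
    exact if_congr (forall₂_congr fun i hi => by rw [hx i hi, hy i hi]) rfl rfl
  · obtain ⟨ψ, h1, rfl⟩ := h; exact kernelOn_outer h1
  · obtain ⟨ψ, h1, _, rfl⟩ := h; exact kernelOn_outer h1

theorem IsProd.kernelOn {α : PreAssignment N} {X : Finset (Fin N)} (hX : IsUnion α X)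
    {M : Op (Fin N)} (h : IsProd α X M) : KernelOn X M := by
  obtain ⟨g, hg, rfl⟩ := h
  intro x x' y y' hx hy
  simp only [of_apply]
  refine Finset.prod_congr rfl fun A hA => ?_
  obtain ⟨i, hi, rfl⟩ := Finset.mem_image.1 hA
  exact (hg i hi).kernelOn x x' y y' (fun j hj => hx j (hX i hi hj))
    fun j hj => hy j (hX i hi hj)

theorem image_disjoint {α : PreAssignment N} (h : IsPartition α) {X Y : Finset (Fin N)}
    (hY : IsUnion α Y) (hXY : Disjoint X Y) :
    Disjoint (X.image fun i => (α i).1) (Y.image fun i => (α i).1) := by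
  rw [Finset.disjoint_left]
  intro A hA hA'
  obtain ⟨i, hi, rfl⟩ := Finset.mem_image.1 hA
  obtain ⟨j, hj, e⟩ := Finset.mem_image.1 hA'
  exact Finset.disjoint_left.1 hXY hi (hY j hj (e ▸ h.mem i))

theorem IsProd.union {α : PreAssignment N} (h : IsPartition α) {X Y : Finset (Fin N)}
    (hY : IsUnion α Y) (hXY : Disjoint X Y) {M M' : Op (Fin N)}
    (hM : IsProd α X M) (hM' : IsProd α Y M') : IsProd α (X ∪ Y) (M ⊙ M') := by
  classical
  obtain ⟨g, hg, rfl⟩ := hM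
  obtain ⟨g', hg', rfl⟩ := hM'
  have hd := image_disjoint h hY hXY
  -- No block meets both `X` and `Y`, so the two families of factors can be glued.
  refine ⟨fun A => if A ∈ X.image (fun i => (α i).1) then g A else g' A, ?_, ?_⟩
  · intro i hi
    by_cases hA : (α i).1 ∈ X.image (fun i => (α i).1)
    · simp only [hA, if_true]
      obtain ⟨j, hj, e⟩ := Finset.mem_image.1 hA
      have e' : α i = α j := h.eq_of_mem j i (e ▸ h.mem i)
      rw [e']
      exact hg j hj
    · simp only [hA, if_false]
      rcases Finset.mem_union.1 hi with hi | hi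
      · exact absurd (Finset.mem_image_of_mem _ hi) hA
      · exact hg' i hi
  · ext x y
    simp only [hadamard_apply, of_apply]
    rw [Finset.image_union, Finset.prod_union hd]
    congr 1
    · exact Finset.prod_congr rfl fun A hA => by rw [if_pos hA]
    · exact Finset.prod_congr rfl fun A hA => by
        rw [if_neg fun h' => Finset.disjoint_left.1 hd h' hA]

theorem IsProd.split {α : PreAssignment N} (h : IsPartition α) {X Y : Finset (Fin N)}
    (hY : IsUnion α Y) (hXY : Disjoint X Y) {M : Op (Fin N)} (hM : IsProd α (X ∪ Y) M) :
    ∃ K G, IsProd α X K ∧ IsProd α Y G ∧ M = K ⊙ G := by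
  obtain ⟨g, hg, rfl⟩ := hM
  refine ⟨_, _, ⟨g, fun i hi => hg i (Finset.mem_union_left _ hi), rfl⟩,
    ⟨g, fun i hi => hg i (Finset.mem_union_right _ hi), rfl⟩, ?_⟩
  ext x y
  simp only [hadamard_apply, of_apply]
  rw [Finset.image_union, Finset.prod_union (image_disjoint h hY hXY)]

theorem isProd_block {α : PreAssignment N} (h : IsPartition α) (i : Fin N) {M : Op (Fin N)} :
    IsProd α (α i).1 M ↔ (α i).2.IsRay (α i).1 M := by
  have himg : (α i).1.image (fun j => (α j).1) = {(α i).1} := by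
    ext A
    simp only [Finset.mem_image, Finset.mem_singleton]
    constructor
    · rintro ⟨j, hj, rfl⟩; rw [h.eq_of_mem i j hj]
    · rintro rfl; exact ⟨i, h.mem i, rfl⟩
  constructor
  · rintro ⟨g, hg, rfl⟩
    rw [himg]
    simp only [Finset.prod_singleton]
    exact hg i (h.mem i)
  · intro hM
    refine ⟨fun _ => M, fun j hj => ?_, ?_⟩
    · rw [h.eq_of_mem i j hj]; exact hM
    · rw [himg]; ext x y; simp

theorem isProd_congr {α β : PreAssignment N} {X : Finset (Fin N)} (h : ∀ i ∈ X, α i = β i)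
    {M : Op (Fin N)} : IsProd α X M ↔ IsProd β X M := by
  have himg : X.image (fun j => (α j).1) = X.image (fun j => (β j).1) :=
    Finset.image_congr fun i hi => by simp only [h i hi]
  unfold IsProd
  rw [himg]
  refine exists_congr fun g => and_congr_left fun _ => forall₂_congr fun i hi => ?_
  rw [h i hi]

theorem isProd_empty {α : PreAssignment N} {M : Op (Fin N)} :
    IsProd α ∅ M ↔ M = of fun _ _ => 1 := by
  simp [IsProd]

theorem IsProd.mem_cone {α : PreAssignment N} {X : Finset (Fin N)} {M : Op (Fin N)}
    (h : IsProd α X M) : M ∈ cone α X := Submodule.subset_span h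

theorem cone_congr {α β : PreAssignment N} {X : Finset (Fin N)} (h : ∀ i ∈ X, α i = β i) :
    cone α X = cone β X := by
  unfold cone
  congr 1
  ext M
  exact isProd_congr h

theorem smul_hadamard_nnreal (c : ℝ≥0) (A B : Op (Fin N)) : (c • A) ⊙ B = c • (A ⊙ B) := by
  ext x y; simp [hadamard_apply, NNReal.smul_def, mul_assoc]

theorem hadamard_smul_nnreal (c : ℝ≥0) (A B : Op (Fin N)) : A ⊙ (c • B) = c • (A ⊙ B) := by
  ext x y; simp [hadamard_apply, NNReal.smul_def, mul_left_comm]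

/-- Entrywise products of elements of two cones. -/
theorem hadamard_mem_span {s t : Set (Op (Fin N))} {P : Submodule ℝ≥0 (Op (Fin N))}
    (h : ∀ A ∈ s, ∀ B ∈ t, A ⊙ B ∈ P) {A B : Op (Fin N)} (hA : A ∈ Submodule.span ℝ≥0 s)
    (hB : B ∈ Submodule.span ℝ≥0 t) : A ⊙ B ∈ P := by
  induction hA using Submodule.span_induction with
  | mem A hA =>
    induction hB using Submodule.span_induction with
    | mem B hB => exact h A hA B hB
    | zero => rw [hadamard_zero]; exact P.zero_mem
    | add B B' _ _ h1 h2 => rw [hadamard_add]; exact P.add_mem h1 h2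
    | smul c B _ h1 => rw [hadamard_smul_nnreal]; exact P.smul_mem c h1
  | zero => rw [zero_hadamard]; exact P.zero_mem
  | add A A' _ _ h1 h2 => rw [add_hadamard]; exact P.add_mem h1 h2
  | smul c A _ h1 => rw [smul_hadamard_nnreal]; exact P.smul_mem c h1

theorem cone_union {α : PreAssignment N} (h : IsPartition α) {X Y : Finset (Fin N)}
    (hY : IsUnion α Y) (hXY : Disjoint X Y) {M M' : Op (Fin N)}
    (hM : M ∈ cone α X) (hM' : M' ∈ cone α Y) : M ⊙ M' ∈ cone α (X ∪ Y) :=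
  hadamard_mem_span (fun _ hA _ hB => (IsProd.union h hY hXY hA hB).mem_cone) hM hM'

/-- A local operator acts on one union of blocks. -/
theorem conj_mem_cone {α β : PreAssignment N} (hα : IsPartition α) (hβ : IsPartition β)
    {X : Finset (Fin N)} (hX : IsUnion α X) (hX' : IsUnion β X) (hoff : ∀ i, i ∉ X → α i = β i)
    {U : Op (Fin N)} (hU : IsLocal X U)
    (h : ∀ K, IsProd α X K → U * K * U.conjTranspose ∈ cone β X)
    {M : Op (Fin N)} (hM : M ∈ cone α Finset.univ) :
    U * M * U.conjTranspose ∈ cone β Finset.univ := by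
  have hY : IsUnion α (Finset.univ \ X) := (isUnion_univ α).sdiff hα hX
  have hY' : IsUnion β (Finset.univ \ X) := (isUnion_univ β).sdiff hβ hX'
  have huniv : X ∪ (Finset.univ \ X) = Finset.univ :=
    Finset.union_sdiff_of_subset (Finset.subset_univ X)
  induction hM using Submodule.span_induction with
  | mem M hM =>
    have hM : IsProd α Finset.univ M := hM
    rw [← huniv] at hM ⊢
    -- Only the factor `K` on `X` is changed by `U`. The factor `G` is also a product of rays for
    -- `β`, since the assignments agree off `X`.
    obtain ⟨K, G, hK, hG, rfl⟩ := hM.split hα hY Finset.disjoint_sdiff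
    have hGk := hG.kernelOn hY
    rw [hU.conj_hadamard K G]
    · refine cone_union hβ hY' Finset.disjoint_sdiff (h K hK) ?_
      exact ((isProd_congr fun i hi => hoff i (by simpa using hi)).1 hG).mem_cone
    · intro y x x' hx
      exact hGk _ _ _ _ (fun i hi => hx i (by simpa using hi)) fun _ _ => rfl
    · intro x y y' hy
      exact hGk _ _ _ _ (fun _ _ => rfl) fun i hi => hy i (by simpa using hi)
  | zero => rw [mul_zero, zero_mul]; exact Submodule.zero_mem _
  | add A A' _ _ h1 h2 => rw [mul_add, add_mul]; exact Submodule.add_mem _ h1 h2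
  | smul c A _ h1 => rw [mul_smul_comm, smul_mul_assoc]; exact Submodule.smul_mem _ c h1

/-! ## Cones of single blocks -/

/-- The cone generated by the states on `A` that are stabilised by `S` up to sign. -/
noncomputable def stabCone (A : Finset (Fin N)) (S : Set (PString N)) : Submodule ℝ≥0 (Op (Fin N)) :=
  Submodule.span ℝ≥0 {M | ∃ ψ : Vec N, DependsOn ψ (A : Set (Fin N)) ∧
    (∀ σ ∈ S, pauliOp σ *ᵥ ψ = ψ ∨ pauliOp σ *ᵥ ψ = -ψ) ∧ M = outer ψ}

theorem ind_mem_stabCone_empty (A : Finset (Fin N)) : ind A ∈ stabCone A ∅ := by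
  -- Resolution of the identity on `A` into basis projectors. The bit strings `z` are normalised to
  -- `0` off `A`, so that each basis vector of `A` is counted once.
  have h : ind A = ∑ z ∈ Finset.univ.filter (fun z : Fin N → Fin 2 => ∀ i, i ∉ A → z i = 0),
      outer fun x => if ∀ i ∈ A, x i = z i then 1 else 0 := by
    ext x y
    rw [Matrix.sum_apply, Finset.sum_eq_single fun i => if i ∈ A then x i else 0]
    · have h1 : ∀ i ∈ A, x i = if i ∈ A then x i else 0 := fun i hi => by rw [if_pos hi]
      rw [outer_apply, if_pos h1, one_mul, ind_apply]
      have : (∀ i ∈ A, x i = y i) ↔ ∀ i ∈ A, y i = if i ∈ A then x i else 0 :=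
        forall₂_congr fun i hi => by rw [if_pos hi, eq_comm]
      by_cases h2 : ∀ i ∈ A, x i = y i
      · rw [if_pos h2, if_pos (this.1 h2), star_one]
      · rw [if_neg h2, if_neg (mt this.2 h2), star_zero]
    · intro z hz hne
      rw [outer_apply, if_neg, zero_mul]
      intro h1
      apply hne
      funext i
      by_cases hi : i ∈ A
      · rw [if_pos hi, h1 i hi]
      · rw [if_neg hi, (Finset.mem_filter.1 hz).2 i hi]
    · intro h1
      exfalso
      apply h1
      simp only [Finset.mem_filter, Finset.mem_univ, true_and]
      intro i hi
      rw [if_neg hi]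
  rw [h]
  refine Submodule.sum_mem _ fun z _ => Submodule.subset_span ⟨_, ?_, fun _ h => h.elim, rfl⟩
  intro x y hxy
  exact if_congr (forall₂_congr fun i hi => by rw [hxy i hi]) rfl rfl

/-- Off `A` the factor is the all-ones matrix rather than the identity, because a kernel on `A` is
constant in the other qubits. -/
theorem ind_eq_kron (A : Finset (Fin N)) :
    ind A = kron fun i => if i ∈ A then 1 else of fun _ _ => 1 := by
  ext x y
  simp only [ind_apply, kron, of_apply]
  by_cases h : ∀ i ∈ A, x i = y i
  · rw [if_pos h, Finset.prod_eq_one]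
    intro i _
    by_cases hi : i ∈ A
    · rw [if_pos hi, h i hi, one_apply_eq]
    · simp [hi]
  · rw [if_neg h]
    push Not at h
    obtain ⟨i, hi, hne⟩ := h
    rw [Finset.prod_eq_zero (Finset.mem_univ i)]
    simp [hi, hne]

theorem kron_conjTranspose (M : Fin N → Matrix (Fin 2) (Fin 2) ℂ) :
    (kron M).conjTranspose = kron fun i => (M i).conjTranspose := by
  ext x y
  simp [kron, star_prod]

theorem kron_conj_ind (A : Finset (Fin N)) (V : Fin N → Matrix (Fin 2) (Fin 2) ℂ)
    (hA : ∀ i, i ∉ A → V i = 1) (hV : ∀ i ∈ A, V i * (V i).conjTranspose = 1) :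
    kron V * ind A * (kron V).conjTranspose = ind A := by
  rw [kron_conjTranspose, ind_eq_kron, kron_mul, kron_mul]
  congr 1
  funext i
  by_cases hi : i ∈ A
  · simp [hi, hV i hi]
  · simp [hi, hA i hi]

theorem outer_add_outer_sub (ψ φ : Vec N) :
    outer (ψ + φ) + outer (ψ - φ) = (2 : ℝ≥0) • (outer ψ + outer φ) := by
  ext x y
  simp only [Matrix.add_apply, Matrix.smul_apply, outer_apply, Pi.add_apply, Pi.sub_apply,
    star_add, star_sub, NNReal.smul_def, NNReal.coe_ofNat, Complex.real_smul, Complex.ofReal_ofNat]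
  ring

/-- The maximally mixed state is a mixture of joint eigenstates of a commuting group. -/
theorem ind_mem_stabCone {A : Finset (Fin N)} {S : PGroup N} (hA : S ≤ supported A)
    (hS : ∀ σ ∈ S, ∀ τ ∈ S, Commute (pauliOp σ) (pauliOp τ)) : ind A ∈ stabCone A S := by
  classical
  -- The elements of the group are imposed one at a time; intermediate sets need not be groups,
  -- which is why `stabCone` takes a set.
  suffices ∀ T : Finset (PString N), (T : Set (PString N)) ⊆ S → ind A ∈ stabCone A T by
    have := this (Set.toFinite (S : Set (PString N))).toFinset (by simp)
    simpa using this
  intro T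
  induction T using Finset.induction_on with
  | empty => intro _; simpa using ind_mem_stabCone_empty A
  | insert σ T _ ih =>
    intro hT
    rw [Finset.coe_insert, Set.insert_subset_iff] at hT
    -- Twirling by `σ`: up to the factor one half, `outer ψ + outer (σψ)` is the sum of `outer (ψ +
    -- σψ)` and `outer (ψ - σψ)`. These vectors are eigenvectors of `σ`, and remain eigenvectors of
    -- `T` since `σ` commutes with it.
    have key : ∀ R ∈ stabCone A T, R + pauliOp σ * R * (pauliOp σ).conjTranspose ∈
        stabCone A (insert σ T : Finset (PString N)) := by
      intro R hR
      induction hR using Submodule.span_induction with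
      | mem R hR =>
        obtain ⟨ψ, hψ, hs, rfl⟩ := hR
        have hσψ := (pauliOp_isLocal (hA hT.1)).dependsOn A subset_rfl ψ hψ
        have hsq : pauliOp σ *ᵥ (pauliOp σ *ᵥ ψ) = ψ := by
          rw [mulVec_mulVec, pauliOp_mul_self, one_mulVec]
        have h2 : ∀ c : ℂ, c = 1 ∨ c = -1 → outer (ψ + c • (pauliOp σ *ᵥ ψ)) ∈
            stabCone A (insert σ T : Finset (PString N)) := by
          intro c hc
          refine Submodule.subset_span ⟨_, ?_, ?_, rfl⟩
          · intro x y hxy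
            simp only [Pi.add_apply, Pi.smul_apply, hψ hxy, hσψ hxy]
          · intro τ hτ
            rw [mulVec_add, mulVec_smul]
            rcases Finset.mem_insert.1 (Finset.mem_coe.1 hτ) with rfl | hτ
            · rw [hsq]
              rcases hc with rfl | rfl
              · left; rw [one_smul, one_smul, add_comm]
              · right; rw [neg_smul, neg_smul, one_smul, one_smul]; abel
            · have hcomm : pauliOp τ *ᵥ (pauliOp σ *ᵥ ψ) = pauliOp σ *ᵥ (pauliOp τ *ᵥ ψ) := by
                rw [mulVec_mulVec, mulVec_mulVec, (hS τ (hT.2 hτ) σ hT.1).eq]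
              rw [hcomm]
              rcases hs τ hτ with h | h <;> rw [h]
              · left; rfl
              · right; rw [mulVec_neg, smul_neg]; abel
        have h3 : outer ψ + pauliOp σ * outer ψ * (pauliOp σ).conjTranspose =
            (2⁻¹ : ℝ≥0) • (outer (ψ + (1 : ℂ) • (pauliOp σ *ᵥ ψ)) +
              outer (ψ + (-1 : ℂ) • (pauliOp σ *ᵥ ψ))) := by
          rw [mul_outer_mul, one_smul, neg_smul, one_smul, ← sub_eq_add_neg,
            outer_add_outer_sub, smul_smul, inv_mul_cancel₀ two_ne_zero, one_smul]
        rw [h3]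
        exact Submodule.smul_mem _ _
          (Submodule.add_mem _ (h2 1 (Or.inl rfl)) (h2 (-1) (Or.inr rfl)))
      | zero => simp
      | add R R' _ _ h1 h2 =>
        have := Submodule.add_mem _ h1 h2
        convert this using 1
        rw [mul_add, add_mul]; abel
      | smul c R _ h1 =>
        have := Submodule.smul_mem _ c h1
        convert this using 1
        rw [mul_smul_comm, smul_mul_assoc, smul_add]
    have h1 := key _ (ih hT.2)
    have h2 : pauliOp σ * ind A * (pauliOp σ).conjTranspose = ind A :=
      kron_conj_ind A _ (fun i hi => by simp [hA hT.1 i hi])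
        fun i _ => by rw [Pauli.mat_conjTranspose, Pauli.mat_mul_self]
    rw [h2] at h1
    -- The twirl only doubles `ind A`, because conjugation by `σ` fixes it.
    have h3 : ind A = (2⁻¹ : ℝ≥0) • (ind A + ind A) := by
      rw [← two_smul ℝ≥0 (ind A), smul_smul, inv_mul_cancel₀ two_ne_zero, one_smul]
    rw [h3]
    exact Submodule.smul_mem _ _ h1

/-! ## Products in the cones -/

theorem hadamard_mem_stabCone {X Y : Finset (Fin N)} {M M' : Op (Fin N)}
    (hM : M ∈ stabCone X ∅) (hM' : M' ∈ stabCone Y ∅) : M ⊙ M' ∈ stabCone (X ∪ Y) ∅ := by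
  refine hadamard_mem_span ?_ hM hM'
  rintro _ ⟨ψ, hψ, -, rfl⟩ _ ⟨φ, hφ, -, rfl⟩
  refine Submodule.subset_span ⟨ψ * φ, ?_, fun _ h => h.elim, (outer_mul ψ φ).symm⟩
  intro x y hxy
  rw [Pi.mul_apply, Pi.mul_apply, hψ fun i hi => hxy i (by simp_all),
    hφ fun i hi => hxy i (by simp_all)]

theorem Label.IsRay.mem_stabCone {A : Finset (Fin N)} {g : Op (Fin N)} {L : Label N}
    (h : L.IsRay A g) : g ∈ stabCone A ∅ := by
  rcases L with _ | _ | S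
  · rw [show g = ind A from h]; exact ind_mem_stabCone_empty A
  · obtain ⟨ψ, h1, rfl⟩ := h
    exact Submodule.subset_span ⟨ψ, h1, fun _ h => h.elim, rfl⟩
  · obtain ⟨ψ, h1, _, rfl⟩ := h
    exact Submodule.subset_span ⟨ψ, h1, fun _ h => h.elim, rfl⟩

/-- What makes `■` a top element: a pure product is a pure state of the union, and each mixed factor
is itself a sum of pure states. -/
theorem IsProd.mem_stabCone {α : PreAssignment N} (h : IsPartition α) {X : Finset (Fin N)}
    (hX : IsUnion α X) {M : Op (Fin N)} (hM : IsProd α X M) : M ∈ stabCone X ∅ := by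
  revert M
  refine h.union_induction (P := fun X => ∀ {M}, IsProd α X M → M ∈ stabCone X ∅) ?_ ?_ X hX
  · intro M hM
    refine Submodule.subset_span ⟨1, fun _ _ _ => rfl, fun _ h => h.elim, ?_⟩
    rw [isProd_empty.1 hM]
    ext x y
    simp [outer_apply]
  · intro i X hX hd ih M hM
    obtain ⟨K, G, hK, hG, rfl⟩ := hM.split h hX hd
    exact hadamard_mem_stabCone ((isProd_block h i).1 hK).mem_stabCone (ih hG)

theorem cone_block_box {α : PreAssignment N} (h : IsPartition α) {i : Fin N}
    (hi : (α i).2 = .box) : cone α (α i).1 = stabCone (α i).1 ∅ := by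
  unfold cone stabCone
  congr 1
  ext M
  refine (isProd_block h i).trans ?_
  rw [hi]
  simp [Label.IsRay]

theorem cone_block_stab {α : PreAssignment N} (h : IsPartition α) {i : Fin N} {S : PGroup N}
    (hi : (α i).2 = .stab S) : cone α (α i).1 = stabCone (α i).1 S := by
  unfold cone stabCone
  congr 1
  ext M
  refine (isProd_block h i).trans ?_
  rw [hi]
  rfl

/-- What makes `I` a bottom element for `≤ₛ`. For a stabilizer label, validity supplies the
commuting group that `ind_mem_stabCone` needs. -/
theorem ind_mem_cone {α : PreAssignment N} (h : IsAssignment α) (i : Fin N) :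
    ind (α i).1 ∈ cone α (α i).1 := by
  rcases hL : (α i).2 with _ | _ | S
  · refine ((isProd_block h.isPartition i).2 ?_).mem_cone
    rw [hL]; rfl
  · rw [cone_block_box h.isPartition hL]; exact ind_mem_stabCone_empty _
  · rw [cone_block_stab h.isPartition hL]
    have := h.valid i
    rw [hL] at this
    exact ind_mem_stabCone this.1.1 this.1.2.1

theorem IsProd.eq_ind {α : PreAssignment N} (h : IsPartition α) {X : Finset (Fin N)}
    (hX : IsUnion α X) (hmix : ∀ i ∈ X, (α i).2 = .mixed) {M : Op (Fin N)}
    (hM : IsProd α X M) : M = ind X := by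
  obtain ⟨g, hg, rfl⟩ := hM
  ext x y
  have h1 : ∀ A ∈ X.image (fun i => (α i).1), g A x y = if ∀ i ∈ A, x i = y i then 1 else 0 := by
    intro A hA
    obtain ⟨i, hi, rfl⟩ := Finset.mem_image.1 hA
    have := hg i hi
    rw [hmix i hi] at this
    rw [show g (α i).1 = ind (α i).1 from this, ind_apply]
  rw [of_apply, Finset.prod_congr rfl h1, ind_apply]
  split_ifs with h2
  · refine Finset.prod_eq_one fun A hA => if_pos fun i hi => ?_
    obtain ⟨j, hj, rfl⟩ := Finset.mem_image.1 hA
    exact h2 i (hX j hj hi)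
  · push Not at h2
    obtain ⟨i, hi, hne⟩ := h2
    exact Finset.prod_eq_zero (Finset.mem_image_of_mem _ hi)
      (if_neg fun h3 => hne (h3 i (h.mem i)))

/-- Larger assignments are satisfied by more states. -/
theorem cone_mono {α β : PreAssignment N} (hα : IsAssignment α) (hβ : IsAssignment β)
    (hle : AssignLE α β) : cone α Finset.univ ≤ cone β Finset.univ := by
  have hpα := hα.isPartition
  have hpβ := hβ.isPartition
  have hsub : ∀ X, IsUnion β X → IsUnion α X := fun X hX i hi =>
    (hle.1 i i (hβ.mem i)).trans (hX i hi)
  have hblock : ∀ i K, IsProd α (β i).1 K → K ∈ cone β (β i).1 := by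
    intro i K hK
    have hU : IsUnion α (β i).1 := hsub _ (hpβ.isUnion_block i)
    have hm := hle.2 i
    unfold merge at hm
    -- The three cases of `⨀`. For a single block the labels are compared directly; for several
    -- mixed blocks the product is the identity, which lies in every block cone; otherwise the label
    -- of `β` must be `■`.
    split_ifs at hm with h1 h2
    · have hB : (β i).1 = (α i).1 :=
        Finset.Subset.antisymm (fun k hk => h1 k hk ▸ hα.mem k) (hU i (hβ.mem i))
      have hK' := hK
      rw [hB] at hK'
      rw [isProd_block hpα] at hK'
      rcases hm with hm | hm | hm
      · rw [hm] at hK'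
        rw [show K = ind (α i).1 from hK', ← hB]
        exact ind_mem_cone hβ i
      · rw [cone_block_box hpβ hm]
        exact hK.mem_stabCone hpα hU
      · refine ((isProd_block hpβ i).2 ?_).mem_cone
        rwa [hB, ← hm]
    · rw [hK.eq_ind hpα hU h2]
      exact ind_mem_cone hβ i
    · have hb : (β i).2 = .box := by
        rcases hm with hm | hm | hm
        · cases hm
        · exact hm
        · exact hm.symm
      rw [cone_block_box hpβ hb]
      exact hK.mem_stabCone hpα hU
  refine hpβ.union_induction (P := fun X => cone α X ≤ cone β X) ?_ ?_ _ (isUnion_univ β)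
  · rw [cone_congr fun i hi => absurd hi (Finset.notMem_empty i)]
  · intro i X hX hd ih
    refine Submodule.span_le.2 fun M hM => ?_
    obtain ⟨K, G, hK, hG, rfl⟩ := IsProd.split hpα (hsub X hX) hd hM
    exact cone_union hpβ hX hd (hblock i K hK) (ih hG.mem_cone)

theorem assignLE_of_label_le {α β : PreAssignment N} (hα : IsAssignment α) (hβ : IsAssignment β)
    (h1 : ∀ i, (β i).1 = (α i).1) (h2 : ∀ i, (α i).2.le (β i).2) : AssignLE α β := by
  refine ⟨fun i j hj => ?_, fun i => ?_⟩
  · rw [← h1, hβ.eq_of_mem i j hj]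
  · rw [h1, merge_self hα]; exact h2 i

/-! ## Replacing blocks -/

/-- The blocks in `bs` partition `A`. -/
structure Tiles (A : Finset (Fin N)) (bs : List (Block N)) : Prop where
  subset : ∀ b ∈ bs, b.1 ⊆ A
  eq : ∀ b ∈ bs, ∀ b' ∈ bs, ∀ j, j ∈ b.1 → j ∈ b'.1 → b = b'
  cover : ∀ j ∈ A, ∃ b ∈ bs, j ∈ b.1

theorem Tiles.replace_mem {A : Finset (Fin N)} {bs : List (Block N)} (h : Tiles A bs)
    (α : PreAssignment N) {b : Block N} (hb : b ∈ bs) {j : Fin N} (hj : j ∈ b.1) :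
    replace α bs j = b := by
  unfold replace
  rcases hf : bs.find? (fun b => decide (j ∈ b.1)) with _ | b'
  · have := List.find?_eq_none.1 hf b hb
    simp [hj] at this
  · have h1 := List.find?_some hf
    have h2 := List.mem_of_find?_eq_some hf
    rw [hf]
    exact (h.eq b hb b' h2 j hj (by simpa using h1)).symm

theorem Tiles.replace_notMem {A : Finset (Fin N)} {bs : List (Block N)} (h : Tiles A bs)
    (α : PreAssignment N) {j : Fin N} (hj : j ∉ A) : replace α bs j = α j := by
  unfold replace
  rw [List.find?_eq_none.2]
  · rfl
  · intro b hb
    simp only [decide_eq_true_eq]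
    exact fun hjb => hj (h.subset b hb hjb)

theorem Tiles.isPartition {A : Finset (Fin N)} {bs : List (Block N)} (h : Tiles A bs)
    {α : PreAssignment N} (hα : IsPartition α) (hA : IsUnion α A) :
    IsPartition (replace α bs) := by
  constructor
  · intro i
    by_cases hi : i ∈ A
    · obtain ⟨b, hb, hib⟩ := h.cover i hi
      rw [h.replace_mem α hb hib]; exact hib
    · rw [h.replace_notMem α hi]; exact hα.mem i
  · intro i j hj
    by_cases hi : i ∈ A
    · obtain ⟨b, hb, hib⟩ := h.cover i hi
      rw [h.replace_mem α hb hib] at hj ⊢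
      rw [h.replace_mem α hb hj]
    · rw [h.replace_notMem α hi] at hj ⊢
      have hjA : j ∉ A := fun hjA => hi (hA j hjA (by rw [hα.eq_of_mem i j hj]; exact hα.mem i))
      rw [h.replace_notMem α hjA, hα.eq_of_mem i j hj]

theorem Tiles.isUnion {A : Finset (Fin N)} {bs : List (Block N)} (h : Tiles A bs)
    (α : PreAssignment N) : IsUnion (replace α bs) A := by
  intro i hi
  obtain ⟨b, hb, hib⟩ := h.cover i hi
  rw [h.replace_mem α hb hib]
  exact h.subset b hb

theorem Tiles.isAssignment {A : Finset (Fin N)} {bs : List (Block N)} (h : Tiles A bs)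
    {α : PreAssignment N} (hα : IsAssignment α) (hA : IsUnion α A)
    (hv : ∀ b ∈ bs, b.2.Valid b.1) : IsAssignment (replace α bs) := by
  have hp := h.isPartition hα.isPartition hA
  refine ⟨hp.mem, hp.eq_of_mem, fun i => ?_⟩
  by_cases hi : i ∈ A
  · obtain ⟨b, hb, hib⟩ := h.cover i hi
    rw [h.replace_mem α hb hib]; exact hv b hb
  · rw [h.replace_notMem α hi]; exact hα.valid i

theorem tiles_singleton (A : Finset (Fin N)) (L : Label N) : Tiles A [(A, L)] := by
  constructor <;> simp

theorem Tiles.cons {A : Finset (Fin N)} {bs : List (Block N)} {i : Fin N} (hi : i ∈ A)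
    (h : Tiles (A.erase i) bs) (L : Label N) : Tiles A (({i}, L) :: bs) := by
  have hn : ∀ b ∈ bs, i ∉ b.1 := fun b hb hib => Finset.notMem_erase i A (h.subset b hb hib)
  constructor
  · intro b hb
    rcases List.mem_cons.1 hb with rfl | hb
    · simpa using hi
    · exact (h.subset b hb).trans (Finset.erase_subset _ _)
  · intro b hb b' hb' j hj hj'
    rcases List.mem_cons.1 hb with rfl | h1 <;> rcases List.mem_cons.1 hb' with rfl | h2
    · rfl
    · rw [Finset.mem_singleton] at hj; subst hj; exact absurd hj' (hn b' h2)
    · rw [Finset.mem_singleton] at hj'; subst hj'; exact absurd hj (hn b h1)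
    · exact h.eq b h1 b' h2 j hj hj'
  · intro j hj
    by_cases hji : j = i
    · exact ⟨_, List.mem_cons_self, by simp [hji]⟩
    · obtain ⟨b, hb, hjb⟩ := h.cover j (Finset.mem_erase.2 ⟨hji, hj⟩)
      exact ⟨b, List.mem_cons_of_mem _ hb, hjb⟩

/-! ## Stabilizer groups -/

theorem IsStab.symp_eq_zero {A : Finset (Fin N)} {S : PGroup N} (h : IsStab A S) {σ τ : PString N}
    (hσ : σ ∈ S) (hτ : τ ∈ S) : symp (Fin N) σ τ = 0 := commute_pauliOp.1 (h.2.1 σ hσ τ hτ)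

theorem single_mem_supported {A : Finset (Fin N)} {i : Fin N} (hi : i ∈ A) (p : Pauli) :
    Pi.single i p ∈ supported A := fun j hj => by
  rw [Pi.single_eq_of_ne]; rintro rfl; exact hj hi

theorem mem_of_single_mem_supported {A : Finset (Fin N)} {i : Fin N} {p : Pauli} (hp : p ≠ 0)
    (h : (Pi.single i p : PString N) ∈ supported A) : i ∈ A := by
  by_contra hi
  have := h i hi
  rw [Pi.single_eq_same] at this
  exact hp this

theorem supported_mono {A B : Finset (Fin N)} (h : A ⊆ B) :
    (supported A : PGroup N) ≤ supported B := fun _ hσ i hi => hσ i fun hA => hi (h hA)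

theorem eq_single_of_mem_supported {i : Fin N} {σ : PString N} (h : σ ∈ supported {i}) :
    σ = Pi.single i (σ i) := by
  funext j
  by_cases hj : j = i
  · subst hj; simp
  · rw [Pi.single_eq_of_ne hj, h j (by simpa using hj)]

theorem mem_oneGen {i : Fin N} {p : Pauli} {σ : PString N} :
    σ ∈ oneGen i p ↔ σ = 0 ∨ σ = Pi.single i p := by
  rw [oneGen, Submodule.mem_span_singleton]
  have h : ∀ a : ZMod 2, a = 0 ∨ a = 1 := by decide
  constructor
  · rintro ⟨a, rfl⟩
    rcases h a with rfl | rfl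
    · left; rw [zero_smul]
    · right; rw [one_smul]
  · rintro (rfl | rfl)
    · exact ⟨0, zero_smul _ _⟩
    · exact ⟨1, one_smul _ _⟩

theorem single_mem_oneGen (i : Fin N) (p : Pauli) : Pi.single i p ∈ oneGen i p :=
  Submodule.subset_span rfl

theorem isStab_oneGen (i : Fin N) {p : Pauli} (hp : p ≠ 0) : IsStab {i} (oneGen i p) := by
  refine ⟨?_, ?_, ?_⟩
  · rw [oneGen, Submodule.span_singleton_le_iff_mem]
    exact single_mem_supported (Finset.mem_singleton_self i) p
  · intro σ hσ τ hτ
    rw [commute_pauliOp]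
    rcases mem_oneGen.1 hσ with rfl | rfl
    · simp
    · rcases mem_oneGen.1 hτ with rfl | rfl
      · simp
      · exact symp_self _
  · rw [oneGen, finrank_span_singleton, Finset.card_singleton]
    intro h
    apply hp
    have := congrFun h i
    simpa using this

theorem valid_singleton_oneGen (i : Fin N) {p : Pauli} (hp : p ≠ 0) :
    (Label.stab (oneGen i p)).Valid {i} :=
  ⟨isStab_oneGen i hp, fun h => by simp at h⟩

theorem pX_ne_zero : pX ≠ 0 := by decide
theorem pZ_ne_zero : pZ ≠ 0 := by decide

theorem isotropic_sup_span {A : Finset (Fin N)} {S : PGroup N} (hS : S ≤ supported A)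
    (hc : ∀ σ ∈ S, ∀ τ ∈ S, symp (Fin N) σ τ = 0) {τ : PString N} (hτ : τ ∈ supported A)
    (hcomm : ∀ σ ∈ S, symp (Fin N) σ τ = 0) :
    (∀ ρ ∈ S ⊔ Submodule.span (ZMod 2) {τ}, ∀ ρ' ∈ S ⊔ Submodule.span (ZMod 2) {τ},
      symp (Fin N) ρ ρ' = 0) ∧
    S ⊔ Submodule.span (ZMod 2) {τ} ≤ supported A := by
  constructor
  · intro ρ hρ ρ' hρ'
    obtain ⟨σ, hσ, a, ha, rfl⟩ := Submodule.mem_sup.1 hρ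
    obtain ⟨σ', hσ', b, hb, rfl⟩ := Submodule.mem_sup.1 hρ'
    obtain ⟨a, rfl⟩ := Submodule.mem_span_singleton.1 ha
    obtain ⟨b, rfl⟩ := Submodule.mem_span_singleton.1 hb
    simp [hc σ hσ σ' hσ', hcomm σ hσ, symp_comm τ σ', hcomm σ' hσ', symp_self]
  · exact sup_le hS ((Submodule.span_singleton_le_iff_mem _ _).2 hτ)

/-- A stabilizer contains every operator that commutes with it. -/
theorem IsStab.mem_of_commute {A : Finset (Fin N)} {S : PGroup N} (h : IsStab A S)
    {τ : PString N} (hτ : τ ∈ supported A) (hcomm : ∀ σ ∈ S, symp (Fin N) σ τ = 0) : τ ∈ S := by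
  by_contra hn
  obtain ⟨h1, h2⟩ := isotropic_sup_span h.1
    (fun σ hσ τ hτ => h.symp_eq_zero hσ hτ) hτ hcomm
  have h3 := finrank_le_card h2 h1
  have h4 : S < S ⊔ Submodule.span (ZMod 2) {τ} := by
    refine lt_of_le_of_ne le_sup_left fun e => hn ?_
    rw [e]
    exact Submodule.mem_sup_right (Submodule.mem_span_singleton_self τ)
  have h5 := Submodule.finrank_lt_finrank_of_lt h4
  rw [h.2.2] at h5
  omega

/-- The surviving part of `S` is its intersection with the kernel of one linear functional, which
makes ranks computable. -/
theorem measStab_eq (i : Fin N) (S : PGroup N) :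
    measStab i S = (S ⊓ LinearMap.ker ((symp (Fin N)).flip (Pi.single i pZ))) ⊔
      Submodule.span (ZMod 2) {Pi.single i pZ} := by
  rw [measStab, Submodule.span_union]
  congr 1
  refine le_antisymm (Submodule.span_le.2 ?_) ?_
  · rintro σ ⟨hσ, hc⟩
    exact ⟨hσ, commute_pauliOp.1 hc⟩
  · rintro σ ⟨hσ, hc⟩
    exact Submodule.subset_span ⟨hσ, commute_pauliOp.2 hc⟩

/-- Keeping only what commutes with `Z` costs at most one dimension, and adjoining `Z`, which is not
in `S`, gains one. So the rank is at least `|A|`, while isotropy bounds it by `|A|`. -/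
theorem isStab_measStab {A : Finset (Fin N)} {S : PGroup N} (h : IsStab A S) {i : Fin N}
    (hi : i ∈ A) (hZ : Pi.single i pZ ∉ S) : IsStab A (measStab i S) := by
  rw [measStab_eq]
  have h6 := LinearMap.finrank_range_add_finrank_ker ((symp (Fin N)).flip (Pi.single i pZ))
  generalize hK : (LinearMap.ker ((symp (Fin N)).flip (Pi.single i pZ)) : PGroup N) = K at h6 ⊢
  obtain ⟨h1, h2⟩ := isotropic_sup_span (S := S ⊓ K) (inf_le_left.trans h.1)
    (fun σ hσ τ hτ => h.symp_eq_zero hσ.1 hτ.1) (single_mem_supported hi pZ) (fun σ hσ => by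
      have := hσ.2
      rwa [← hK] at this)
  refine ⟨h2, fun σ hσ τ hτ => commute_pauliOp.2 (h1 σ hσ τ hτ),
    le_antisymm (finrank_le_card h2 h1) ?_⟩
  have h3 : S ⊓ K < (S ⊓ K) ⊔ Submodule.span (ZMod 2) {Pi.single i pZ} := by
    refine lt_of_le_of_ne le_sup_left fun e => hZ ?_
    have : (Pi.single i pZ : PString N) ∈ S ⊓ K := by
      rw [e]
      exact Submodule.mem_sup_right (Submodule.mem_span_singleton_self _)
    exact this.1
  have h4 := Submodule.finrank_lt_finrank_of_lt h3
  have h5 := Submodule.finrank_sup_add_finrank_inf_eq S K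
  have h7 := Submodule.finrank_le (LinearMap.range ((symp (Fin N)).flip (Pi.single i pZ)))
  have h8 := Submodule.finrank_le (S ⊔ K)
  rw [Module.finrank_self] at h7
  rw [h.2.2] at h5
  change _ + Module.finrank (ZMod 2) K = Module.finrank (ZMod 2) (PString N) at h6
  change _ ≤ Module.finrank (ZMod 2) (PString N) at h8
  omega

/-! ## Splitting stabilizers -/

theorem symp_single_right_eq_zero {σ : PString N} {i : Fin N} {p : Pauli} (hp : p ≠ 0)
    (h : symp (Fin N) σ (Pi.single i p) = 0) : σ i = 0 ∨ σ i = p := by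
  rw [symp_single] at h
  generalize σ i = q at h ⊢
  revert p q; decide

theorem pstring_add_self (σ : PString N) : σ + σ = 0 := by
  funext i
  have : ∀ p : Pauli, p + p = 0 := by decide
  exact this _

/-- Every element commutes with the one-qubit `p`, so at qubit `i` it is either trivial or `p`; in
the second case, multiplying by that one-qubit element clears the site. Hence the tensor
decomposition tested by `splitStab` is automatic. -/
theorem IsStab.split_of_single_mem {A : Finset (Fin N)} {S : PGroup N} (h : IsStab A S)
    {i : Fin N} {p : Pauli} (hp : p ≠ 0) (hi : Pi.single i p ∈ S) :
    S ⊓ supported {i} = oneGen i p ∧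
      S = (S ⊓ supported {i}) ⊔ (S ⊓ supported (A.erase i)) := by
  have hcases : ∀ σ ∈ S, σ i = 0 ∨ σ i = p := fun σ hσ =>
    symp_single_right_eq_zero hp (h.symp_eq_zero hσ hi)
  have hmem : (Pi.single i p : PString N) ∈ S ⊓ supported {i} :=
    ⟨hi, single_mem_supported (Finset.mem_singleton_self i) p⟩
  constructor
  · ext σ
    rw [mem_oneGen]
    constructor
    · rintro ⟨hσ, hσi⟩
      have e := eq_single_of_mem_supported hσi
      rcases hcases σ hσ with h0 | h0 <;> rw [h0] at e
      · left; rw [e, Pi.single_zero]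
      · right; exact e
    · rintro (rfl | rfl)
      · exact Submodule.zero_mem _
      · exact hmem
  · refine le_antisymm (fun σ hσ => ?_) (sup_le inf_le_left inf_le_left)
    rcases hcases σ hσ with h0 | h0
    · refine Submodule.mem_sup_right ⟨hσ, fun j hj => ?_⟩
      by_cases hji : j = i
      · rw [hji, h0]
      · exact h.1 hσ j fun hjA => hj (Finset.mem_erase.2 ⟨hji, hjA⟩)
    · have e : σ = Pi.single i p + (σ + Pi.single i p) := by
        rw [add_comm σ, ← add_assoc, pstring_add_self, zero_add]
      rw [e]
      refine Submodule.add_mem _ (Submodule.mem_sup_left hmem)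
        (Submodule.mem_sup_right ⟨S.add_mem hσ hi, fun j hj => ?_⟩)
      by_cases hji : j = i
      · subst hji
        rw [Pi.add_apply, h0, Pi.single_eq_same]
        exact congrFun (pstring_add_self fun _ : Fin N => p) j
      · rw [Pi.add_apply, Pi.single_eq_of_ne hji, add_zero]
        exact h.1 hσ j fun hjA => hj (Finset.mem_erase.2 ⟨hji, hjA⟩)

theorem single_mem_of_inf_eq_oneGen {S : PGroup N} {i : Fin N} {p : Pauli}
    (h : S ⊓ supported {i} = oneGen i p) : Pi.single i p ∈ S := by
  have := single_mem_oneGen i p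
  rw [← h] at this
  exact this.1

theorem IsStab.erase {A : Finset (Fin N)} {S : PGroup N} (h : IsStab A S)
    {i : Fin N} {p : Pauli} (hp : p ≠ 0) (hi : Pi.single i p ∈ S) :
    IsStab (A.erase i) (S ⊓ supported (A.erase i)) := by
  refine ⟨inf_le_right, fun σ hσ τ hτ => h.2.1 σ hσ.1 τ hτ.1, ?_⟩
  obtain ⟨h1, h2⟩ := h.split_of_single_mem hp hi
  have h3 := Submodule.finrank_sup_add_finrank_inf_eq (S ⊓ supported {i})
    (S ⊓ supported (A.erase i))
  have h4 : (S ⊓ supported {i}) ⊓ (S ⊓ supported (A.erase i)) = ⊥ := by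
    rw [eq_bot_iff]
    rintro σ ⟨⟨-, ha⟩, -, hb⟩
    rw [Submodule.mem_bot, eq_single_of_mem_supported ha, hb i (Finset.notMem_erase i A),
      Pi.single_zero]
  rw [h4, ← h2, h.2.2, finrank_bot, h1, (isStab_oneGen i hp).2.2, Finset.card_singleton] at h3
  have := Finset.card_erase_add_one (mem_of_single_mem_supported hp (h.1 hi))
  omega

/-- The hypothesis `hJ` says that every one-qubit element sits on a listed qubit. All of them are
then split off by the end of the list, and the remaining block has none, as a valid label requires.
-/
theorem splitStab_tiles (J : List (Fin N)) (A : Finset (Fin N)) (S : PGroup N) (h : IsStab A S)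
    (hJ : 2 ≤ A.card → ∀ i, ∀ p : Pauli, p ≠ 0 → Pi.single i p ∈ S → i ∈ J) :
    Tiles A (splitStab J A S) ∧ ∀ b ∈ splitStab J A S, b.2.Valid b.1 := by
  induction J generalizing A S with
  | nil =>
    refine ⟨tiles_singleton A _, fun b hb => ?_⟩
    rw [splitStab, List.mem_singleton] at hb
    subst hb
    exact ⟨h, fun hc i p hp hm => by simpa using hJ hc i p hp hm⟩
  | cons i J ih =>
    rw [splitStab]
    split_ifs with hs
    · obtain ⟨⟨p, hp, hone⟩, -⟩ := hs
      have hi := single_mem_of_inf_eq_oneGen hone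
      have hiA := mem_of_single_mem_supported hp (h.1 hi)
      obtain ⟨h1, h2⟩ := ih (A.erase i) (S ⊓ supported (A.erase i)) (h.erase hp hi) (by
        intro hc k q hq hk
        have hkA := mem_of_single_mem_supported hq hk.2
        have hc' : 2 ≤ A.card := hc.trans (Finset.card_le_card (Finset.erase_subset _ _))
        have := hJ hc' k q hq hk.1
        rcases List.mem_cons.1 this with rfl | hkJ
        · exact absurd hkA (Finset.notMem_erase _ _)
        · exact hkJ)
      refine ⟨h1.cons hiA _, fun b hb => ?_⟩
      rcases List.mem_cons.1 hb with rfl | hb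
      · change (Label.stab _).Valid {i}
        rw [hone]
        exact valid_singleton_oneGen i hp
      · exact h2 b hb
    · refine ih A S h fun hc k p hp hk => ?_
      rcases List.mem_cons.1 (hJ hc k p hp hk) with rfl | hkJ
      -- A one-qubit element on the head of the list would have passed the splitting test.
      · obtain ⟨h1, h2⟩ := h.split_of_single_mem hp hk
        exact absurd ⟨⟨p, hp, h1⟩, h2⟩ hs
      · exact hkJ

/-! ## Clifford conjugation of stabilizer groups -/

/-- Commutation with all Pauli operators is insensitive to scalars, and by nondegeneracy it
determines the string. -/
theorem pauliOp_injective_smul {σ τ : PString N} {c : ℂ} (h : pauliOp σ = c • pauliOp τ) :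
    σ = τ := by
  have hc : c ≠ 0 := by
    rintro rfl
    rw [zero_smul] at h
    exact pauliOp_ne_zero σ h
  have h1 : ∀ ρ, symp (Fin N) σ ρ = symp (Fin N) τ ρ := by
    intro ρ
    have h2 : symp (Fin N) σ ρ = 0 ↔ symp (Fin N) τ ρ = 0 := by
      rw [← commute_pauliOp, ← commute_pauliOp, h]
      constructor
      · intro h3
        have := h3.smul_left c⁻¹
        rwa [smul_smul, inv_mul_cancel₀ hc, one_smul] at this
      · intro h3; exact h3.smul_left c
    generalize symp (Fin N) σ ρ = a at h2
    generalize symp (Fin N) τ ρ = b at h2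
    revert a b; decide
  have h2 : σ - τ ∈ LinearMap.ker (symp (Fin N)) := by
    rw [LinearMap.mem_ker]
    refine LinearMap.ext fun ρ => ?_
    rw [map_sub, LinearMap.sub_apply, h1, sub_self, LinearMap.zero_apply]
  rw [symp_ker, Submodule.mem_bot] at h2
  exact sub_eq_zero.1 h2

/-- `U` is a Clifford operator that acts on Pauli strings as `L`. -/
structure IsClifford (U : Op (Fin N)) (L : PString N ≃ₗ[ZMod 2] PString N) : Prop where
  unitary : U.conjTranspose * U = 1
  conj : ∀ σ, ∃ c : ℂ, U * pauliOp σ * U.conjTranspose = c • pauliOp (L σ)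

/-- Both the conjugated operator and `pauliOp (L σ)` square to one, so the scalar `c` between them
satisfies `c² = 1`. -/
theorem IsClifford.conj_eq_or {U : Op (Fin N)} {L : PString N ≃ₗ[ZMod 2] PString N}
    (h : IsClifford U L) (σ : PString N) : pauliOp (L σ) = U * pauliOp σ * U.conjTranspose ∨
      pauliOp (L σ) = -(U * pauliOp σ * U.conjTranspose) := by
  obtain ⟨c, hc⟩ := h.conj σ
  have hu : U * U.conjTranspose = 1 := mul_eq_one_comm.1 h.unitary
  have h1 : (U * pauliOp σ * U.conjTranspose) * (U * pauliOp σ * U.conjTranspose) = 1 := by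
    have : (U * pauliOp σ * U.conjTranspose) * (U * pauliOp σ * U.conjTranspose) =
        U * pauliOp σ * (U.conjTranspose * U) * pauliOp σ * U.conjTranspose := by
      simp only [mul_assoc]
    rw [this, h.unitary, mul_one, mul_assoc U, pauliOp_mul_self, mul_one, hu]
  rw [hc, smul_mul_smul_comm, pauliOp_mul_self] at h1
  have h2 : c * c = 1 := by
    have := congrFun (congrFun h1 0) 0
    simpa using this
  rcases mul_self_eq_one_iff.1 h2 with rfl | rfl
  · left; rw [hc, one_smul]
  · right; rw [hc, neg_smul, one_smul, neg_neg]

/-- Identifies the span that defines `conjGroup` with a linear image, from which rank and membership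
can be read off. -/
theorem IsClifford.conjGroup_eq {U : Op (Fin N)} {L : PString N ≃ₗ[ZMod 2] PString N}
    (h : IsClifford U L) (S : PGroup N) : conjGroup U S = S.map (L : PString N →ₗ[ZMod 2] _) := by
  refine le_antisymm (Submodule.span_le.2 ?_) ?_
  · rintro τ ⟨σ, hσ, hτ⟩
    refine ⟨σ, hσ, ?_⟩
    obtain ⟨c, hc⟩ := h.conj σ
    rcases hτ with hτ | hτ
    · rw [hc] at hτ; exact (pauliOp_injective_smul hτ).symm
    · rw [hc, ← neg_smul] at hτ; exact (pauliOp_injective_smul hτ).symm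
  · rintro _ ⟨σ, hσ, rfl⟩
    exact Submodule.subset_span ⟨σ, hσ, h.conj_eq_or σ⟩

theorem IsClifford.isStab {U : Op (Fin N)} {L : PString N ≃ₗ[ZMod 2] PString N}
    (h : IsClifford U L) {A : Finset (Fin N)} (hL : ∀ σ ∈ supported A, L σ ∈ supported A)
    {S : PGroup N} (hS : IsStab A S) : IsStab A (conjGroup U S) := by
  rw [h.conjGroup_eq]
  refine ⟨?_, ?_, ?_⟩
  · rintro _ ⟨σ, hσ, rfl⟩
    exact hL σ (hS.1 hσ)
  · rintro _ ⟨σ, hσ, rfl⟩ _ ⟨τ, hτ, rfl⟩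
    have hc : Commute (U * pauliOp σ * U.conjTranspose) (U * pauliOp τ * U.conjTranspose) := by
      have key : ∀ σ τ : PString N, (U * pauliOp σ * U.conjTranspose) *
          (U * pauliOp τ * U.conjTranspose) = U * (pauliOp σ * pauliOp τ) * U.conjTranspose := by
        intro σ τ
        have : (U * pauliOp σ * U.conjTranspose) * (U * pauliOp τ * U.conjTranspose) =
            U * pauliOp σ * (U.conjTranspose * U) * pauliOp τ * U.conjTranspose := by
          simp only [mul_assoc]
        rw [this, h.unitary, mul_one, mul_assoc U]
      rw [Commute, SemiconjBy, key, key, (hS.2.1 σ hσ τ hτ).eq]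
    rcases h.conj_eq_or σ with e | e <;> rcases h.conj_eq_or τ with e' | e' <;>
      simp only [LinearEquiv.coe_coe, e, e', Commute.neg_left_iff, Commute.neg_right_iff, hc]
  · rw [← hS.2.2]
    exact LinearEquiv.finrank_map_eq L S

/-! ## The Clifford gates of the language -/

/-- The action of a one-qubit gate on a Pauli matrix. -/
def Gate.act : Gate → Pauli ≃ₗ[ZMod 2] Pauli
  | .X => LinearEquiv.refl _ _
  | .Y => LinearEquiv.refl _ _
  | .Z => LinearEquiv.refl _ _
  | .H => LinearEquiv.prodComm _ _ _
  | .S => LinearEquiv.ofInvolutive (LinearMap.prod (LinearMap.fst _ _ _)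
      (LinearMap.fst (ZMod 2) (ZMod 2) (ZMod 2) + LinearMap.snd _ _ _)) (by
        intro p; revert p; decide)

theorem Gate.act_conj (U : Gate) (p : Pauli) :
    ∃ c : ℂ, U.mat * p.mat * U.mat.conjTranspose = c • (U.act p).mat := by
  have h2 : ((Real.sqrt 2 : ℝ) : ℂ)⁻¹ * ((Real.sqrt 2 : ℝ) : ℂ)⁻¹ = 2⁻¹ := by
    rw [← mul_inv, ← Complex.ofReal_mul, Real.mul_self_sqrt (by norm_num)]; norm_num
  have e0 : ∀ U : Gate, U.act 0 = 0 := fun U => map_zero _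
  have eHX : Gate.H.act pX = pZ := by decide
  have eHY : Gate.H.act pY = pY := by decide
  have eHZ : Gate.H.act pZ = pX := by decide
  have eSX : Gate.S.act pX = pY := by decide
  have eSY : Gate.S.act pY = pX := by decide
  have eSZ : Gate.S.act pZ = pZ := by decide
  rcases p.cases with h | h | h | h <;> subst h
  · refine ⟨1, ?_⟩
    rw [e0, Pauli.mat_zero, mul_one, one_smul]
    exact mul_eq_one_comm.1 U.mat_unitary
  all_goals cases U
  case inr.inl.X | inr.inr.inl.Y | inr.inr.inr.Z =>
    refine ⟨1, ?_⟩
    ext a b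
    fin_cases a <;> fin_cases b <;> simp [Gate.mat, Gate.act, matX, matY, matZ, mul_apply]
  case inr.inl.Y | inr.inl.Z | inr.inr.inl.X | inr.inr.inl.Z | inr.inr.inr.X | inr.inr.inr.Y =>
    refine ⟨-1, ?_⟩
    ext a b
    fin_cases a <;> fin_cases b <;> simp [Gate.mat, Gate.act, matX, matY, matZ, mul_apply]
  case inr.inl.H | inr.inr.inr.H =>
    refine ⟨1, ?_⟩
    simp only [eHX, eHZ]
    ext a b
    fin_cases a <;> fin_cases b <;> simp [Gate.mat, matX, matH, matZ, mul_apply, h2] <;> norm_num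
  case inr.inr.inl.H =>
    refine ⟨-1, ?_⟩
    rw [eHY]
    ext a b
    fin_cases a <;> fin_cases b <;> simp [Gate.mat, matH, matY, mul_apply] <;> ring_nf <;>
      simp [pow_two, h2] <;> ring
  case inr.inl.S | inr.inr.inr.S =>
    refine ⟨1, ?_⟩
    simp only [eSX, eSZ]
    ext a b
    fin_cases a <;> fin_cases b <;> simp [Gate.mat, matX, matS, matY, matZ, mul_apply]
  case inr.inr.inl.S =>
    refine ⟨-1, ?_⟩
    rw [eSY]
    ext a b
    fin_cases a <;> fin_cases b <;> simp [Gate.mat, matX, matS, matY, mul_apply]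

/-- The action of a one-qubit gate on Pauli strings. -/
def Gate.actOn (U : Gate) (i : Fin N) : PString N ≃ₗ[ZMod 2] PString N :=
  LinearEquiv.piCongrRight fun j => if j = i then U.act else LinearEquiv.refl _ _

theorem Gate.actOn_self (U : Gate) (i : Fin N) (σ : PString N) : U.actOn i σ i = U.act (σ i) := by
  simp [Gate.actOn]

theorem Gate.actOn_of_ne (U : Gate) {i j : Fin N} (h : j ≠ i) (σ : PString N) :
    U.actOn i σ j = σ j := by
  simp [Gate.actOn, h]

theorem onQubit_unitary {U : Matrix (Fin 2) (Fin 2) ℂ} (hU : U.conjTranspose * U = 1)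
    (i : Fin N) : (onQubit i U).conjTranspose * onQubit i U = 1 := by
  rw [onQubit_conjTranspose, onQubit_mul, hU, onQubit_one]

theorem Gate.isClifford (U : Gate) (i : Fin N) : IsClifford (onQubit i U.mat) (U.actOn i) := by
  refine ⟨onQubit_unitary U.mat_unitary i, fun σ => ?_⟩
  obtain ⟨c, hc⟩ := U.act_conj (σ i)
  refine ⟨∏ j, if j = i then c else 1, ?_⟩
  rw [onQubit_conjTranspose, onQubit, onQubit, pauliOp, pauliOp, kron_mul, kron_mul, ← kron_smul]
  congr 1
  funext j
  by_cases h : j = i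
  · subst h; simp [hc, Gate.actOn_self]
  · simp [h, Gate.actOn_of_ne U h]

/-- The action of a controlled-X gate on Pauli strings, as a linear map. -/
def mapCX (i j : Fin N) : PString N →ₗ[ZMod 2] PString N :=
  LinearMap.pi fun k =>
    if k = i then LinearMap.prod (LinearMap.fst (ZMod 2) _ _ ∘ₗ LinearMap.proj i)
      (LinearMap.snd (ZMod 2) (ZMod 2) (ZMod 2) ∘ₗ LinearMap.proj i +
        LinearMap.snd _ _ _ ∘ₗ LinearMap.proj j)
    else if k = j then LinearMap.prod
      (LinearMap.fst (ZMod 2) (ZMod 2) (ZMod 2) ∘ₗ LinearMap.proj j +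
        LinearMap.fst _ _ _ ∘ₗ LinearMap.proj i)
      (LinearMap.snd (ZMod 2) _ _ ∘ₗ LinearMap.proj j)
    else LinearMap.proj k

theorem mapCX_involutive (i j : Fin N) (hij : i ≠ j) : Function.Involutive (mapCX i j) := by
  have h2 : ∀ a b : ZMod 2, a + b + b = a := by decide
  intro σ
  funext k
  by_cases hk : k = i
  · subst hk
    ext <;> simp [mapCX, hij.symm, h2]
  · by_cases hk' : k = j
    · subst hk'
      ext <;> simp [mapCX, hk, h2]
    · simp [mapCX, hk, hk']

/-- The action of a controlled-X gate on Pauli strings. -/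
def actCX (i j : Fin N) (hij : i ≠ j) : PString N ≃ₗ[ZMod 2] PString N :=
  LinearEquiv.ofInvolutive (mapCX i j) (mapCX_involutive i j hij)

theorem actCX_control (i j : Fin N) (hij : i ≠ j) (σ : PString N) :
    actCX i j hij σ i = ((σ i).1, (σ i).2 + (σ j).2) := by
  change mapCX i j σ i = _
  simp [mapCX]

theorem actCX_target (i j : Fin N) (hij : i ≠ j) (σ : PString N) :
    actCX i j hij σ j = ((σ j).1 + (σ i).1, (σ j).2) := by
  change mapCX i j σ j = _
  simp [mapCX, hij.symm]

theorem actCX_of_ne (i j : Fin N) (hij : i ≠ j) (σ : PString N) {k : Fin N} (hi : k ≠ i)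
    (hj : k ≠ j) : actCX i j hij σ k = σ k := by
  change mapCX i j σ k = _
  simp [mapCX, hi, hj]

theorem matCX_mul_apply (i j : Fin N) (hij : i ≠ j) (M : Op (Fin N)) (x y : Fin N → Fin 2) :
    (matCX i j * M * (matCX i j).conjTranspose) x y =
      M (Function.update x j (x j + x i)) (Function.update y j (y j + y i)) := by
  have h1 : ∀ (M : Op (Fin N)) x y, (matCX i j * M) x y =
      M (Function.update x j (x j + x i)) y := fun M x y =>
    matCX_mulVec i j hij (fun z => M z y) x
  have h2 : matCX i j * M * (matCX i j).conjTranspose =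
      (matCX i j * (matCX i j * M).conjTranspose).conjTranspose := by
    rw [conjTranspose_mul, conjTranspose_conjTranspose]
  rw [h2, conjTranspose_apply, h1, conjTranspose_apply, star_star, h1]

/-- The entries of a Pauli matrix up to a common phase. -/
def Pauli.entry (p : Pauli) (a b : Fin 2) : ℤ :=
  if (a.val + b.val + p.1.val) % 2 = 0 then (-1) ^ (p.2.val * b.val) else 0

theorem Pauli.mat_apply (p : Pauli) (a b : Fin 2) :
    p.mat a b = (if p = pY then Complex.I else 1) * (p.entry a b : ℂ) := by
  have hXY : pX ≠ pY := by decide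
  have hZY : pZ ≠ pY := by decide
  have h0Y : 0 ≠ pY := by decide
  have hv : (1 : ZMod 2).val = 1 := rfl
  rcases p.cases with h | h | h | h <;> subst h <;> fin_cases a <;> fin_cases b <;>
    simp [matX, matY, matZ, Pauli.entry, hXY, hZY, h0Y] <;> simp [pX, pY, pZ, hv]

/-- With the phase of `Y` removed the entries are integers, so the action of `CX` on a pair of Pauli
matrices is a finite check. -/
theorem Pauli.entry_cx : ∀ (p q : Pauli) (a b c d : Fin 2),
    p.entry a b * q.entry (c + a) (d + b) =
      Pauli.entry (p.1, p.2 + q.2) a b * Pauli.entry (q.1 + p.1, q.2) c d := by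
  decide +kernel

theorem matCX_isClifford (i j : Fin N) (hij : i ≠ j) :
    IsClifford (matCX i j) (actCX i j hij) := by
  refine ⟨matCX_unitary i j hij, fun σ => ?_⟩
  set τ := actCX i j hij σ with hτ
  let κ : Pauli → ℂ := fun p => if p = pY then Complex.I else 1
  have hκ : ∀ p, κ p ≠ 0 := fun p => by
    simp only [κ]; split_ifs; exacts [Complex.I_ne_zero, one_ne_zero]
  -- The removed phases of `σ` at the two qubits, divided by those of its image `τ`; at all other
  -- qubits `σ` and `τ` agree.
  refine ⟨κ (σ i) * κ (σ j) * (κ (τ i))⁻¹ * (κ (τ j))⁻¹, ?_⟩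
  ext x y
  rw [matCX_mul_apply i j hij, Matrix.smul_apply, smul_eq_mul]
  simp only [pauliOp, kron, of_apply]
  have hj : j ∈ Finset.univ.erase i := by simp [hij.symm]
  rw [← Finset.mul_prod_erase _ _ (Finset.mem_univ i), ← Finset.mul_prod_erase _ _ hj,
    ← Finset.mul_prod_erase _ (fun k => (τ k).mat (x k) (y k)) (Finset.mem_univ i),
    ← Finset.mul_prod_erase _ (fun k => (τ k).mat (x k) (y k)) hj]
  have hrest : ∀ k ∈ (Finset.univ.erase i).erase j,
      (σ k).mat (Function.update x j (x j + x i) k) (Function.update y j (y j + y i) k) =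
      (τ k).mat (x k) (y k) := by
    intro k hk
    simp only [Finset.mem_erase, Finset.mem_univ, and_true] at hk
    rw [hτ, actCX_of_ne i j hij σ hk.2 hk.1, Function.update_of_ne hk.1, Function.update_of_ne hk.1]
  rw [Finset.prod_congr rfl hrest]
  simp only [Function.update_self, Function.update_of_ne hij, Pauli.mat_apply]
  have h := Pauli.entry_cx (σ i) (σ j) (x i) (y i) (x j) (y j)
  rw [← actCX_control i j hij, ← actCX_target i j hij, ← hτ] at h
  have h' : ((σ i).entry (x i) (y i) : ℂ) * ((σ j).entry (x j + x i) (y j + y i) : ℂ) =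
      ((τ i).entry (x i) (y i) : ℂ) * ((τ j).entry (x j) (y j) : ℂ) := by exact_mod_cast h
  have h1 := hκ (τ i)
  have h2 := hκ (τ j)
  change κ (σ i) * _ * (κ (σ j) * _ * _) = _ * (κ (τ i) * _ * (κ (τ j) * _ * _))
  field_simp
  linear_combination (κ (σ i) * κ (σ j) * ∏ k ∈ (Finset.univ.erase i).erase j,
    ((if τ k = pY then Complex.I else 1) * ((τ k).entry (x k) (y k) : ℂ))) * h'

/-! ## Factoring stabilised vectors -/

/-- The eigenspaces are lines. The coordinate `b` is one where the spanning vector `f` equals `1`,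
so an eigenvector `v` is `v b` times `f`. -/
theorem Pauli.eigenvector (p : Pauli) (hp : p ≠ 0) (s : ℂ) (hs : s = 1 ∨ s = -1) :
    ∃ (b : Fin 2) (f : Fin 2 → ℂ), (∀ a, ∑ c, p.mat a c * f c = s * f a) ∧
      ∀ v : Fin 2 → ℂ, (∀ a, ∑ c, p.mat a c * v c = s * v a) → ∀ a, v a = f a * v b := by
  have hI := Complex.I_mul_I
  rcases p.cases with h | h | h | h <;> subst h
  · exact absurd rfl hp
  · refine ⟨0, ![1, s], ?_, fun v hv a => ?_⟩
    · intro a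
      rcases hs with rfl | rfl <;> fin_cases a <;> simp [matX, Fin.sum_univ_two]
    · have h0 := hv 0
      simp [matX, Fin.sum_univ_two] at h0
      fin_cases a <;> simp [h0]
  · refine ⟨0, ![1, s * Complex.I], ?_, fun v hv a => ?_⟩
    · intro a
      rcases hs with rfl | rfl <;> fin_cases a <;> simp [matY, Fin.sum_univ_two]
    · have h0 := hv 0
      simp [matY, Fin.sum_univ_two] at h0
      fin_cases a
      · simp
      · simp only [Fin.mk_one, cons_val_one, cons_val_fin_one]
        linear_combination Complex.I * h0 + v 1 * hI
  · rcases hs with rfl | rfl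
    · refine ⟨0, ![1, 0], ?_, fun v hv a => ?_⟩
      · intro a
        fin_cases a <;> simp [matZ, Fin.sum_univ_two]
      · have h1 := hv 1
        simp [matZ, Fin.sum_univ_two] at h1
        have h2 : v 1 = 0 := by linear_combination (-1 / 2) * h1
        fin_cases a <;> simp [h2]
    · refine ⟨1, ![0, 1], ?_, fun v hv a => ?_⟩
      · intro a
        fin_cases a <;> simp [matZ, Fin.sum_univ_two]
      · have h1 := hv 0
        simp [matZ, Fin.sum_univ_two] at h1
        have h2 : v 0 = 0 := by linear_combination (1 / 2) * h1
        fin_cases a <;> simp [h2]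

/-- The vector `ψ` with qubit `i` fixed to `b`. -/
def slice (i : Fin N) (b : Fin 2) (ψ : Vec N) : Vec N := fun x => ψ (Function.update x i b)

/-- Written as a (non-unitary) operator on qubit `i`, slicing visibly commutes with every Pauli
string that is trivial at `i`. -/
theorem slice_eq_mulVec (i : Fin N) (b : Fin 2) (ψ : Vec N) :
    slice i b ψ = onQubit i (of fun _ c => if c = b then 1 else 0) *ᵥ ψ := by
  funext x
  rw [onQubit_mulVec]
  simp [slice]

theorem slice_dependsOn {A : Finset (Fin N)} (i : Fin N) (b : Fin 2) {ψ : Vec N}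
    (h : DependsOn ψ (A : Set (Fin N))) :
    DependsOn (slice i b ψ) (A.erase i : Set (Fin N)) := by
  intro x y hxy
  refine h fun k hk => ?_
  by_cases hki : k = i
  · subst hki; simp
  · simp only [Function.update_of_ne hki]
    exact hxy k (by simp [hki]; exact hk)

theorem Stabilizes.slice {S : PGroup N} {ψ : Vec N} (h : Stabilizes S ψ) (i : Fin N) (b : Fin 2)
    (hS : ∀ σ ∈ S, σ i = 0) : Stabilizes S (slice i b ψ) := by
  intro σ hσ
  rw [slice_eq_mulVec]
  have hc : pauliOp σ * onQubit i (of fun _ c => if c = b then 1 else 0) =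
      onQubit i (of fun _ c => if c = b then 1 else 0) * pauliOp σ := by
    rw [pauliOp, onQubit, kron_mul, kron_mul]
    congr 1
    funext k
    by_cases hk : k = i
    · subst hk; simp [hS σ hσ]
    · simp [hk]
  rw [mulVec_mulVec, hc, ← mulVec_mulVec]
  rcases h σ hσ with h1 | h1 <;> rw [h1]
  · left; rfl
  · right; rw [mulVec_neg]

/-- A vector stabilised by a one-qubit Pauli operator is a product. -/
theorem exists_factor {i : Fin N} {p : Pauli} (hp : p ≠ 0) {ψ : Vec N}
    (h : Stabilizes (oneGen i p) ψ) : ∃ (b : Fin 2) (φ : Vec N), DependsOn φ {i} ∧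
      Stabilizes (oneGen i p) φ ∧ ψ = φ * slice i b ψ := by
  obtain ⟨s, hs, hsψ⟩ : ∃ s : ℂ, (s = 1 ∨ s = -1) ∧ pauliOp (Pi.single i p) *ᵥ ψ = s • ψ := by
    rcases h _ (single_mem_oneGen i p) with h | h
    · exact ⟨1, Or.inl rfl, by rw [h, one_smul]⟩
    · exact ⟨-1, Or.inr rfl, by rw [h, neg_smul, one_smul]⟩
  obtain ⟨b, f, hf, hv⟩ := p.eigenvector hp s hs
  have key : pauliOp (Pi.single i p) *ᵥ (fun x => f (x i)) = s • fun x : Fin N → Fin 2 => f (x i) := by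
    funext x
    rw [pauliOp_single, onQubit_mulVec]
    simpa using hf (x i)
  refine ⟨b, fun x => f (x i), ?_, stabilizes_span ?_, ?_⟩
  · intro x y hxy
    simp only [hxy i (Set.mem_singleton i)]
  · rintro σ rfl
    exact eq_or_eq_neg_of_eq_smul key
  · funext x
    -- With all other qubits held fixed, `ψ` as a function of qubit `i` is an eigenvector of `p`.
    have h1 := hv (fun c => ψ (Function.update x i c)) (fun a => by
      have := congrFun hsψ (Function.update x i a)
      rw [pauliOp_single, onQubit_mulVec] at this
      simpa using this) (x i)
    simpa [QStab.slice] using h1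

theorem insert_erase_union {A : Finset (Fin N)} {i : Fin N} (hi : i ∈ A) :
    {i} ∪ A.erase i = A := by
  rw [← Finset.insert_eq, Finset.insert_erase hi]

/-- The recursion of `splitStab` is repeated on vectors: each one-qubit element of the group splits
off a factor, and the slice that is left is still stabilised by the rest of the group, which is
trivial at that qubit. -/
theorem splitStab_mem_cone (J : List (Fin N)) (A : Finset (Fin N)) (S : PGroup N)
    (h : IsStab A S) {β : PreAssignment N} (hβ : IsPartition β)
    (hb : ∀ b ∈ splitStab J A S, ∀ j ∈ b.1, β j = b) {ψ : Vec N}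
    (hψ : DependsOn ψ (A : Set (Fin N))) (hs : Stabilizes S ψ) :
    IsUnion β A ∧ outer ψ ∈ cone β A := by
  induction J generalizing A S ψ with
  | nil =>
    rcases A.eq_empty_or_nonempty with rfl | ⟨i, hi⟩
    · refine ⟨fun i hi => absurd hi (Finset.notMem_empty i), ?_⟩
      -- All qubits have been split off. `β` says nothing about an empty block, but `ψ` is now a
      -- constant, so `outer ψ` is a nonnegative multiple of the empty product.
      have h1 : outer ψ = (⟨‖ψ 0‖ ^ 2, by positivity⟩ : ℝ≥0) • (of fun _ _ => 1 : Op (Fin N)) := by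
        ext x y
        have hx : ψ x = ψ 0 := hψ fun i hi => by simp at hi
        have hy : ψ y = ψ 0 := hψ fun i hi => by simp at hi
        rw [outer_apply, hx, hy, Matrix.smul_apply, of_apply]
        change _ = (‖ψ 0‖ ^ 2 : ℝ) • (1 : ℂ)
        simp [Complex.mul_conj']
      rw [h1]
      exact Submodule.smul_mem _ _ (isProd_empty.2 rfl).mem_cone
    · have e := hb (A, .stab S) (by simp [splitStab]) i hi
      have e1 : A = (β i).1 := by rw [e]
      rw [e1]
      refine ⟨hβ.isUnion_block i, ((isProd_block hβ i).2 ?_).mem_cone⟩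
      rw [e]
      exact ⟨ψ, hψ, hs, rfl⟩
  | cons i J ih =>
    rw [splitStab] at hb
    split_ifs at hb with hc
    · obtain ⟨⟨p, hp, hone⟩, -⟩ := hc
      have hi := single_mem_of_inf_eq_oneGen hone
      have hiA := mem_of_single_mem_supported hp (h.1 hi)
      have hsub : oneGen i p ≤ S := by rw [← hone]; exact inf_le_left
      obtain ⟨b, φ, hφ, hφs, e⟩ := exists_factor hp (hs.mono hsub)
      obtain ⟨h1, h2⟩ := ih (A.erase i) (S ⊓ supported (A.erase i)) (h.erase hp hi)
        (fun b hb' => hb b (List.mem_cons_of_mem _ hb')) (slice_dependsOn i b hψ)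
        ((hs.mono inf_le_left).slice i b fun σ hσ => hσ.2 i (Finset.notMem_erase i A))
      have e3 := hb _ List.mem_cons_self i (Finset.mem_singleton_self i)
      have e4 : ({i} : Finset (Fin N)) = (β i).1 := by rw [e3]
      have hu : IsUnion β {i} := by rw [e4]; exact hβ.isUnion_block i
      rw [← insert_erase_union hiA]
      refine ⟨hu.union h1, ?_⟩
      rw [e, outer_mul]
      refine cone_union hβ h1 (by simp) ?_ h2
      rw [e4]
      refine ((isProd_block hβ i).2 ?_).mem_cone
      rw [e3, hone]
      exact ⟨φ, by simpa using hφ, hφs, rfl⟩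
    · exact ih A S h hb hψ hs

theorem conj_mem_of_mem_stabCone {A : Finset (Fin N)} {S : Set (PString N)} {U K : Op (Fin N)}
    {P : Submodule ℝ≥0 (Op (Fin N))} (hK : K ∈ stabCone A S)
    (h : ∀ ψ : Vec N, DependsOn ψ (A : Set (Fin N)) →
      (∀ σ ∈ S, pauliOp σ *ᵥ ψ = ψ ∨ pauliOp σ *ᵥ ψ = -ψ) → outer (U *ᵥ ψ) ∈ P) :
    U * K * U.conjTranspose ∈ P := by
  induction hK using Submodule.span_induction with
  | mem K hK =>
    obtain ⟨ψ, h1, h2, rfl⟩ := hK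
    rw [mul_outer_mul]
    exact h ψ h1 h2
  | zero => rw [mul_zero, zero_mul]; exact P.zero_mem
  | add A A' _ _ h1 h2 => rw [mul_add, add_mul]; exact P.add_mem h1 h2
  | smul c A _ h1 => rw [mul_smul_comm, smul_mul_assoc]; exact P.smul_mem c h1

/-! ## Measurement -/

theorem pauliZ_mulVec (i : Fin N) (ψ : Vec N) (x : Fin N → Fin 2) :
    (pauliOp (Pi.single i pZ) *ᵥ ψ) x = if x i = 0 then ψ x else -ψ x := by
  rw [pauliOp_single, onQubit_mulVec, Pauli.mat_pZ, Fin.sum_univ_two]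
  have h : ∀ a : Fin 2, a = 0 ∨ a = 1 := by decide
  rcases h (x i) with hx | hx
  · have : Function.update x i 0 = x := by rw [← hx, Function.update_eq_self]
    simp [hx, matZ, this]
  · have : Function.update x i 1 = x := by rw [← hx, Function.update_eq_self]
    simp [hx, matZ, this]

theorem pauliZ_proj (b : Fin 2) (i : Fin N) (ψ : Vec N) :
    pauliOp (Pi.single i pZ) *ᵥ (proj b i *ᵥ ψ) = proj b i *ᵥ ψ ∨
      pauliOp (Pi.single i pZ) *ᵥ (proj b i *ᵥ ψ) = -(proj b i *ᵥ ψ) := by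
  have h : b = 0 ∨ b = 1 := by revert b; decide
  rcases h with rfl | rfl
  · left; funext x
    rw [pauliZ_mulVec, proj_mulVec]
    split_ifs <;> simp
  · right; funext x
    rw [pauliZ_mulVec, Pi.neg_apply, proj_mulVec]
    by_cases hx : x i = 0 <;> simp [hx]

theorem proj_eq (b : Fin 2) (i : Fin N) (ψ : Vec N) :
    proj b i *ᵥ ψ = (1 / 2 : ℂ) • (ψ + (if b = 0 then 1 else -1 : ℂ) •
      (pauliOp (Pi.single i pZ) *ᵥ ψ)) := by
  have h : ∀ a : Fin 2, a = 0 ∨ a = 1 := by decide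
  funext x
  rw [proj_mulVec, Pi.smul_apply, Pi.add_apply, Pi.smul_apply, pauliZ_mulVec]
  rcases h b with rfl | rfl <;> rcases h (x i) with hx | hx <;> simp [hx] <;> ring

theorem Stabilizes.measStab {S : PGroup N} {ψ : Vec N} (h : Stabilizes S ψ) (b : Fin 2)
    (i : Fin N) : Stabilizes (measStab i S) (proj b i *ᵥ ψ) := by
  refine stabilizes_span ?_
  rintro σ (⟨hσ, hc⟩ | rfl)
  · rw [proj_eq, mulVec_smul, mulVec_add, mulVec_smul, mulVec_mulVec, hc.eq, ← mulVec_mulVec]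
    rcases h σ hσ with h1 | h1 <;> rw [h1]
    · left; rfl
    · right; rw [mulVec_neg, smul_neg, ← neg_add, smul_neg]
  · exact pauliZ_proj b i ψ

theorem proj_isLocal (b : Fin 2) (i : Fin N) : IsLocal {i} (proj b i) := onQubit_isLocal i _

theorem IsAssignment.block_eq_singleton {α : PreAssignment N} (hα : IsAssignment α) {i : Fin N}
    (h : (α i).1.card = 1) : (α i).1 = {i} := by
  obtain ⟨k, hk⟩ := Finset.card_eq_one.1 h
  have := hα.mem i
  rw [hk, Finset.mem_singleton] at this
  rw [hk, this]

theorem IsAssignment.two_le_card {α : PreAssignment N} (hα : IsAssignment α) {i : Fin N}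
    (h : (α i).1.card ≠ 1) : 2 ≤ (α i).1.card := by
  have := Finset.card_pos.2 ⟨i, hα.mem i⟩
  omega

/-- One abstract result serves both outcomes: the post-measurement states differ in the sign of `Z`,
which labels do not record. The projected vectors are not renormalised and may vanish. -/
theorem meas_sound {α : PreAssignment N} (hα : IsAssignment α) (i : Fin N) :
    IsAssignment (meas i α) ∧ ∀ (b : Fin 2), ∀ M ∈ cone α Finset.univ,
      proj b i * M * proj b i ∈ cone (meas i α) Finset.univ := by
  have hp := hα.isPartition
  have hU := hp.isUnion_block i
  have hloc : ∀ b, IsLocal (α i).1 (proj b i) := fun b =>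
    (proj_isLocal b i).mono (Finset.singleton_subset_iff.2 (hα.mem i))
  suffices ∃ bs, meas i α = replace α bs ∧ Tiles (α i).1 bs ∧ (∀ b ∈ bs, b.2.Valid b.1) ∧
      ∀ β : PreAssignment N, IsPartition β → (∀ c ∈ bs, ∀ j ∈ c.1, β j = c) →
      ∀ b K, IsProd α (α i).1 K →
        proj b i * K * (proj b i).conjTranspose ∈ cone β (α i).1 by
    obtain ⟨bs, e, ht, hv, hK⟩ := this
    rw [e]
    have hβ := ht.isAssignment hα hU hv
    refine ⟨hβ, fun b M hM => ?_⟩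
    have := conj_mem_cone hp hβ.isPartition hU (ht.isUnion α)
      (fun j hj => (ht.replace_notMem α hj).symm) (hloc b)
      (hK _ hβ.isPartition (fun c hc j hj => ht.replace_mem α hc hj) b) hM
    rwa [proj_conjTranspose] at this
  by_cases hcard : (α i).1.card = 1
  · have hA := hα.block_eq_singleton hcard
    refine ⟨[((α i).1, labelZ i)], by rw [meas, if_pos hcard], tiles_singleton _ _, ?_, ?_⟩
    · intro b hb
      rw [List.mem_singleton] at hb
      subst hb
      rw [hA]
      exact valid_singleton_oneGen i pZ_ne_zero
    · intro β hβ hbs b K hK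
      have e := hbs _ List.mem_cons_self i (hα.mem i)
      refine conj_mem_of_mem_stabCone (hK.mem_stabCone hp hU) fun ψ hψ _ => ?_
      have e1 : (α i).1 = (β i).1 := by rw [e]
      have e2 : (β i).2 = .stab (oneGen i pZ) := by rw [e]; rfl
      rw [e1, cone_block_stab hβ e2, ← e1]
      refine Submodule.subset_span ⟨_, (hloc b).dependsOn _ subset_rfl ψ hψ, ?_, rfl⟩
      refine stabilizes_span ?_
      rintro σ rfl
      exact pauliZ_proj b i ψ
  · have h2 := hα.two_le_card hcard
    have hvalid := hα.valid i
    rcases hL : (α i).2 with _ | _ | S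
    · rw [hL] at hvalid
      exact absurd hvalid hcard
    · obtain ⟨j, hj⟩ : ((α i).1.erase i).Nonempty := by
        rw [← Finset.card_pos, Finset.card_erase_of_mem (hα.mem i)]; omega
      refine ⟨[({i}, labelZ i), ((α i).1.erase i, .box)], by rw [meas, if_neg hcard, hL],
        (tiles_singleton _ _).cons (hα.mem i) _, ?_, ?_⟩
      · intro b hb
        simp only [List.mem_cons, List.not_mem_nil, or_false] at hb
        rcases hb with rfl | rfl
        · exact valid_singleton_oneGen i pZ_ne_zero
        · trivial
      · intro β hβ hbs b K hK
        have ei := hbs _ List.mem_cons_self i (Finset.mem_singleton_self i)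
        have ej := hbs _ (List.mem_cons_of_mem _ List.mem_cons_self) j hj
        refine conj_mem_of_mem_stabCone (hK.mem_stabCone hp hU) fun ψ hψ _ => ?_
        -- A projected pure state is a product of the basis state `b` and a slice, so the unmeasured
        -- part is again pure.
        have e : proj b i *ᵥ ψ = (fun x => if x i = b then 1 else 0) * slice i b ψ := by
          funext x
          rw [proj_mulVec, Pi.mul_apply]
          split_ifs with hx
          · rw [slice, ← hx, Function.update_eq_self, one_mul]
          · rw [zero_mul]
        have hu : IsUnion β ((α i).1.erase i) := by
          have := hβ.isUnion_block j
          rwa [ej] at this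
        rw [e, outer_mul]
        suffices h3 : (outer fun x => if x i = b then 1 else 0) ⊙ outer (slice i b ψ) ∈
            cone β ({i} ∪ (α i).1.erase i) by rwa [insert_erase_union (hα.mem i)] at h3
        refine cone_union hβ hu (by simp) ?_ ?_
        · refine IsProd.mem_cone ?_
          have := isProd_block hβ i (M := outer fun x => if x i = b then 1 else 0)
          rw [ei] at this
          refine this.2 ⟨_, ?_, stabilizes_span ?_, rfl⟩
          · intro x y hxy
            simp only [hxy i (by simp)]
          · rintro σ rfl
            have h1 : proj b i *ᵥ (fun _ => 1) = fun x : Fin N → Fin 2 =>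
                if x i = b then (1 : ℂ) else 0 := by
              funext x; rw [proj_mulVec]
            rw [← h1]
            exact pauliZ_proj b i _
        · refine IsProd.mem_cone ?_
          have := isProd_block hβ j (M := outer (slice i b ψ))
          rw [ej] at this
          exact this.2 ⟨_, slice_dependsOn i b hψ, rfl⟩
    · rw [hL] at hvalid
      -- On a block of at least two qubits a valid stabilizer contains no one-qubit operator, in
      -- particular not `Z` on `i`.
      have hst := isStab_measStab hvalid.1 (hα.mem i) (hvalid.2 h2 i pZ pZ_ne_zero)
      obtain ⟨ht, hv⟩ := splitStab_tiles ((α i).1.sort (· ≤ ·)) _ _ hst (fun _ k p hp' hk => by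
        rw [Finset.mem_sort]
        exact mem_of_single_mem_supported hp' (hst.1 hk))
      refine ⟨_, by rw [meas, if_neg hcard, hL]; rfl, ht, hv, ?_⟩
      intro β hβ hbs b K hK
      rw [isProd_block hp, hL] at hK
      obtain ⟨ψ, hψ, hs, rfl⟩ := hK
      rw [mul_outer_mul]
      exact (splitStab_mem_cone _ _ _ hst hβ hbs ((hloc b).dependsOn _ subset_rfl ψ hψ)
        (hs.measStab b i)).2

/-! ## Gates -/

/-- Soundness of a replacement of the blocks in `X` under an operator that is local to `X`. -/
theorem replace_sound {α : PreAssignment N} (hα : IsAssignment α) {X : Finset (Fin N)}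
    (hX : IsUnion α X) {U : Op (Fin N)} (hU : IsLocal X U) {bs : List (Block N)}
    (ht : Tiles X bs) (hv : ∀ b ∈ bs, b.2.Valid b.1)
    (h : ∀ β : PreAssignment N, IsPartition β → (∀ c ∈ bs, ∀ j ∈ c.1, β j = c) →
      ∀ K, IsProd α X K → U * K * U.conjTranspose ∈ cone β X) :
    IsAssignment (replace α bs) ∧ ∀ M ∈ cone α Finset.univ,
      U * M * U.conjTranspose ∈ cone (replace α bs) Finset.univ := by
  have hβ := ht.isAssignment hα hX hv
  refine ⟨hβ, fun M hM => ?_⟩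
  exact conj_mem_cone hα.isPartition hβ.isPartition hX (ht.isUnion α)
    (fun j hj => (ht.replace_notMem α hj).symm) hU
    (h _ hβ.isPartition fun c hc j hj => ht.replace_mem α hc hj) hM

/-- In general the image of a product must again be a single ray; for the label `■` it may be any
mixture of pure states on `X`. -/
theorem replace_block_sound {α : PreAssignment N} (hα : IsAssignment α) {X : Finset (Fin N)}
    (hX : IsUnion α X) (hne : X.Nonempty) {U : Op (Fin N)} (hU : IsLocal X U) {L : Label N}
    (hv : L.Valid X) (h : ∀ K, IsProd α X K → L.IsRay X (U * K * U.conjTranspose) ∨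
      L = .box ∧ U * K * U.conjTranspose ∈ stabCone X ∅) :
    IsAssignment (replace α [(X, L)]) ∧ ∀ M ∈ cone α Finset.univ,
      U * M * U.conjTranspose ∈ cone (replace α [(X, L)]) Finset.univ := by
  refine replace_sound hα hX hU (tiles_singleton X L) (fun b hb => ?_) fun β hβ hbs K hK => ?_
  · rw [List.mem_singleton] at hb
    subst hb
    exact hv
  · obtain ⟨i, hi⟩ := hne
    have e := hbs _ List.mem_cons_self i hi
    have e1 : (β i).1 = X := by rw [e]
    have e2 : (β i).2 = L := by rw [e]
    rcases h K hK with h | ⟨hb, h⟩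
    · have := isProd_block hβ i (M := U * K * U.conjTranspose)
      rw [e1, e2] at this
      exact (this.2 h).mem_cone
    · have := cone_block_box hβ (e2.trans hb)
      rw [e1] at this
      rwa [this]

theorem conj_mem_stabCone {A : Finset (Fin N)} {U : Op (Fin N)} (hU : IsLocal A U)
    {K : Op (Fin N)} (hK : K ∈ stabCone A ∅) : U * K * U.conjTranspose ∈ stabCone A ∅ :=
  conj_mem_of_mem_stabCone hK fun ψ hψ _ =>
    Submodule.subset_span ⟨_, hU.dependsOn A subset_rfl ψ hψ, fun _ h => h.elim, rfl⟩

theorem onQubit_conj_ind {A : Finset (Fin N)} {i : Fin N} (hi : i ∈ A)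
    {U : Matrix (Fin 2) (Fin 2) ℂ} (hU : U.conjTranspose * U = 1) :
    onQubit i U * ind A * (onQubit i U).conjTranspose = ind A := by
  refine kron_conj_ind A _ (fun j hj => ?_) fun j _ => ?_
  · rw [Function.update_of_ne]; rintro rfl; exact hj hi
  · by_cases hj : j = i
    · subst hj
      rw [Function.update_self]
      exact mul_eq_one_comm.1 hU
    · simp [hj]

theorem IsClifford.isRay_conj {U : Op (Fin N)} {L : PString N ≃ₗ[ZMod 2] PString N}
    (h : IsClifford U L) {A : Finset (Fin N)} (hU : IsLocal A U)
    (hind : U * ind A * U.conjTranspose = ind A) {l : Label N} {K : Op (Fin N)}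
    (hK : l.IsRay A K) : (l.conj U).IsRay A (U * K * U.conjTranspose) := by
  rcases l with _ | _ | S
  · rw [show K = ind A from hK]; exact hind
  · obtain ⟨ψ, hψ, rfl⟩ := hK
    exact ⟨_, hU.dependsOn A subset_rfl ψ hψ, mul_outer_mul U ψ⟩
  · obtain ⟨ψ, hψ, hs, rfl⟩ := hK
    exact ⟨_, hU.dependsOn A subset_rfl ψ hψ, hs.conjGroup h.unitary, mul_outer_mul U ψ⟩

theorem gate_sound {α : PreAssignment N} (hα : IsAssignment α) (U : Gate) (i : Fin N) :
    IsAssignment (replace α [((α i).1, (α i).2.conj (onQubit i U.mat))]) ∧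
      ∀ M ∈ cone α Finset.univ, onQubit i U.mat * M * (onQubit i U.mat).conjTranspose ∈
        cone (replace α [((α i).1, (α i).2.conj (onQubit i U.mat))]) Finset.univ := by
  have hp := hα.isPartition
  have hC := U.isClifford i
  have hloc : IsLocal (α i).1 (onQubit i U.mat) :=
    (onQubit_isLocal i _).mono (Finset.singleton_subset_iff.2 (hα.mem i))
  refine replace_block_sound hα (hp.isUnion_block i) ⟨i, hα.mem i⟩ hloc ?_ fun K hK => Or.inl ?_
  · have hv := hα.valid i
    rcases hL : (α i).2 with _ | _ | S
    · rw [hL] at hv; exact hv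
    · trivial
    · rw [hL] at hv
      refine ⟨hC.isStab (fun σ hσ j hj => ?_) hv.1, fun h2 k p hp' hk => ?_⟩
      · rw [Gate.actOn_of_ne, hσ j hj]
        rintro rfl; exact hj (hα.mem j)
      · rw [hC.conjGroup_eq] at hk
        obtain ⟨σ, hσ, e⟩ := hk
        -- The gate acts invertibly qubit by qubit, so it preserves which qubits a string touches: a
        -- one-qubit element of the new group comes from one of the old group.
        have h0 : ∀ j, U.actOn i σ j = 0 ↔ σ j = 0 := by
          intro j
          by_cases hj : j = i
          · subst hj; rw [Gate.actOn_self]; exact U.act.map_eq_zero_iff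
          · rw [Gate.actOn_of_ne U hj]
        have e' : U.actOn i σ = Pi.single k p := e
        have e1 : σ = Pi.single k (σ k) := by
          funext j
          by_cases hj : j = k
          · subst hj; simp
          · rw [Pi.single_eq_of_ne hj, ← h0, e', Pi.single_eq_of_ne hj]
        have e2 : σ k ≠ 0 := by
          rw [Ne, ← h0, e', Pi.single_eq_same]; exact hp'
        exact hv.2 h2 k (σ k) e2 (e1 ▸ hσ)
  · exact hC.isRay_conj hloc (onQubit_conj_ind (hα.mem i) U.mat_unitary) ((isProd_block hp i).1 hK)

theorem matT_mulVec (i : Fin N) (ψ : Vec N) (x : Fin N → Fin 2) :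
    (onQubit i matT *ᵥ ψ) x =
      (if x i = 0 then 1 else Complex.exp (Complex.I * (Real.pi / 4))) * ψ x := by
  rw [onQubit_mulVec, Fin.sum_univ_two]
  have h : ∀ a : Fin 2, a = 0 ∨ a = 1 := by decide
  rcases h (x i) with hx | hx
  · have : Function.update x i 0 = x := by rw [← hx, Function.update_eq_self]
    simp [hx, matT, this]
  · have : Function.update x i 1 = x := by rw [← hx, Function.update_eq_self]
    simp [hx, matT, this]

theorem eq_zero_of_pauliZ_eq {i : Fin N} {ψ : Vec N} (h : pauliOp (Pi.single i pZ) *ᵥ ψ = ψ)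
    {x : Fin N → Fin 2} (hx : x i ≠ 0) : ψ x = 0 := by
  have := congrFun h x
  rw [pauliZ_mulVec, if_neg hx] at this
  linear_combination (-1 / 2) * this

theorem eq_zero_of_pauliZ_eq_neg {i : Fin N} {ψ : Vec N}
    (h : pauliOp (Pi.single i pZ) *ᵥ ψ = -ψ) {x : Fin N → Fin 2} (hx : x i = 0) : ψ x = 0 := by
  have := congrFun h x
  rw [pauliZ_mulVec, if_pos hx, Pi.neg_apply] at this
  linear_combination (1 / 2) * this

/-- An eigenvector of `Z` on qubit `i` is supported on one value of that bit, where `T` is a scalar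
of modulus one; a global phase cancels in `outer`. -/
theorem matT_conj_outer {i : Fin N} {ψ : Vec N}
    (h : pauliOp (Pi.single i pZ) *ᵥ ψ = ψ ∨ pauliOp (Pi.single i pZ) *ᵥ ψ = -ψ) :
    outer (onQubit i matT *ᵥ ψ) = outer ψ := by
  rcases h with h | h
  · congr 1
    funext x
    rw [matT_mulVec]
    split_ifs with hx
    · rw [one_mul]
    · rw [eq_zero_of_pauliZ_eq h hx, mul_zero]
  · have e : onQubit i matT *ᵥ ψ = Complex.exp (Complex.I * (Real.pi / 4)) • ψ := by
      funext x
      rw [matT_mulVec, Pi.smul_apply, smul_eq_mul]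
      split_ifs with hx
      · rw [eq_zero_of_pauliZ_eq_neg h hx, mul_zero, mul_zero]
      · rfl
    have hn : Complex.exp (Complex.I * (Real.pi / 4)) *
        star (Complex.exp (Complex.I * (Real.pi / 4))) = 1 := by
      have h4 : (starRingEnd ℂ) 4 = 4 := map_ofNat _ 4
      simp [← Complex.exp_conj, ← Complex.exp_add, h4]
    rw [e, outer_smul, hn, one_smul]

theorem gateT_sound {α : PreAssignment N} (hα : IsAssignment α) (i : Fin N) :
    IsAssignment ((QIL.gateT i).asem α) ∧ ∀ M ∈ cone α Finset.univ,
      onQubit i matT * M * (onQubit i matT).conjTranspose ∈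
        cone ((QIL.gateT i).asem α) Finset.univ := by
  have hp := hα.isPartition
  have hU := hp.isUnion_block i
  have hloc : IsLocal (α i).1 (onQubit i matT) :=
    (onQubit_isLocal i _).mono (Finset.singleton_subset_iff.2 (hα.mem i))
  rw [QIL.asem]
  split_ifs with hc
  · refine ⟨hα, fun M hM => conj_mem_cone hp hp hU hU (fun _ _ => rfl) hloc ?_ hM⟩
    intro K hK
    suffices e : onQubit i matT * K * (onQubit i matT).conjTranspose = K by
      rw [e]; exact hK.mem_cone
    rw [isProd_block hp] at hK
    rcases hL : (α i).2 with _ | _ | S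
    · rw [hL] at hK
      rw [show K = ind _ from hK]
      exact onQubit_conj_ind (hα.mem i) matT_unitary
    · rw [hL] at hc; exact hc.elim
    · have hv := hα.valid i
      rw [hL] at hK hc hv
      obtain ⟨ψ, hψ, hs, rfl⟩ := hK
      rw [mul_outer_mul]
      -- By maximality, a stabilizer that commutes with `Z` on `i` contains it.
      refine matT_conj_outer (hs _ (hv.1.mem_of_commute (single_mem_supported (hα.mem i) pZ) ?_))
      exact fun σ hσ => commute_pauliOp.1 (hc σ hσ)
  · exact replace_block_sound hα hU ⟨i, hα.mem i⟩ hloc trivial fun K hK =>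
      Or.inr ⟨rfl, conj_mem_stabCone hloc (hK.mem_stabCone hp hU)⟩

/-! ## The controlled-X gate -/

/-- Commuting or anticommuting past `τ` changes an eigenvalue at most by a sign, which is
disregarded. Hence Pauli corrections preserve every label. -/
theorem Stabilizes.pauliOp {S : PGroup N} {ψ : Vec N} (h : Stabilizes S ψ) (τ : PString N) :
    Stabilizes S (pauliOp τ *ᵥ ψ) := by
  intro σ hσ
  have : ∃ c : ℂ, QStab.pauliOp σ *ᵥ (QStab.pauliOp τ *ᵥ ψ) = c • (QStab.pauliOp τ *ᵥ ψ) := by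
    rw [mulVec_mulVec, pauliOp_comm, smul_mulVec, ← mulVec_mulVec]
    rcases h σ hσ with h1 | h1 <;> rw [h1]
    · exact ⟨_, rfl⟩
    · exact ⟨-signChar (symp (Fin N) σ τ), by rw [mulVec_neg, smul_neg, neg_smul]⟩
  exact eq_or_eq_neg_of_eq_smul this.choose_spec

theorem Label.IsRay.pauli_conj {A : Finset (Fin N)} {g : Op (Fin N)} {L : Label N}
    (h : L.IsRay A g) {τ : PString N} (hτ : τ ∈ supported A) :
    L.IsRay A (pauliOp τ * g * (pauliOp τ).conjTranspose) := by
  have hloc := pauliOp_isLocal hτ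
  rcases L with _ | _ | S
  · rw [show g = ind A from h]
    exact kron_conj_ind A _ (fun i hi => by simp [hτ i hi])
      fun i _ => by rw [Pauli.mat_conjTranspose, Pauli.mat_mul_self]
  · obtain ⟨ψ, hψ, rfl⟩ := h
    exact ⟨_, hloc.dependsOn A subset_rfl ψ hψ, mul_outer_mul _ ψ⟩
  · obtain ⟨ψ, hψ, hs, rfl⟩ := h
    exact ⟨_, hloc.dependsOn A subset_rfl ψ hψ, hs.pauliOp τ, mul_outer_mul _ ψ⟩

theorem pauliX_mulVec (i : Fin N) (ψ : Vec N) (x : Fin N → Fin 2) :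
    (pauliOp (Pi.single i pX) *ᵥ ψ) x = ψ (Function.update x i (x i + 1)) := by
  rw [pauliOp_single, onQubit_mulVec, Pauli.mat_pX, Fin.sum_univ_two]
  have h : ∀ a : Fin 2, a = 0 ∨ a = 1 := by decide
  rcases h (x i) with hx | hx <;> simp [hx, matX]

theorem conj_apply_of_mulVec {U : Op (Fin N)} (c : (Fin N → Fin 2) → ℂ)
    (e : (Fin N → Fin 2) → Fin N → Fin 2) (h : ∀ (ψ : Vec N) x, (U *ᵥ ψ) x = c x * ψ (e x))
    (M : Op (Fin N)) (x y : Fin N → Fin 2) :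
    (U * M * U.conjTranspose) x y = c x * star (c y) * M (e x) (e y) := by
  have h1 : ∀ (M : Op (Fin N)) x y, (U * M) x y = c x * M (e x) y := fun M x y =>
    h (fun z => M z y) x
  have h2 : U * M * U.conjTranspose = (U * (U * M).conjTranspose).conjTranspose := by
    rw [conjTranspose_mul, conjTranspose_conjTranspose]
  rw [h2, conjTranspose_apply, h1, conjTranspose_apply, h1]
  simp only [star_mul', star_star]
  ring

/-- The control is supported on a single bit value, `0` or `1`, so `CX` acts on the other factor as
the identity or as `X` on the target. -/
theorem cx_control_eigenstate {i j : Fin N} (hij : i ≠ j) {φ : Vec N} (hφ : DependsOn φ {i})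
    (hs : Stabilizes (oneGen i pZ) φ) : ∃ τ ∈ (supported {j} : PGroup N), ∀ g : Op (Fin N),
      matCX i j * (outer φ ⊙ g) * (matCX i j).conjTranspose =
        outer φ ⊙ (pauliOp τ * g * (pauliOp τ).conjTranspose) := by
  have h01 : ∀ a : Fin 2, a = 0 ∨ a = 1 := by decide
  have hupd : ∀ (x : Fin N → Fin 2) c, φ (Function.update x j c) = φ x := fun x c =>
    hφ fun k hk => by rw [Set.mem_singleton_iff.1 hk, Function.update_of_ne hij]
  rcases hs _ (single_mem_oneGen i pZ) with h | h
  · refine ⟨0, Submodule.zero_mem _, fun g => ?_⟩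
    ext x y
    rw [matCX_mul_apply i j hij, hadamard_apply, hadamard_apply, outer_apply, outer_apply, hupd,
      hupd, pauliOp_zero, one_mul, conjTranspose_one, mul_one]
    rcases h01 (x i) with hx | hx
    · rcases h01 (y i) with hy | hy
      · rw [hx, hy, add_zero, add_zero, Function.update_eq_self, Function.update_eq_self]
      · rw [eq_zero_of_pauliZ_eq h (x := y) (by rw [hy]; decide)]; simp
    · rw [eq_zero_of_pauliZ_eq h (x := x) (by rw [hx]; decide)]; simp
  · refine ⟨Pi.single j pX, single_mem_supported (Finset.mem_singleton_self j) _, fun g => ?_⟩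
    ext x y
    rw [matCX_mul_apply i j hij, hadamard_apply, hadamard_apply, outer_apply, outer_apply, hupd,
      hupd, conj_apply_of_mulVec (fun _ => 1) (fun x => Function.update x j (x j + 1))
        (fun ψ x => by rw [pauliX_mulVec, one_mul])]
    rcases h01 (x i) with hx | hx
    · rw [eq_zero_of_pauliZ_eq_neg h hx]; simp
    · rcases h01 (y i) with hy | hy
      · rw [eq_zero_of_pauliZ_eq_neg h hy]; simp
      · rw [hx, hy]; simp

/-- Phase kickback: flipping the target multiplies `φ` by a sign, so `CX` acts on the other factor
as the identity or as `Z` on the control. The factor `g` must not see the target qubit. -/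
theorem cx_target_eigenstate {i j : Fin N} (hij : i ≠ j) {φ : Vec N}
    (hs : Stabilizes (oneGen j pX) φ) : ∃ τ ∈ (supported {i} : PGroup N),
      ∀ g : Op (Fin N), (∀ (x y : Fin N → Fin 2) c d,
        g (Function.update x j c) (Function.update y j d) = g x y) →
      matCX i j * (g ⊙ outer φ) * (matCX i j).conjTranspose =
        (pauliOp τ * g * (pauliOp τ).conjTranspose) ⊙ outer φ := by
  have h01 : ∀ a : Fin 2, a = 0 ∨ a = 1 := by decide
  rcases hs _ (single_mem_oneGen j pX) with h | h
  · refine ⟨0, Submodule.zero_mem _, fun g hg => ?_⟩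
    have hupd : ∀ x : Fin N → Fin 2, φ (Function.update x j (x j + x i)) = φ x := by
      intro x
      rcases h01 (x i) with hx | hx
      · rw [hx, add_zero, Function.update_eq_self]
      · have := congrFun h x
        rw [pauliX_mulVec] at this
        rw [hx, this]
    ext x y
    rw [matCX_mul_apply i j hij, hadamard_apply, hadamard_apply, outer_apply, outer_apply, hupd,
      hupd, hg, pauliOp_zero, one_mul, conjTranspose_one, mul_one]
  · refine ⟨Pi.single i pZ, single_mem_supported (Finset.mem_singleton_self i) _, fun g hg => ?_⟩
    have hupd : ∀ x : Fin N → Fin 2, φ (Function.update x j (x j + x i)) =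
        (if x i = 0 then 1 else -1) * φ x := by
      intro x
      rcases h01 (x i) with hx | hx
      · rw [hx, add_zero, Function.update_eq_self]; simp
      · have := congrFun h x
        rw [pauliX_mulVec] at this
        rw [hx, this]; simp
    ext x y
    rw [matCX_mul_apply i j hij, hadamard_apply, hadamard_apply, outer_apply, outer_apply, hupd,
      hupd, hg, conj_apply_of_mulVec (fun x => if x i = 0 then 1 else -1) id
        (fun ψ x => by rw [pauliZ_mulVec]; split_ifs <;> simp)]
    simp only [star_mul', id]
    ring

theorem matCX_conj_ind {i j : Fin N} (hij : i ≠ j) {A : Finset (Fin N)} (hi : i ∈ A)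
    (hj : j ∈ A) : matCX i j * ind A * (matCX i j).conjTranspose = ind A := by
  ext x y
  rw [matCX_mul_apply i j hij, ind_apply, ind_apply]
  have : (∀ k ∈ A, Function.update x j (x j + x i) k = Function.update y j (y j + y i) k) ↔
      ∀ k ∈ A, x k = y k := by
    constructor
    · intro h k hk
      have h1 : x i = y i := by simpa [hij] using h i hi
      by_cases hkj : k = j
      · subst hkj
        simpa [h1] using h k hk
      · simpa [hkj] using h k hk
    · intro h k hk
      by_cases hkj : k = j
      · subst hkj
        simp [h k hk, h i hi]
      · simp [hkj, h k hk]
  by_cases h : ∀ k ∈ A, x k = y k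
  · rw [if_pos h, if_pos (this.2 h)]
  · rw [if_neg h, if_neg (mt this.1 h)]

/-- `CX` acts as an involution on strings, so membership in the new group is pulled back by the same
map. -/
theorem single_mem_of_mem_conjGroup_cx {i j : Fin N} (hij : i ≠ j) {S : PGroup N} {k : Fin N}
    {p : Pauli} (h : Pi.single k p ∈ conjGroup (matCX i j) S) :
    actCX i j hij (Pi.single k p) ∈ S := by
  rw [(matCX_isClifford i j hij).conjGroup_eq] at h
  obtain ⟨σ, hσ, e⟩ := h
  have e' : actCX i j hij σ = Pi.single k p := e
  rw [← e']
  have : actCX i j hij (actCX i j hij σ) = σ := mapCX_involutive i j hij σ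
  rwa [this]

theorem actCX_mem_supported {i j : Fin N} (hij : i ≠ j) {A : Finset (Fin N)} (hi : i ∈ A)
    (hj : j ∈ A) {σ : PString N} (hσ : σ ∈ supported A) : actCX i j hij σ ∈ supported A := by
  intro k hk
  rw [actCX_of_ne, hσ k hk]
  · rintro rfl; exact hk hi
  · rintro rfl; exact hk hj

theorem actCX_single_of_ne {i j : Fin N} (hij : i ≠ j) {k : Fin N} (hi : k ≠ i) (hj : k ≠ j)
    (p : Pauli) : actCX i j hij (Pi.single k p) = Pi.single k p := by
  funext l
  by_cases hli : l = i
  · subst hli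
    rw [actCX_control]
    simp [hi.symm, hj.symm]
  · by_cases hlj : l = j
    · subst hlj
      rw [actCX_target]
      simp [hi.symm, hj.symm]
    · rw [actCX_of_ne i j hij _ hli hlj]

theorem actCX_single_control {i j : Fin N} (hij : i ≠ j) (p : Pauli) :
    actCX i j hij (Pi.single i p) = Pi.single i p + Pi.single j (p.1, 0) := by
  funext l
  by_cases hli : l = i
  · subst hli
    rw [actCX_control]
    simp [hij, hij.symm]
  · by_cases hlj : l = j
    · subst hlj
      rw [actCX_target]
      simp [hli]
    · rw [actCX_of_ne i j hij _ hli hlj]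
      simp [hli, hlj]

theorem actCX_single_target {i j : Fin N} (hij : i ≠ j) (p : Pauli) :
    actCX i j hij (Pi.single j p) = Pi.single i (0, p.2) + Pi.single j p := by
  funext l
  by_cases hli : l = i
  · subst hli
    rw [actCX_control]
    simp [hij]
  · by_cases hlj : l = j
    · subst hlj
      rw [actCX_target]
      simp [hli]
    · rw [actCX_of_ne i j hij _ hli hlj]
      simp [hli, hlj]

theorem cx_same_block_sound {α : PreAssignment N} (hα : IsAssignment α) {i j : Fin N}
    (hij : i ≠ j) (h : (α i).1 = (α j).1) :
    IsAssignment (replace α (updateBlocks [i, j] (α i).1 ((α i).2.conj (matCX i j)))) ∧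
      ∀ M ∈ cone α Finset.univ, matCX i j * M * (matCX i j).conjTranspose ∈
        cone (replace α (updateBlocks [i, j] (α i).1 ((α i).2.conj (matCX i j)))) Finset.univ := by
  have hp := hα.isPartition
  have hU := hp.isUnion_block i
  have hi := hα.mem i
  have hj : j ∈ (α i).1 := h ▸ hα.mem j
  have hsub : ({i, j} : Finset (Fin N)) ⊆ (α i).1 :=
    Finset.insert_subset hi (Finset.singleton_subset_iff.2 hj)
  have hloc := (matCX_isLocal i j hij).mono hsub
  have hcard : 2 ≤ (α i).1.card := (Finset.card_pair hij).symm.le.trans (Finset.card_le_card hsub)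
  have hv := hα.valid i
  have hC := matCX_isClifford i j hij
  rcases hL : (α i).2 with _ | _ | S
  · rw [hL] at hv
    have : (α i).1.card = 1 := hv
    omega
  · exact replace_block_sound hα hU ⟨i, hi⟩ hloc trivial fun K hK =>
      Or.inr ⟨rfl, conj_mem_stabCone hloc (hK.mem_stabCone hp hU)⟩
  · rw [hL] at hv
    have hst := hC.isStab (fun σ hσ => actCX_mem_supported hij hi hj hσ) hv.1
    -- Only `i` and `j` need to be offered for splitting: a one-qubit string elsewhere is fixed by
    -- `CX` and would already lie in the old, valid stabilizer.
    obtain ⟨ht, hv'⟩ := splitStab_tiles [i, j] _ _ hst (fun _ k p hp' hk => by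
      by_contra hn
      simp only [List.mem_cons, List.not_mem_nil, or_false, not_or] at hn
      have := single_mem_of_mem_conjGroup_cx hij hk
      rw [actCX_single_of_ne hij hn.1 hn.2] at this
      exact hv.2 hcard k p hp' this)
    refine replace_sound hα hU hloc ht hv' fun β hβ hbs K hK => ?_
    rw [isProd_block hp, hL] at hK
    obtain ⟨ψ, hψ, hs, rfl⟩ := hK
    rw [mul_outer_mul]
    exact (splitStab_mem_cone _ _ _ hst hβ hbs (hloc.dependsOn _ subset_rfl ψ hψ)
      (hs.conjGroup hC.unitary)).2

theorem block_eq_singleton_of_stab {α : PreAssignment N} (hα : IsAssignment α) {i : Fin N}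
    {p : Pauli} (hp : p ≠ 0) (h : (α i).2 = .stab (oneGen i p)) : (α i).1 = {i} := by
  have hv := hα.valid i
  rw [h] at hv
  have h1 := hv.1.2.2
  rw [(isStab_oneGen i hp).2.2, Finset.card_singleton] at h1
  exact hα.block_eq_singleton h1.symm

theorem disjoint_blocks {α : PreAssignment N} (hα : IsPartition α) {i j : Fin N}
    (h : (α i).1 ≠ (α j).1) : Disjoint (α i).1 (α j).1 := by
  rw [Finset.disjoint_left]
  intro k hk hk'
  apply h
  rw [← hα.eq_of_mem i k hk, hα.eq_of_mem j k hk']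

theorem cx_unchanged_sound {α : PreAssignment N} (hα : IsAssignment α) {i j : Fin N}
    (hij : i ≠ j) (hne : (α i).1 ≠ (α j).1)
    (h : (α i).2 = labelZ i ∨ (α j).2 = labelX j ∨ ((α i).2 = .mixed ∧ (α j).2 = .mixed)) :
    ∀ M ∈ cone α Finset.univ,
      matCX i j * M * (matCX i j).conjTranspose ∈ cone α Finset.univ := by
  have hp := hα.isPartition
  have hUi := hp.isUnion_block i
  have hUj := hp.isUnion_block j
  have hd := disjoint_blocks hp hne
  have hU := hUi.union hUj
  have hsub : ({i, j} : Finset (Fin N)) ⊆ (α i).1 ∪ (α j).1 := Finset.insert_subset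
    (Finset.mem_union_left _ (hα.mem i))
    (Finset.singleton_subset_iff.2 (Finset.mem_union_right _ (hα.mem j)))
  have hloc := (matCX_isLocal i j hij).mono hsub
  intro M hM
  refine conj_mem_cone hp hp hU hU (fun _ _ => rfl) hloc (fun K hK => ?_) hM
  obtain ⟨g, g', hg, hg', rfl⟩ := hK.split hp hUj hd
  rcases h with h | h | ⟨h, h'⟩
  · have hA := block_eq_singleton_of_stab hα pZ_ne_zero h
    have hgr := (isProd_block hp i).1 hg
    rw [h] at hgr
    obtain ⟨φ, hφ, hs, rfl⟩ := hgr
    rw [hA] at hφ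
    obtain ⟨τ, hτ, e⟩ := cx_control_eigenstate hij (by simpa using hφ) hs
    rw [e]
    refine (IsProd.union hp hUj hd hg ?_).mem_cone
    refine (isProd_block hp j).2 (((isProd_block hp j).1 hg').pauli_conj ?_)
    exact supported_mono (Finset.singleton_subset_iff.2 (hα.mem j)) hτ
  · have hgr := (isProd_block hp j).1 hg'
    rw [h] at hgr
    obtain ⟨φ, hφ, hs, rfl⟩ := hgr
    obtain ⟨τ, hτ, e⟩ := cx_target_eigenstate hij hs
    rw [e]
    · refine (IsProd.union hp hUj hd ?_ hg').mem_cone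
      refine (isProd_block hp i).2 (((isProd_block hp i).1 hg).pauli_conj ?_)
      exact supported_mono (Finset.singleton_subset_iff.2 (hα.mem i)) hτ
    · intro x y c d
      have hn : ∀ k ∈ (α i).1, k ≠ j := by
        rintro k hk rfl
        exact Finset.disjoint_left.1 hd hk (hα.mem k)
      exact hg.kernelOn hUi _ _ _ _ (fun k hk => by rw [Function.update_of_ne (hn k hk)])
        fun k hk => by rw [Function.update_of_ne (hn k hk)]
  · have hK' := IsProd.union hp hUj hd hg hg'
    have hm : ∀ k ∈ (α i).1 ∪ (α j).1, (α k).2 = .mixed := by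
      intro k hk
      rcases Finset.mem_union.1 hk with hk | hk
      · rw [hα.eq_of_mem i k hk, h]
      · rw [hα.eq_of_mem j k hk, h']
    have e := hK'.eq_ind hp hU hm
    have := hK'.mem_cone
    rw [e] at this ⊢
    rwa [matCX_conj_ind hij (hsub (by simp)) (hsub (by simp))]

/-- Giving a maximally mixed qubit a definite basis. -/
theorem replace_mixed {α : PreAssignment N} (hα : IsAssignment α) {i : Fin N}
    (h : (α i).2 = .mixed) {p : Pauli} (hp : p ≠ 0) :
    IsAssignment (replace α [((α i).1, .stab (oneGen i p))]) ∧
      cone α Finset.univ ≤ cone (replace α [((α i).1, .stab (oneGen i p))]) Finset.univ := by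
  have ht := tiles_singleton (α i).1 (.stab (oneGen i p))
  have hA := block_of_mixed hα h
  have hβ := ht.isAssignment hα (hα.isPartition.isUnion_block i) (fun b hb => by
    rw [List.mem_singleton] at hb
    subst hb
    rw [hA]
    exact valid_singleton_oneGen i hp)
  refine ⟨hβ, cone_mono hα hβ (assignLE_of_label_le hα hβ (fun k => ?_) fun k => ?_)⟩
  · by_cases hk : k ∈ (α i).1
    · rw [ht.replace_mem α List.mem_cons_self hk, hα.eq_of_mem i k hk]
    · rw [ht.replace_notMem α hk]
  · by_cases hk : k ∈ (α i).1
    · rw [hα.eq_of_mem i k hk]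
      exact Or.inl h
    · rw [ht.replace_notMem α hk]
      exact Label.le_refl _

theorem symp_eq_zero_of_disjoint {A B : Finset (Fin N)} (hAB : Disjoint A B) {σ τ : PString N}
    (hσ : σ ∈ supported A) (hτ : τ ∈ supported B) : symp (Fin N) σ τ = 0 := by
  rw [symp_apply]
  refine Finset.sum_eq_zero fun i _ => ?_
  by_cases hi : i ∈ A
  · rw [hτ i (Finset.disjoint_left.1 hAB hi)]; simp
  · rw [hσ i hi]; simp

theorem supported_inf_disjoint {A B : Finset (Fin N)} (hAB : Disjoint A B) {S T : PGroup N}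
    (hS : S ≤ supported A) (hT : T ≤ supported B) : S ⊓ T = ⊥ := by
  rw [eq_bot_iff]
  rintro σ ⟨hσ, hσ'⟩
  rw [Submodule.mem_bot]
  funext i
  by_cases hi : i ∈ A
  · exact hT hσ' i (Finset.disjoint_left.1 hAB hi)
  · exact hS hσ i hi

theorem IsStab.sup {A B : Finset (Fin N)} (hAB : Disjoint A B) {S T : PGroup N}
    (hS : IsStab A S) (hT : IsStab B T) : IsStab (A ∪ B) (S ⊔ T) := by
  refine ⟨sup_le (hS.1.trans (supported_mono Finset.subset_union_left))
    (hT.1.trans (supported_mono Finset.subset_union_right)), ?_, ?_⟩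
  · intro ρ hρ ρ' hρ'
    obtain ⟨σ, hσ, τ, hτ, rfl⟩ := Submodule.mem_sup.1 hρ
    obtain ⟨σ', hσ', τ', hτ', rfl⟩ := Submodule.mem_sup.1 hρ'
    rw [commute_pauliOp]
    simp [hS.symp_eq_zero hσ hσ', hT.symp_eq_zero hτ hτ',
      symp_eq_zero_of_disjoint hAB (hS.1 hσ) (hT.1 hτ'),
      symp_eq_zero_of_disjoint hAB.symm (hT.1 hτ) (hS.1 hσ')]
  · have := Submodule.finrank_sup_add_finrank_inf_eq S T
    rw [supported_inf_disjoint hAB hS.1 hT.1, finrank_bot, hS.2.2, hT.2.2] at this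
    rw [Finset.card_union_of_disjoint hAB]
    omega

/-- The components of an element of a tensor product of stabilizers. -/
theorem mem_of_add_mem_sup {A B : Finset (Fin N)} (hAB : Disjoint A B) {S T : PGroup N}
    (hS : S ≤ supported A) (hT : T ≤ supported B) {σ τ : PString N} (hσ : σ ∈ supported A)
    (hτ : τ ∈ supported B) (h : σ + τ ∈ S ⊔ T) : σ ∈ S ∧ τ ∈ T := by
  obtain ⟨σ', hσ', τ', hτ', e⟩ := Submodule.mem_sup.1 h
  have hd : σ' - σ = τ - τ' := by rw [sub_eq_sub_iff_add_eq_add, e, add_comm]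
  have h1 : σ' - σ ∈ (supported A : PGroup N) ⊓ supported B :=
    ⟨Submodule.sub_mem _ (hS hσ') hσ, hd ▸ Submodule.sub_mem _ hτ (hT hτ')⟩
  rw [supported_inf_disjoint hAB le_rfl le_rfl, Submodule.mem_bot] at h1
  rw [h1] at hd
  rw [← sub_eq_zero.1 h1, sub_eq_zero.1 hd.symm]
  exact ⟨hσ', hτ'⟩

/-- A block that contains a one-qubit operator of its stabilizer is a single qubit. -/
theorem label_eq_of_single_mem {α : PreAssignment N} (hα : IsAssignment α) {i k : Fin N}
    {S : PGroup N} (hL : (α i).2 = .stab S) {p : Pauli} (hp : p ≠ 0) (h : Pi.single k p ∈ S) :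
    k = i ∧ S = oneGen i p := by
  have hv := hα.valid i
  rw [hL] at hv
  have hk := mem_of_single_mem_supported hp (hv.1.1 h)
  by_cases hc : (α i).1.card = 1
  · have hA := hα.block_eq_singleton hc
    rw [hA, Finset.mem_singleton] at hk
    subst hk
    refine ⟨rfl, ?_⟩
    rw [← (hv.1.split_of_single_mem hp h).1, left_eq_inf, ← hA]
    exact hv.1.1
  · exact absurd h (hv.2 (hα.two_le_card hc) k p hp)

/-- The merged group has no one-qubit element. Pulled back through `CX`, an element on `i` is either
`Z` there or carries an `X` on `j`; one on `j` is either `X` there or carries a `Z` on `i`. Its two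
components belong to the two old groups, so one of these would be `⟨Z⟩` on `i` or `⟨X⟩` on `j`,
cases treated before. -/
theorem cx_merge_sound {α : PreAssignment N} (hα : IsAssignment α) {i j : Fin N}
    (hij : i ≠ j) (hne : (α i).1 ≠ (α j).1) (hZ : (α i).2 ≠ labelZ i) (hX : (α j).2 ≠ labelX j)
    (hi : (α i).2 ≠ .mixed) (hj : (α j).2 ≠ .mixed) :
    IsAssignment (replace α [((α i).1 ∪ (α j).1, ((α i).2.tensor (α j).2).conj (matCX i j))]) ∧
      ∀ M ∈ cone α Finset.univ, matCX i j * M * (matCX i j).conjTranspose ∈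
        cone (replace α [((α i).1 ∪ (α j).1, ((α i).2.tensor (α j).2).conj (matCX i j))])
          Finset.univ := by
  have hp := hα.isPartition
  have hUi := hp.isUnion_block i
  have hUj := hp.isUnion_block j
  have hd := disjoint_blocks hp hne
  have hU := hUi.union hUj
  have hiX : i ∈ (α i).1 ∪ (α j).1 := Finset.mem_union_left _ (hα.mem i)
  have hjX : j ∈ (α i).1 ∪ (α j).1 := Finset.mem_union_right _ (hα.mem j)
  have hloc := (matCX_isLocal i j hij).mono
    (Finset.insert_subset hiX (Finset.singleton_subset_iff.2 hjX))
  have hC := matCX_isClifford i j hij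
  have hbox : IsAssignment (replace α [((α i).1 ∪ (α j).1, .box)]) ∧
      ∀ M ∈ cone α Finset.univ, matCX i j * M * (matCX i j).conjTranspose ∈
        cone (replace α [((α i).1 ∪ (α j).1, .box)]) Finset.univ :=
    replace_block_sound hα hU ⟨i, hiX⟩ hloc trivial fun K hK =>
      Or.inr ⟨rfl, conj_mem_stabCone hloc (hK.mem_stabCone hp hU)⟩
  have hvi := hα.valid i
  have hvj := hα.valid j
  rcases hLi : (α i).2 with _ | _ | S
  · exact absurd hLi hi
  · exact hbox
  · rcases hLj : (α j).2 with _ | _ | T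
    · exact absurd hLj hj
    · exact hbox
    · rw [hLi] at hvi hZ
      rw [hLj] at hvj hX
      have hst := IsStab.sup hd hvi.1 hvj.1
      refine replace_block_sound hα hU ⟨i, hiX⟩ hloc ⟨?_, ?_⟩ fun K hK => Or.inl ?_
      · exact hC.isStab (fun σ hσ => actCX_mem_supported hij hiX hjX hσ) hst
      · intro _ k p hp' hk
        have hk' := single_mem_of_mem_conjGroup_cx hij hk
        have hsi : ∀ q, (Pi.single i q : PString N) ∈ supported (α i).1 :=
          single_mem_supported (hα.mem i)
        have hsj : ∀ q, (Pi.single j q : PString N) ∈ supported (α j).1 :=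
          single_mem_supported (hα.mem j)
        by_cases hki : k = i
        · subst hki
          rw [actCX_single_control] at hk'
          obtain ⟨h1, h2⟩ := mem_of_add_mem_sup hd hvi.1.1 hvj.1.1 (hsi _) (hsj _) hk'
          by_cases hp1 : p.1 = 0
          · have hpZ : p = pZ := by
              have : ∀ p : Pauli, p ≠ 0 → p.1 = 0 → p = pZ := by decide
              exact this p hp' hp1
            subst hpZ
            exact hZ (congrArg Label.stab (label_eq_of_single_mem hα hLi hp' h1).2)
          · have hpX : ((p.1, 0) : Pauli) = pX := by
              have : ∀ a : ZMod 2, a ≠ 0 → ((a, 0) : Pauli) = pX := by decide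
              exact this _ hp1
            rw [hpX] at h2
            exact hX (congrArg Label.stab (label_eq_of_single_mem hα hLj pX_ne_zero h2).2)
        · by_cases hkj : k = j
          · subst hkj
            rw [actCX_single_target] at hk'
            obtain ⟨h1, h2⟩ := mem_of_add_mem_sup hd hvi.1.1 hvj.1.1 (hsi _) (hsj _) hk'
            by_cases hp2 : p.2 = 0
            · have hpX : p = pX := by
                have : ∀ p : Pauli, p ≠ 0 → p.2 = 0 → p = pX := by decide
                exact this p hp' hp2
              subst hpX
              exact hX (congrArg Label.stab (label_eq_of_single_mem hα hLj hp' h2).2)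
            · have hpZ : ((0, p.2) : Pauli) = pZ := by
                have : ∀ a : ZMod 2, a ≠ 0 → ((0, a) : Pauli) = pZ := by decide
                exact this _ hp2
              rw [hpZ] at h1
              exact hZ (congrArg Label.stab (label_eq_of_single_mem hα hLi pZ_ne_zero h1).2)
          · rw [actCX_single_of_ne hij hki hkj] at hk'
            -- A string on a third qubit is fixed by `CX`; a one-qubit element forces its old block
            -- to be a single qubit, namely `i` or `j`.
            rcases Finset.mem_union.1 (mem_of_single_mem_supported hp' (hst.1 hk')) with hkA | hkB
            · have h1 : (Pi.single k p : PString N) + 0 ∈ S ⊔ T := by rwa [add_zero]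
              have h2 := (mem_of_add_mem_sup hd hvi.1.1 hvj.1.1 (single_mem_supported hkA p)
                (Submodule.zero_mem _) h1).1
              exact hki (label_eq_of_single_mem hα hLi hp' h2).1
            · have h1 : 0 + (Pi.single k p : PString N) ∈ S ⊔ T := by rwa [zero_add]
              have h2 := (mem_of_add_mem_sup hd hvi.1.1 hvj.1.1 (Submodule.zero_mem _)
                (single_mem_supported hkB p) h1).2
              exact hkj (label_eq_of_single_mem hα hLj hp' h2).1
      · obtain ⟨g, g', hg, hg', rfl⟩ := hK.split hp hUj hd
        rw [isProd_block hp, hLi] at hg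
        rw [isProd_block hp, hLj] at hg'
        obtain ⟨ψ, hψ, hs, rfl⟩ := hg
        obtain ⟨φ, hφ, hs', rfl⟩ := hg'
        rw [← outer_mul, mul_outer_mul]
        refine ⟨_, hloc.dependsOn _ subset_rfl _ ?_, Stabilizes.conjGroup ?_ hC.unitary, rfl⟩
        · intro x y hxy
          rw [Pi.mul_apply, Pi.mul_apply, hψ fun k hk => hxy k (by simp_all),
            hφ fun k hk => hxy k (by simp_all)]
        · refine Stabilizes.sup (hs.mul hvi.1.1 (hφ.mono fun k hk => ?_)) ?_
          · exact fun hk' => Finset.disjoint_left.1 hd hk' hk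
          · rw [mul_comm]
            refine hs'.mul hvj.1.1 (hψ.mono fun k hk => ?_)
            exact fun hk' => Finset.disjoint_left.1 hd hk hk'

theorem cx_sound {α : PreAssignment N} (hα : IsAssignment α) (i j : Fin N) (hij : i ≠ j) :
    IsAssignment ((QIL.cx i j hij).asem α) ∧ ∀ M ∈ cone α Finset.univ,
      matCX i j * M * (matCX i j).conjTranspose ∈
        cone ((QIL.cx i j hij).asem α) Finset.univ := by
  rw [QIL.asem]
  split_ifs with h1 h2 h3 h4
  · exact cx_same_block_sound hα hij h1
  · exact ⟨hα, cx_unchanged_sound hα hij h1 h2⟩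
  -- A mixed control may be weakened to `⟨Z⟩`, after which `CX` changes nothing; a mixed target is
  -- handled likewise with `⟨X⟩`.
  · obtain ⟨hβ, hle⟩ := replace_mixed hα h3 pZ_ne_zero
    have ht := tiles_singleton (α i).1 (labelZ i)
    have ei := ht.replace_mem α List.mem_cons_self (hα.mem i)
    have ej := ht.replace_notMem α (j := j) fun hj =>
      Finset.disjoint_left.1 (disjoint_blocks hα.isPartition h1) hj (hα.mem j)
    refine ⟨hβ, fun M hM => cx_unchanged_sound hβ hij ?_ (Or.inl ?_) M (hle hM)⟩
    · change (replace α [((α i).1, labelZ i)] i).1 ≠ (replace α [((α i).1, labelZ i)] j).1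
      rwa [ei, ej]
    · change (replace α [((α i).1, labelZ i)] i).2 = _
      rw [ei]
  · obtain ⟨hβ, hle⟩ := replace_mixed hα h4 pX_ne_zero
    have ht := tiles_singleton (α j).1 (labelX j)
    have ej := ht.replace_mem α List.mem_cons_self (hα.mem j)
    have ei := ht.replace_notMem α (j := i) fun hi =>
      Finset.disjoint_left.1 (disjoint_blocks hα.isPartition h1) (hα.mem i) hi
    refine ⟨hβ, fun M hM => cx_unchanged_sound hβ hij ?_ (Or.inr (Or.inl ?_)) M (hle hM)⟩
    · change (replace α [((α j).1, labelX j)] i).1 ≠ (replace α [((α j).1, labelX j)] j).1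
      rwa [ei, ej]
    · change (replace α [((α j).1, labelX j)] j).2 = _
      rw [ej]
  · push Not at h2
    exact cx_merge_sound hα hij h1 h2.1 h2.2.1 h3 h4

/-! ## Satisfaction in terms of cones -/

/-- A matrix on the qubits in `A` as a kernel on all qubits. -/
def pull (A : Finset (Fin N)) (r : Op A) : Op (Fin N) :=
  of fun x y => r (fun i => x i) (fun i => y i)

/-- A vector on the qubits in `A` as a function of all qubits. -/
def pullVec (A : Finset (Fin N)) (v : (A → Fin 2) → ℂ) : Vec N := fun x => v fun i => x i

/-- Extension of a bit string on `A`. -/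
def extend (A : Finset (Fin N)) (x : Fin N → Fin 2) (u : A → Fin 2) : Fin N → Fin 2 :=
  fun i => if h : i ∈ A then u ⟨i, h⟩ else x i

theorem extend_restrict (A : Finset (Fin N)) (x : Fin N → Fin 2) (u : A → Fin 2) :
    (fun i : A => extend A x u i) = u := by
  funext i
  simp [extend]

theorem pullVec_dependsOn (A : Finset (Fin N)) (v : (A → Fin 2) → ℂ) :
    DependsOn (pullVec A v) (A : Set (Fin N)) := by
  intro x y hxy
  exact congrArg v (funext fun i => hxy i i.2)

theorem pullVec_injective (A : Finset (Fin N)) : Function.Injective (pullVec A) := by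
  intro v w h
  funext u
  have := congrFun h (extend A 0 u)
  rwa [pullVec, pullVec, extend_restrict] at this

theorem exists_pullVec {A : Finset (Fin N)} {ψ : Vec N} (h : DependsOn ψ (A : Set (Fin N))) :
    ∃ v, ψ = pullVec A v := by
  refine ⟨fun u => ψ (extend A 0 u), funext fun x => h fun i hi => ?_⟩
  rw [extend, dif_pos (Finset.mem_coe.1 hi)]

theorem pull_vecMulVec (A : Finset (Fin N)) (v : (A → Fin 2) → ℂ) :
    pull A (vecMulVec v (star v)) = outer (pullVec A v) := rfl

theorem pauliOp_mulVec_pullVec {A : Finset (Fin N)} {σ : PString N} (hσ : σ ∈ supported A)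
    (v : (A → Fin 2) → ℂ) : pauliOp σ *ᵥ pullVec A v = pullVec A (pauliOn A σ *ᵥ v) := by
  funext x
  rw [pullVec]
  simp only [mulVec, dotProduct]
  symm
  -- Off `A` the matrix is the identity, so only bit strings that agree with `x` off `A` contribute.
  refine Fintype.sum_of_injective (extend A x) ?_ _ _ ?_ ?_
  · intro u u' h
    rw [← extend_restrict A x u, h, extend_restrict]
  · intro y hy
    have : ∃ i, i ∉ A ∧ x i ≠ y i := by
      by_contra! hc
      refine hy ⟨fun i => y i, funext fun i => ?_⟩
      rw [extend]
      split_ifs with hi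
      · rfl
      · exact hc i hi
    obtain ⟨i, hi, hne⟩ := this
    have h0 : pauliOp σ x y = 0 := by
      simp only [pauliOp, kron, of_apply]
      refine Finset.prod_eq_zero (Finset.mem_univ i) ?_
      rw [hσ i hi, Pauli.mat_zero, one_apply_ne hne]
    rw [h0, zero_mul]
  · intro u
    rw [pullVec, extend_restrict]
    congr 1
    simp only [pauliOn, pauliOp, kron, of_apply]
    rw [← Finset.prod_subset (Finset.subset_univ A), ← Finset.prod_coe_sort A]
    · exact Finset.prod_congr rfl fun i _ => by rw [extend, dif_pos i.2]
    · intro i _ hi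
      rw [hσ i hi, Pauli.mat_zero, extend, dif_neg hi, one_apply_eq]

theorem stabilizes_pullVec {A : Finset (Fin N)} {S : PGroup N} (hS : S ≤ supported A)
    (v : (A → Fin 2) → ℂ) : Stabilizes S (pullVec A v) ↔
      ∀ σ ∈ S, pauliOn A σ *ᵥ v = v ∨ pauliOn A σ *ᵥ v = -v := by
  refine forall₂_congr fun σ hσ => ?_
  rw [pauliOp_mulVec_pullVec (hS hσ)]
  exact or_congr (pullVec_injective A).eq_iff ((pullVec_injective A).eq_iff (b := -v))

/-- The product over the blocks of `α` that meet `X`. -/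
def blockProd (α : PreAssignment N) (X : Finset (Fin N)) (g : Finset (Fin N) → Op (Fin N)) :
    Op (Fin N) := of fun x y => ∏ A ∈ X.image (fun i => (α i).1), g A x y

theorem blockProd_mem_cone {α : PreAssignment N} (h : IsPartition α)
    {g : Finset (Fin N) → Op (Fin N)} (hg : ∀ i, g (α i).1 ∈ cone α (α i).1) :
    blockProd α Finset.univ g ∈ cone α Finset.univ := by
  refine h.union_induction (P := fun X => blockProd α X g ∈ cone α X) ?_ ?_ _ (isUnion_univ α)
  · exact (isProd_empty.2 (by ext x y; simp [blockProd])).mem_cone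
  · intro i X hX hd ih
    have e : blockProd α ((α i).1 ∪ X) g = g (α i).1 ⊙ blockProd α X g := by
      ext x y
      simp only [blockProd, hadamard_apply, of_apply]
      rw [Finset.image_union, Finset.prod_union (image_disjoint h hX hd)]
      congr 1
      rw [show (α i).1.image (fun j => (α j).1) = {(α i).1} from ?_, Finset.prod_singleton]
      refine Finset.eq_singleton_iff_unique_mem.2 ⟨Finset.mem_image_of_mem _ (h.mem i), ?_⟩
      intro A hA
      obtain ⟨j, hj, rfl⟩ := Finset.mem_image.1 hA
      rw [h.eq_of_mem i j hj]
    rw [e]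
    exact cone_union h hX hd (hg i) ih

theorem pull_one (A : Finset (Fin N)) : pull A 1 = ind A := by
  ext x y
  simp only [pull, of_apply, one_apply, ind_apply, funext_iff, Subtype.forall]

theorem pull_posSemidef {A : Finset (Fin N)} {r : Op A} (h : r.PosSemidef) :
    pull A r ∈ stabCone A ∅ := by
  obtain ⟨m, B, rfl⟩ := posSemidef_iff_eq_sum_vecMulVec.1 h
  have e : pull A (∑ k, vecMulVec (B k) (star (B k))) = ∑ k, outer (pullVec A (B k)) := by
    ext x y
    simp only [pull, of_apply, Matrix.sum_apply]
    rfl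
  rw [e]
  exact Submodule.sum_mem _ fun k _ =>
    Submodule.subset_span ⟨_, pullVec_dependsOn A _, fun _ h => h.elim, rfl⟩

/-- The bound on the weights is dropped here; it is recovered from the trace in `sat_of_mem_cone`.
-/
theorem Sat.mem_cone {α : PreAssignment N} (hα : IsAssignment α) {ρ : Op (Fin N)}
    (h : Sat α ρ) : ρ ∈ cone α Finset.univ := by
  have hp := hα.isPartition
  obtain ⟨m, p, r, hp0, -, hr, rfl⟩ := h
  refine Submodule.sum_mem _ fun k _ => ?_
  have e : ((p k : ℂ) • blockTensor α (r k)) = (⟨p k, hp0 k⟩ : ℝ≥0) • blockTensor α (r k) := by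
    ext x y
    exact (Complex.real_smul (x := p k)).symm
  rw [e]
  refine Submodule.smul_mem _ _ (blockProd_mem_cone hp fun i => ?_)
  change pull (α i).1 (r k (α i).1) ∈ _
  have hi := hr k i
  have hv := hα.valid i
  rcases hL : (α i).2 with _ | _ | S
  · rw [hL] at hi
    have e1 : pull (α i).1 (r k (α i).1) = (2⁻¹ : ℝ≥0) • ind (α i).1 := by
      rw [← pull_one, show r k (α i).1 = (1 / 2 : ℂ) • (1 : Op (α i).1) from hi]
      ext x y
      simp [pull, NNReal.smul_def]
    rw [e1]
    exact Submodule.smul_mem _ _ (ind_mem_cone hα i)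
  · rw [hL] at hi
    rw [cone_block_box hp hL]
    exact pull_posSemidef hi.1
  · rw [hL] at hi hv
    rw [cone_block_stab hp hL]
    obtain ⟨ψ, -, hs, e1⟩ := hi
    refine Submodule.subset_span ⟨pullVec _ ψ, pullVec_dependsOn _ ψ, ?_, ?_⟩
    · exact (stabilizes_pullVec hv.1.1 ψ).2 hs
    · simp only [e1]
      exact pull_vecMulVec _ _

/-- Normalisation of a nonzero vector. -/
theorem exists_normalize {A : Finset (Fin N)} (v : (A → Fin 2) → ℂ) (hv : v ≠ 0) :
    ∃ (a : ℂ) (c : ℝ≥0), ∑ u, ‖(a • v) u‖ ^ 2 = 1 ∧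
      outer (pullVec A v) = c • pull A (vecMulVec (a • v) (star (a • v))) := by
  have hn : 0 < ∑ u, ‖v u‖ ^ 2 := by
    obtain ⟨u, hu⟩ := Function.ne_iff.1 hv
    exact Finset.sum_pos' (fun u _ => by positivity)
      ⟨u, Finset.mem_univ u, by have : v u ≠ 0 := hu; positivity⟩
  set n := ∑ u, ‖v u‖ ^ 2 with hn'
  refine ⟨((Real.sqrt n)⁻¹ : ℝ), ⟨n, hn.le⟩, ?_, ?_⟩
  · simp only [Pi.smul_apply, smul_eq_mul, norm_mul, mul_pow, ← Finset.mul_sum, ← hn']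
    rw [Complex.norm_real, Real.norm_of_nonneg (by positivity), inv_pow, Real.sq_sqrt hn.le,
      inv_mul_cancel₀ hn.ne']
  · rw [pull_vecMulVec]
    have e : pullVec A ((((Real.sqrt n)⁻¹ : ℝ) : ℂ) • v) =
        (((Real.sqrt n)⁻¹ : ℝ) : ℂ) • pullVec A v := rfl
    have e2 : (((Real.sqrt n)⁻¹ : ℝ) : ℂ) * star (((Real.sqrt n)⁻¹ : ℝ) : ℂ) = ((n⁻¹ : ℝ) : ℂ) := by
      rw [Complex.star_def, Complex.conj_ofReal, ← Complex.ofReal_mul, ← mul_inv,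
        Real.mul_self_sqrt hn.le]
    rw [e, outer_smul, e2]
    ext x y
    change _ = (n : ℝ) • (((n⁻¹ : ℝ) : ℂ) * _)
    rw [Complex.real_smul, ← mul_assoc, ← Complex.ofReal_mul, mul_inv_cancel₀ hn.ne',
      Complex.ofReal_one, one_mul]

/-- Rays allow the zero vector, which arises from impossible outcomes and cannot be normalised; it
is kept as a separate case. -/
theorem Label.IsRay.eq_smul_pull {A : Finset (Fin N)} {g : Op (Fin N)} {L : Label N}
    (hv : L.Valid A) (h : L.IsRay A g) :
    g = 0 ∨ ∃ (c : ℝ≥0) (r : Op A), L.IsState A r ∧ g = c • pull A r := by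
  have h0 : ∀ v : (A → Fin 2) → ℂ, v = 0 → outer (pullVec A v) = 0 := by
    rintro v rfl
    ext x y
    simp [outer_apply, pullVec]
  rcases L with _ | _ | S
  · refine Or.inr ⟨2, (1 / 2 : ℂ) • 1, rfl, ?_⟩
    rw [show g = ind A from h, ← pull_one]
    ext x y
    simp [pull, NNReal.smul_def]
  · obtain ⟨ψ, hψ, rfl⟩ := h
    obtain ⟨v, rfl⟩ := exists_pullVec hψ
    by_cases hv0 : v = 0
    · exact Or.inl (h0 v hv0)
    · obtain ⟨a, c, h1, h2⟩ := exists_normalize v hv0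
      refine Or.inr ⟨c, _, ⟨posSemidef_vecMulVec_self_star _, ?_⟩, h2⟩
      rw [trace_vecMulVec, dotProduct, ← Complex.ofReal_one, ← h1, Complex.ofReal_sum]
      exact Finset.sum_congr rfl fun u _ => by
        rw [Pi.star_apply, Complex.star_def, Complex.mul_conj', Complex.ofReal_pow]
  · obtain ⟨ψ, hψ, hs, rfl⟩ := h
    obtain ⟨v, rfl⟩ := exists_pullVec hψ
    by_cases hv0 : v = 0
    · exact Or.inl (h0 v hv0)
    · obtain ⟨a, c, h1, h2⟩ := exists_normalize v hv0
      exact Or.inr ⟨c, _, ⟨_, h1, (stabilizes_pullVec hv.1.1 _).1 (hs.smul a), rfl⟩, h2⟩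

theorem trace_eq_one {A : Finset (Fin N)} {r : Op A} {L : Label N} (hv : L.Valid A)
    (h : L.IsState A r) : r.trace = 1 := by
  rcases L with _ | _ | S
  · rw [show r = (1 / 2 : ℂ) • (1 : Op A) from h, trace_smul, trace_one]
    have : A.card = 1 := hv
    simp [this]
  · exact h.2
  · obtain ⟨ψ, h1, -, rfl⟩ := h
    rw [trace_vecMulVec, dotProduct, ← Complex.ofReal_one, ← h1, Complex.ofReal_sum]
    exact Finset.sum_congr rfl fun u _ => by
      rw [Pi.star_apply, Complex.star_def, Complex.mul_conj', Complex.ofReal_pow]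

/-- Restriction to the blocks is a bijection from bit strings on all qubits to families of bit
strings on the blocks, so the sum over the diagonal factorises. -/
theorem trace_blockTensor {α : PreAssignment N} (h : IsPartition α)
    (r : (A : Finset (Fin N)) → Op A) :
    (blockTensor α r).trace = ∏ A ∈ Finset.univ.image (fun i => (α i).1), (r A).trace := by
  rw [← Finset.prod_coe_sort]
  simp only [trace, diag_apply]
  rw [Finset.prod_univ_sum, Fintype.piFinset_univ]
  refine Fintype.sum_bijective
    (fun (x : Fin N → Fin 2) (A : Finset.univ.image fun i => (α i).1) (i : A.1) => x i) ⟨?_, ?_⟩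
    _ _ fun x => ?_
  · intro x y hxy
    funext i
    exact congrFun (congrFun hxy ⟨(α i).1, Finset.mem_image_of_mem _ (Finset.mem_univ i)⟩)
      ⟨i, h.mem i⟩
  · intro u
    refine ⟨fun i => u ⟨(α i).1, Finset.mem_image_of_mem _ (Finset.mem_univ i)⟩ ⟨i, h.mem i⟩, ?_⟩
    funext ⟨A, hA⟩ ⟨k, hk⟩
    have key : ∀ (B : Finset (Fin N)) (hB : B ∈ Finset.univ.image fun i => (α i).1) (hkB : k ∈ B),
        B = A → u ⟨B, hB⟩ ⟨k, hkB⟩ = u ⟨A, hA⟩ ⟨k, hk⟩ := by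
      rintro B hB hkB rfl; rfl
    refine key _ _ _ ?_
    obtain ⟨j, -, rfl⟩ := Finset.mem_image.1 hA
    rw [h.eq_of_mem j k hk]
  · rw [blockTensor, of_apply, ← Finset.prod_coe_sort]

theorem IsProd.mem_span_blockTensor {α : PreAssignment N} (hα : IsAssignment α)
    {M : Op (Fin N)} (hM : IsProd α Finset.univ M) :
    M ∈ Submodule.span ℝ≥0 {M | ∃ r : (A : Finset (Fin N)) → Op A,
      (∀ i, (α i).2.IsState (α i).1 (r (α i).1)) ∧ M = blockTensor α r} := by
  obtain ⟨g, hg, rfl⟩ := hM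
  by_cases h0 : ∃ i, g (α i).1 = 0
  · obtain ⟨i, hi⟩ := h0
    convert Submodule.zero_mem _
    ext x y
    rw [of_apply, Matrix.zero_apply]
    exact Finset.prod_eq_zero (Finset.mem_image_of_mem _ (Finset.mem_univ i)) (by rw [hi]; rfl)
  · push Not at h0
    -- The choice is indexed by the set rather than by a qubit, so that all qubits of a block
    -- receive the same state; sets that are not blocks get a dummy value.
    have h1 : ∀ A : Finset (Fin N), ∃ (c : ℝ≥0) (r : Op A), ∀ i, (α i).1 = A →
        (α i).2.IsState A r ∧ g A = c • pull A r := by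
      intro A
      by_cases hA : ∃ i, (α i).1 = A
      · obtain ⟨i, rfl⟩ := hA
        rcases (hg i (Finset.mem_univ i)).eq_smul_pull (hα.valid i) with h | ⟨c, r, h, h'⟩
        · exact absurd h (h0 i)
        · refine ⟨c, r, fun j hj => ⟨?_, h'⟩⟩
          rwa [hα.eq_of_mem i j (hj ▸ hα.mem j)]
      · exact ⟨0, 0, fun i hi => absurd ⟨i, hi⟩ hA⟩
    choose c r hr using h1
    have e : (of fun x y => ∏ A ∈ Finset.univ.image (fun i => (α i).1), g A x y : Op (Fin N)) =
        (∏ A ∈ Finset.univ.image (fun i => (α i).1), c A) • blockTensor α r := by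
      ext x y
      rw [Matrix.smul_apply, of_apply, blockTensor, of_apply, NNReal.smul_def, Complex.real_smul,
        NNReal.coe_prod, Complex.ofReal_prod, ← Finset.prod_mul_distrib]
      refine Finset.prod_congr rfl fun A hA => ?_
      obtain ⟨i, -, hi⟩ := Finset.mem_image.1 hA
      rw [(hr A i hi).2, Matrix.smul_apply, NNReal.smul_def, Complex.real_smul]
      rfl
    rw [e]
    exact Submodule.smul_mem _ _ (Submodule.subset_span ⟨r, fun i => (hr _ i rfl).1, rfl⟩)

/-- Each generator is a nonnegative combination of block tensors of trace one, so the weights add up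
to the trace of `ρ`. -/
theorem sat_of_mem_cone {α : PreAssignment N} (hα : IsAssignment α) {ρ : Op (Fin N)}
    (hρ : ρ ∈ cone α Finset.univ) (htr : ρ.trace.re ≤ 1) : Sat α ρ := by
  have h : ρ ∈ Submodule.span ℝ≥0 {M | ∃ r : (A : Finset (Fin N)) → Op A,
      (∀ i, (α i).2.IsState (α i).1 (r (α i).1)) ∧ M = blockTensor α r} :=
    Submodule.span_le.2 (fun _ hM => IsProd.mem_span_blockTensor hα hM) hρ
  obtain ⟨m, p, M, rfl⟩ := Submodule.mem_span_set'.1 h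
  choose r hr hM using fun k => (M k).2
  have e : ∑ k, p k • (M k : Op (Fin N)) = ∑ k, (((p k : ℝ) : ℂ)) • blockTensor α (r k) := by
    refine Finset.sum_congr rfl fun k _ => ?_
    rw [hM k]
    ext x y
    exact Complex.real_smul
  refine ⟨m, fun k => p k, r, fun k => (p k).2, ?_, hr, e⟩
  have ht : ∀ k, (blockTensor α (r k)).trace = 1 := by
    intro k
    rw [trace_blockTensor hα.isPartition]
    refine Finset.prod_eq_one fun A hA => ?_
    obtain ⟨i, -, rfl⟩ := Finset.mem_image.1 hA
    exact trace_eq_one (hα.valid i) (hr k i)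
  rw [e, trace_sum] at htr
  simpa [trace_smul, ht] using htr

/-! ## Soundness -/

theorem join_sound {κ : Type} [Nonempty κ] {F : κ → PreAssignment N}
    (hF : ∀ n, IsAssignment (F n)) (n : κ) :
    cone (F n) Finset.univ ≤ cone (assignJoin F) Finset.univ :=
  cone_mono (hF n) (assignJoin_isLUB F hF).1 ((assignJoin_isLUB F hF).2.1 n)

/-- Induction on the program in terms of cones. Positivity is carried along because it gives the
convergence of the loop series. -/
theorem asem_sound (C : QIL N) (α : PreAssignment N) (hα : IsAssignment α) :
    IsAssignment (C.asem α) ∧ ∀ ρ : Op (Fin N), ρ.PosSemidef → ρ ∈ cone α Finset.univ →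
      C.sem ρ ∈ cone (C.asem α) Finset.univ := by
  induction C generalizing α with
  | skip => exact ⟨hα, fun _ _ h => h⟩
  | seq C C' ih ih' =>
    obtain ⟨h1, h2⟩ := ih α hα
    obtain ⟨h3, h4⟩ := ih' _ h1
    exact ⟨h3, fun ρ hρ h => h4 _ (C.sem_posSemidef ρ hρ).1 (h2 ρ hρ h)⟩
  | gate U i =>
    obtain ⟨h1, h2⟩ := gate_sound hα U i
    exact ⟨h1, fun ρ _ h => h2 ρ h⟩
  | gateT i =>
    obtain ⟨h1, h2⟩ := gateT_sound hα i
    exact ⟨h1, fun ρ _ h => h2 ρ h⟩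
  | cx i j hij =>
    obtain ⟨h1, h2⟩ := cx_sound hα i j hij
    exact ⟨h1, fun ρ _ h => h2 ρ h⟩
  | ifte i C C' ih ih' =>
    obtain ⟨hm, hs⟩ := meas_sound hα i
    obtain ⟨h1, h2⟩ := ih _ hm
    obtain ⟨h3, h4⟩ := ih' _ hm
    have hF : ∀ b : Bool, IsAssignment
        (if b then C.asem (meas i α) else C'.asem (meas i α)) := by
      rintro (_ | _)
      · exact h3
      · exact h1
    refine ⟨(assignJoin_isLUB _ hF).1, fun ρ hρ h => Submodule.add_mem _ ?_ ?_⟩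
    · exact join_sound hF true (h2 _ (proj_posSemidef 0 i hρ) (hs 0 ρ h))
    · exact join_sound hF false (h4 _ (proj_posSemidef 1 i hρ) (hs 1 ρ h))
  | loop i C ih =>
    set F : ℕ → PreAssignment N := fun n => (fun β => C.asem (meas i β))^[n] α with hFdef
    have hF : ∀ n, IsAssignment (F n) := by
      intro n
      induction n with
      | zero => exact hα
      | succ n hn =>
        simp only [hFdef, Function.iterate_succ_apply'] at hn ⊢
        exact (ih _ (meas_sound hn i).1).1
    have hmF : ∀ n, IsAssignment (meas i (F n)) := fun n => (meas_sound (hF n) i).1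
    refine ⟨(assignJoin_isLUB _ hmF).1, fun ρ hρ h => ?_⟩
    -- The `n`-th concrete iterate lies in the cone of the `n`-th abstract iterate, by the
    -- outcome-`0` half of the measurement lemma and the hypothesis on the body.
    have hiter : ∀ n, ((fun σ => C.sem (proj 0 i * σ * proj 0 i))^[n] ρ).PosSemidef ∧
        (fun σ => C.sem (proj 0 i * σ * proj 0 i))^[n] ρ ∈ cone (F n) Finset.univ := by
      intro n
      induction n with
      | zero => exact ⟨hρ, h⟩
      | succ n hn =>
        have hms := meas_sound (hF n) i
        have hp := proj_posSemidef 0 i hn.1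
        simp only [hFdef, Function.iterate_succ_apply'] at hn hms hp ⊢
        exact ⟨(C.sem_posSemidef _ hp).1, (ih _ hms.1).2 _ hp (hms.2 0 _ hn.2)⟩
    -- Every summand, an exit on outcome `1`, lies in the cone of one member of the join, hence in
    -- that of the join, and so does the convergent sum.
    refine mem_of_hasSum_of_forall_mem (cone _ Finset.univ)
      (QIL.summable_loop i C ρ hρ).hasSum fun n => ?_
    exact join_sound hmF n ((meas_sound (hF n) i).2 1 _ (hiter n).2)

end QStab

theorem mainTheorem1 {N : ℕ} (ρ : QStab.Op (Fin N)) (hρ : QStab.IsPartialDensity ρ)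
    (α : QStab.PreAssignment N) (hα : QStab.IsAssignment α) (C : QStab.QIL N) :
    QStab.IsAssignment (C.asem α) ∧ (QStab.Sat α ρ → QStab.Sat (C.asem α) (C.sem ρ)) := by
  obtain ⟨h1, h2⟩ := QStab.asem_sound C α hα
  exact ⟨h1, fun h => QStab.sat_of_mem_cone h1 (h2 ρ hρ.1 (h.mem_cone hα))
    (C.sem_isPartialDensity ρ hρ).2⟩
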